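/- **Setting.** Let $n\ge 2$, $1\le q\le n-1$. Let $r:\mathbb C^n\to\mathbb R$ be $C^\infty$ with $D=\{r<0\}$ bounded and $\partial D=\{r=0\}$, and let $U$ be an open neighbourhood of $\partial D$ on which $r$ is strictly plurisubharmonic, all critical points of $r$ in $U$ are non-degenerate, and they lie on $\partial D$. Let $ds^2=\sum g_{jk}d\zeta_jd\bar\zeta_k$ be a smooth Hermitian metric on $\mathbb C^n$ with $g_{jk}=\partial^2r/\partial\zeta_j\partial\bar\zeta_k$ on $U$ (a Levi metric). Let $\rho(\zeta,z)$ be symmetric, positive off the diagonal, with $\rho^2$ smooth, and equal to the geodesic distance near the diagonal. Let $\gamma$ be a smooth positive function in $D$ which equals $|\partial r|$ (length in the metric $g$) on $D\cap U$. For $\epsilon>0$ put $r_\epsilon=r+\epsilon$, $D_\epsilon=\{r_\epsilon<0\}$. With $$F(\zeta,z)=\sum_j\tfrac{\partial r}{\partial\zeta_j}(\zeta)(\zeta_j-z_j)-\tfrac12\sum_{j,k}\tfrac{\partial^2 r}{\partial\zeta_j\partial\zeta_k}(\zeta)(\zeta_j-z_j)(\zeta_k-z_k),$$ a smooth $\varphi(\zeta,z)\in[0,1]$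 equal to $1$ for $\rho^2\le\kappa/2$ and to $0$ for $\rho^2\ge\frac34\kappa$, and a smooth $\chi(\zeta)\in[0,1]$ equal to $1$ for $|r|<\delta$ and to $0$ for $|r|>\frac32\delta$, let $$\phi_\epsilon=\varphi\,(F-r_\epsilon(\zeta))+(1-\varphi)\rho^2,\qquad P_\epsilon=\rho^2+2\frac{r_\epsilon(\zeta)}{\gamma(\zeta)}\frac{r_\epsilon(z)}{\gamma(z)},\qquad \alpha_\epsilon=\chi\frac{\partial r_\epsilon}{\phi_\epsilon},\qquad \beta_\epsilon=\frac{\partial_\zeta\rho^2}{P_\epsilon}.$$ For double forms (differentials in $\zeta$ commute with those in $z$), $\ast_\zeta$ the complex linear Hodge operator of $g$ in $\zeta$ and $\vartheta_\zeta=-\ast_\zeta\partial_\zeta\ast_\zeta$, put $\mathcal L_q^\epsilon=(-1)^{q+1}\ast_\zeta\overline{C_q^\epsilon}$, $$C_q^\epsilon=\sum_{\mu=0}^{n-q-2}\sum_{\nu=0}^{q}\frac{\binom{\mu+\nu}{\mu}\binom{n-2-\mu-\nu}{q-\nu}}{(2\pi i)^{n}}\,\alpha_\epsilon\wedge\beta_\epsilon\wedge(\bar\partial_\zeta\alpha_\epsilon)^\mu\wedge(\bar\partial_\zeta\beta_\epsilon)^{n-q-\mu-2}\wedge(\bar\partial_z\alpha_\epsilon)^\nu\wedge(\bar\partial_z\beta_\epsilon)^{q-\nu}$$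 (an empty sum is $0$), $\Gamma_{0,q}=\frac{(n-2)!}{2\pi^n}\rho^{2-2n}(\bar\partial_\zeta\partial_z\rho^2)^q$, and $$\mathcal T_q^\epsilon=\vartheta_\zeta\mathcal L_q^\epsilon-\partial_z\mathcal L_{q-1}^\epsilon+\bar\partial_\zeta\Gamma_{0,q}.$$ The operator on $D_\epsilon$ with kernel $\mathcal K$ is $f\mapsto\int_{D_\epsilon}f(\zeta)\wedge\ast_\zeta\overline{\mathcal K(\zeta,z)}$; let $\mathbf T_q^\epsilon$ be the one with kernel $\mathcal T_q^\epsilon$. **Classes of kernels.** Kernels are families indexed by $\epsilon\in(0,\epsilon_0)$; exponents, comparison functions, constants and neighbourhoods below do not depend on $\epsilon$. Let $\Delta_\epsilon=\overline D_\epsilon\times\overline D_\epsilon\setminus\{(\zeta,\zeta):\zeta\in\partial D_\epsilon\}$. On sets $W_\epsilon\subset\Delta_\epsilon$, $\mathcal E_{j,k}$ ($j\in\mathbb N$, $k\in\mathbb Z$) denotes smooth double forms on $W_\epsilon$ with $|\mathcal E_{j,k}(\zeta,z)|\le C|\xi_k(\zeta)||\zeta-z|^j$, where $\xi_k$ is smooth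 in $D$ and $\gamma^{a}|D^a\xi_k|\le C_a\gamma^k$ for every order $a$; $\mathcal E^*_{j,k}$ denotes forms $\mathcal E_{j,k}(z,\zeta)$, and similarly $\ast$ on functions interchanges the roles of $\zeta$ and $z$. $R_0=1$, and for $N>0$, $R_N$ is a finite sum of $N$-fold products of first derivatives of $r$. * An *isotropic* family $E_{1-2n}$ has kernels $\mathcal E_{m,0}/\rho^{2k}$ on $\overline D_\epsilon\times\overline D_\epsilon$ off the diagonal, $\mathcal E_{m,0}$ being defined on $\Delta_\epsilon$, with $m,k\in\mathbb N$, $m-2k\ge1-2n$. * An *admissible* family $A_1^\epsilon$ of type $\geq 1$ has kernels $\mathcal A^\epsilon$ that are smooth on $\overline D_\epsilon\times\overline D_\epsilon$ off the diagonal and such that each $x\in\overline D$ has a neighbourhood $V$ on which, on $(V\times V)\cap\Delta_\epsilon$, either $\mathcal A^\epsilon$ for all $\epsilon$ or $\overline{\mathcal A^\epsilon}$ for all $\epsilon$ has the form $$R_NR_M^*\,\mathcal E_{j,\alpha}\mathcal E_{k,\beta}^*\,P_\epsilon^{-t_0}\phi_\epsilon^{t_1}\bar\phi_\epsilon^{t_2}\phi_\epsilon^{*t_3}\bar\phi_\epsilon^{*t_4}r_\epsilon^l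 r_\epsilon^{*m}$$ with integers $N,M,j,k,t_0,l,m\ge0$, $t=-(t_1+t_2+t_3+t_4)\ge0$, $N+\alpha\ge0$, $M+\beta\ge0$, and type $\tau=s-\max\{0,2-N-M-\alpha-\beta\}\ge1$, where $s=2n+j+\min\{2,t-l-m\}-2(t_0+t-l-m)$. **Theorem.** For all sufficiently small $\kappa>0$, all sufficiently small $\delta>0$ (depending on $\kappa$) and every choice of $\varphi,\chi$ as above there is $\epsilon_0>0$ such that, for $0<\epsilon<\epsilon_0$, $$\mathbf T_q^\epsilon=E_{1-2n}+A_1^\epsilon,$$ an isotropic operator plus an admissible operator of type $1$, uniformly in $\epsilon$. That is, there are an isotropic family $\mathcal E^\epsilon$ and an admissible family $\mathcal A^\epsilon$ of type $\geq 1$ with $\mathcal T_q^\epsilon=\mathcal E^\epsilon+\mathcal A^\epsilon$ on $\overline D_\epsilon\times\overline D_\epsilon$ off the diagonal; and for every $f\in L^2(D_\epsilon)$ the integrals defining the operators with kernels $\mathcal E^\epsilon$ and $\mathcal A^\epsilon$ applied to $f$ converge absolutely at almost every $z\in D_\epsilon$, and their sum is $\mathbf T_q^\epsilon f(z)$. 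-/

import Mathlib

open MeasureTheory Topology
open scoped ContDiff ComplexConjugate ComplexOrder

namespace HL

noncomputable section

/-! ### Double differential forms on `ℂⁿ × ℂⁿ` -/

/-- `ℂⁿ` with its Euclidean norm. -/
abbrev Cn (n : ℕ) := EuclideanSpace ℂ (Fin n)

/-- Labels of the basic differentials in one variable: `(j, false)` is `dζ_j` and `(j, true)` is
its conjugate.  The order is `dζ_1, dζ̄_1, dζ_2, dζ̄_2, …`. -/
abbrev Gen (n : ℕ) := Fin n ×ₗ Bool

/-- The label of `dζ_j` (for `b = false`) or `dζ̄_j` (for `b = true`). -/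
def gen {n : ℕ} (j : Fin n) (b : Bool) : Gen n := toLex (j, b)

/-- Conjugation of labels. -/
def Gen.conj {n : ℕ} (a : Gen n) : Gen n := toLex ((ofLex a).1, !(ofLex a).2)

/-- Value at a point of a form in one variable: the coefficients with respect to the basis
`e_A`, the wedge product of the differentials in `A` in increasing order. -/
abbrev Form (n : ℕ) := Finset (Gen n) → ℂ

/-- Value at a point `(ζ, z)` of a double form: the coefficients with respect to
`e_A(ζ) ⊗ e_B(z)`.  Differentials in `ζ` commute with differentials in `z`. -/
abbrev DForm (n : ℕ) := Finset (Gen n) × Finset (Gen n) → ℂ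

/-- A double form `K(ζ, z)`; the first argument is `ζ`. -/
abbrev Kernel (n : ℕ) := Cn n → Cn n → DForm n

/-- `e_A ∧ e_B = shuffleSign A B • e_{A ∪ B}` for disjoint `A`, `B`. -/
def shuffleSign {n : ℕ} (A B : Finset (Gen n)) : ℂ :=
  (-1) ^ ((A ×ˢ B).filter (fun p => p.2 < p.1)).card

/-- Wedge product of double forms. -/
def wedge {n : ℕ} (F G : DForm n) : DForm n := fun S =>
  ∑ A ∈ S.1.powerset, ∑ B ∈ S.2.powerset,
    shuffleSign A (S.1 \ A) * shuffleSign B (S.2 \ B) * F (A, B) * G (S.1 \ A, S.2 \ B)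

/-- The double form `1`. -/
def oneForm {n : ℕ} : DForm n := Pi.single (∅, ∅) 1

/-- Wedge powers. -/
def wedgePow {n : ℕ} (F : DForm n) : ℕ → DForm n
  | 0 => oneForm
  | k + 1 => wedge F (wedgePow F k)

/-- The differential with label `a` in the variable `ζ`. -/
def genZeta {n : ℕ} (a : Gen n) : DForm n := Pi.single ({a}, ∅) 1

/-- The differential with label `a` in the variable `z`. -/
def genZ {n : ℕ} (a : Gen n) : DForm n := Pi.single (∅, {a}) 1

/-- A form in `ζ` regarded as a double form. -/
def inclZeta {n : ℕ} (F : Form n) : DForm n := fun S => if S.2 = ∅ then F S.1 else 0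

/-- The conjugate of `e_A` is `conjSign A • e_{Ā}`. -/
def conjSign {n : ℕ} (A : Finset (Gen n)) : ℂ :=
  (-1) ^ ((A ×ˢ A).filter (fun p => p.1 < p.2 ∧ p.2.conj < p.1.conj)).card

/-- Complex conjugation of double forms. -/
def conjForm {n : ℕ} (F : DForm n) : DForm n := fun S =>
  conjSign (S.1.image Gen.conj) * conjSign (S.2.image Gen.conj) *
    conj (F (S.1.image Gen.conj, S.2.image Gen.conj))

/-! ### Differential operators -/

/-- `∂f/∂ζ_j`. -/
def dd {n : ℕ} {F : Type*} [NormedAddCommGroup F] [NormedSpace ℝ F] [NormedSpace ℂ F]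
    (j : Fin n) (f : Cn n → F) (x : Cn n) : F :=
  (1 / 2 : ℂ) • (fderiv ℝ f x (EuclideanSpace.single j 1) -
    Complex.I • fderiv ℝ f x (EuclideanSpace.single j Complex.I))

/-- `∂f/∂ζ̄_j`. -/
def ddbar {n : ℕ} {F : Type*} [NormedAddCommGroup F] [NormedSpace ℝ F] [NormedSpace ℂ F]
    (j : Fin n) (f : Cn n → F) (x : Cn n) : F :=
  (1 / 2 : ℂ) • (fderiv ℝ f x (EuclideanSpace.single j 1) +
    Complex.I • fderiv ℝ f x (EuclideanSpace.single j Complex.I))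

/-- `∂_ζ`. -/
def delZeta {n : ℕ} (K : Kernel n) : Kernel n := fun ζ z =>
  ∑ j, wedge (genZeta (gen j false)) (dd j (fun w => K w z) ζ)

/-- `∂̄_ζ`. -/
def delbarZeta {n : ℕ} (K : Kernel n) : Kernel n := fun ζ z =>
  ∑ j, wedge (genZeta (gen j true)) (ddbar j (fun w => K w z) ζ)

/-- `∂_z`. -/
def delZ {n : ℕ} (K : Kernel n) : Kernel n := fun ζ z =>
  ∑ j, wedge (genZ (gen j false)) (dd j (fun w => K ζ w) z)

/-- `∂̄_z`. -/
def delbarZ {n : ℕ} (K : Kernel n) : Kernel n := fun ζ z =>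
  ∑ j, wedge (genZ (gen j true)) (ddbar j (fun w => K ζ w) z)

/-- A scalar function of `(ζ, z)` as a double form of degree zero. -/
def scalarKernel {n : ℕ} (f : Cn n → Cn n → ℂ) : Kernel n := fun ζ z => f ζ z • oneForm

/-! ### Hermitian metrics -/

/-- Complex bilinear extension to the differentials of the scalar product dual to the Riemannian
metric with `|v|² = ∑ g_{jk} v_j v̄_k`.  In particular `⟨dζ_j, dζ̄_k⟩ = 2 (g⁻¹)_{kj}`. -/
def genPairing {n : ℕ} (g : Matrix (Fin n) (Fin n) ℂ) (a b : Gen n) : ℂ :=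
  if (ofLex a).2 = false ∧ (ofLex b).2 = true then 2 * g⁻¹ (ofLex b).1 (ofLex a).1
  else if (ofLex a).2 = true ∧ (ofLex b).2 = false then 2 * g⁻¹ (ofLex a).1 (ofLex b).1
  else 0

/-- The induced bilinear pairing of `e_A` and `e_B`. -/
def formPairing {n : ℕ} (g : Matrix (Fin n) (Fin n) ℂ) (A B : Finset (Gen n)) : ℂ :=
  if h : B.card = A.card then
    (Matrix.of fun i j : Fin A.card =>
      genPairing g (A.orderEmbOfFin rfl i) (B.orderEmbOfFin h j)).det
  else 0

/-- Coefficient of the volume form with respect to `dζ_1 ∧ dζ̄_1 ∧ dζ_2 ∧ dζ̄_2 ∧ ⋯`. -/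
def volCoeff {n : ℕ} (g : Matrix (Fin n) (Fin n) ℂ) : ℂ := (Complex.I / 2) ^ n * g.det

/-- The complex linear Hodge operator `∗_ζ`, characterized by `e_A ∧ ∗β = ⟨e_A, β⟩ dV`, where
`⟨·,·⟩` is the bilinear pairing; it acts on the differentials in `ζ` only. -/
def starZeta {n : ℕ} (g : Matrix (Fin n) (Fin n) ℂ) (F : DForm n) : DForm n := fun S =>
  shuffleSign S.1ᶜ S.1 * volCoeff g * ∑ B, formPairing g S.1ᶜ B * F (B, S.2)

/-- `ϑ_ζ = -∗_ζ ∂_ζ ∗_ζ`, the formal adjoint of `∂̄_ζ` for the metric `g`. -/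
def thetaZeta {n : ℕ} (g : Cn n → Matrix (Fin n) (Fin n) ℂ) (K : Kernel n) : Kernel n :=
  fun ζ z => -starZeta (g ζ) (delZeta (fun ζ z => starZeta (g ζ) (K ζ z)) ζ z)

/-- Geodesic distance of the metric `g`: the infimum of the lengths of the `C¹` curves from
`x` to `y`. -/
def geodDist {n : ℕ} (g : Cn n → Matrix (Fin n) (Fin n) ℂ) (x y : Cn n) : ℝ :=
  sInf {L : ℝ | ∃ c : ℝ → Cn n, ContDiff ℝ 1 c ∧ c 0 = x ∧ c 1 = y ∧
    L = ∫ t in (0 : ℝ)..1, Real.sqrt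
      (∑ j, ∑ k, g (c t) j k * (deriv c t) j * conj ((deriv c t) k)).re}

/-! ### The domain, the metric and the auxiliary functions -/

/-- `D = {r < 0}`. -/
def dom {n : ℕ} (r : Cn n → ℝ) : Set (Cn n) := {x | r x < 0}

/-- `D_ε = {r_ε < 0}` with `r_ε = r + ε`. -/
def domEps {n : ℕ} (r : Cn n → ℝ) (ε : ℝ) : Set (Cn n) := {x | r x + ε < 0}

/-- `∂r/∂ζ_j`. -/
def dr {n : ℕ} (r : Cn n → ℝ) (j : Fin n) (x : Cn n) : ℂ := dd j (fun y => (r y : ℂ)) x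

/-- The Levi matrix `∂²r/∂ζ_j∂ζ̄_k`. -/
def leviMatrix {n : ℕ} (r : Cn n → ℝ) (x : Cn n) : Matrix (Fin n) (Fin n) ℂ :=
  Matrix.of fun j k => ddbar k (dr r j) x

/-- `D = {r < 0}` is a bounded Henkin-Leiterer domain whose defining function `r` is strictly
plurisubharmonic and Morse in the neighbourhood `U` of `∂D`, with no critical points in
`U` off `∂D`. -/
structure IsHenkinLeiterer {n : ℕ} (r : Cn n → ℝ) (U : Set (Cn n)) : Prop where
  smooth : ContDiff ℝ ∞ r
  bounded : Bornology.IsBounded (dom r)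
  boundary : frontier (dom r) = {x | r x = 0}
  isOpen : IsOpen U
  boundary_subset : frontier (dom r) ⊆ U
  strictlyPsh : ∀ x ∈ U, (leviMatrix r x).PosDef
  morse : ∀ x ∈ U, fderiv ℝ r x = 0 →
    ∀ v, (∀ w, fderiv ℝ (fderiv ℝ r) x v w = 0) → v = 0
  critical : ∀ x ∈ U, fderiv ℝ r x = 0 → x ∈ frontier (dom r)

/-- A smooth Hermitian metric on `ℂⁿ` which is the Levi metric of `r` on `U`. -/
structure IsLeviMetric {n : ℕ} (r : Cn n → ℝ) (U : Set (Cn n))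
    (g : Cn n → Matrix (Fin n) (Fin n) ℂ) : Prop where
  smooth : ∀ j k, ContDiff ℝ ∞ (fun x => g x j k)
  posDef : ∀ x, (g x).PosDef
  eq_levi : ∀ x ∈ U, g x = leviMatrix r x

/-- A symmetric function, positive off the diagonal, with smooth square, which coincides with the
geodesic distance near the diagonal. -/
structure IsDistance {n : ℕ} (g : Cn n → Matrix (Fin n) (Fin n) ℂ)
    (ρ : Cn n → Cn n → ℝ) : Prop where
  smooth_sq : ContDiff ℝ ∞ (fun p : Cn n × Cn n => ρ p.1 p.2 ^ 2)
  symm : ∀ x y, ρ x y = ρ y x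
  pos : ∀ x y, x ≠ y → 0 < ρ x y
  eq_geodDist : ∀ᶠ p in 𝓝ˢ {p : Cn n × Cn n | p.1 = p.2}, ρ p.1 p.2 = geodDist g p.1 p.2

/-- The length `|∂r|` in the metric `g`. -/
def normDr {n : ℕ} (r : Cn n → ℝ) (g : Cn n → Matrix (Fin n) (Fin n) ℂ) (x : Cn n) : ℝ :=
  Real.sqrt (∑ j, ∑ k, 2 * (g x)⁻¹ k j * dr r j x * conj (dr r k x)).re

/-- `γ` is a smooth positive function in `D` equal to `|∂r|` near `∂D`. -/
structure IsGamma {n : ℕ} (r : Cn n → ℝ) (U : Set (Cn n))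
    (g : Cn n → Matrix (Fin n) (Fin n) ℂ) (γ : Cn n → ℝ) : Prop where
  smooth : ContDiffOn ℝ ∞ γ (dom r)
  pos : ∀ x ∈ dom r, 0 < γ x
  eq_norm : ∀ x ∈ dom r ∩ U, γ x = normDr r g x

/-- The patching function `φ(ζ, z)`, for the parameter `κ`. -/
structure IsPatching {n : ℕ} (ρ : Cn n → Cn n → ℝ) (κ : ℝ) (φ : Cn n → Cn n → ℝ) : Prop where
  smooth : ContDiff ℝ ∞ (fun p : Cn n × Cn n => φ p.1 p.2)
  range : ∀ x y, φ x y ∈ Set.Icc (0 : ℝ) 1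
  eq_one : ∀ x y, ρ x y ^ 2 ≤ κ / 2 → φ x y = 1
  eq_zero : ∀ x y, 3 / 4 * κ ≤ ρ x y ^ 2 → φ x y = 0

/-- The cut-off function `χ(ζ)`, for the parameter `δ`. -/
structure IsCutoff {n : ℕ} (r : Cn n → ℝ) (δ : ℝ) (χ : Cn n → ℝ) : Prop where
  smooth : ContDiff ℝ ∞ χ
  range : ∀ x, χ x ∈ Set.Icc (0 : ℝ) 1
  eq_one : ∀ x, |r x| < δ → χ x = 1
  eq_zero : ∀ x, 3 / 2 * δ < |r x| → χ x = 0

/-- The Levi polynomial `F(ζ, z)`. -/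
def leviPoly {n : ℕ} (r : Cn n → ℝ) (ζ z : Cn n) : ℂ :=
  ∑ j, dr r j ζ * (ζ j - z j) -
    1 / 2 * ∑ j, ∑ k, dd k (dr r j) ζ * (ζ j - z j) * (ζ k - z k)

/-- `φ_ε(ζ, z)`. -/
def phi {n : ℕ} (r : Cn n → ℝ) (ρ φ : Cn n → Cn n → ℝ) (ε : ℝ) (ζ z : Cn n) : ℂ :=
  φ ζ z * (leviPoly r ζ z - ((r ζ + ε : ℝ) : ℂ)) + (1 - φ ζ z) * ((ρ ζ z ^ 2 : ℝ) : ℂ)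

/-- `P_ε(ζ, z)`. -/
def PP {n : ℕ} (r γ : Cn n → ℝ) (ρ : Cn n → Cn n → ℝ) (ε : ℝ) (ζ z : Cn n) : ℝ :=
  ρ ζ z ^ 2 + 2 * ((r ζ + ε) / γ ζ) * ((r z + ε) / γ z)

/-! ### The kernels -/

/-- `∂_ζ ρ²`. -/
def delRhoSq {n : ℕ} (ρ : Cn n → Cn n → ℝ) : Kernel n :=
  delZeta (scalarKernel fun ζ z => ((ρ ζ z ^ 2 : ℝ) : ℂ))

/-- `α_ε = χ ∂r_ε / φ_ε`. -/
def alphaForm {n : ℕ} (r χ : Cn n → ℝ) (ρ φ : Cn n → Cn n → ℝ) (ε : ℝ) : Kernel n := fun ζ z =>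
  ((χ ζ : ℂ) / phi r ρ φ ε ζ z) • ∑ j, dr r j ζ • genZeta (gen j false)

/-- `β_ε = ∂_ζ ρ² / P_ε`. -/
def betaForm {n : ℕ} (r γ : Cn n → ℝ) (ρ : Cn n → Cn n → ℝ) (ε : ℝ) : Kernel n := fun ζ z =>
  ((PP r γ ρ ε ζ z : ℂ))⁻¹ • delRhoSq ρ ζ z

/-- `C_{qμν}(α, β)`. -/
def Cqmn {n : ℕ} (q μ ν : ℕ) (α β : Kernel n) : Kernel n := fun ζ z =>
  wedge (α ζ z) <| wedge (β ζ z) <|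
    wedge (wedgePow (delbarZeta α ζ z) μ) <|
    wedge (wedgePow (delbarZeta β ζ z) (n - q - μ - 2)) <|
    wedge (wedgePow (delbarZ α ζ z) ν) (wedgePow (delbarZ β ζ z) (q - ν))

/-- `C_q(α, β)`; the sum over `0 ≤ μ ≤ n - q - 2` is empty for `q = n - 1`. -/
def Cq {n : ℕ} (q : ℕ) (α β : Kernel n) : Kernel n := fun ζ z =>
  ∑ μ ∈ Finset.range (n - q - 1), ∑ ν ∈ Finset.range (q + 1),
    ((1 / (2 * Real.pi * Complex.I)) ^ n * ((μ + ν).choose μ : ℂ) *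
      ((n - 2 - μ - ν).choose (q - ν) : ℂ)) • Cqmn q μ ν α β ζ z

/-- `L_q^ε = (-1)^{q+1} ∗_ζ conj(C_q^ε)`. -/
def LKer {n : ℕ} (r γ χ : Cn n → ℝ) (g : Cn n → Matrix (Fin n) (Fin n) ℂ)
    (ρ φ : Cn n → Cn n → ℝ) (q : ℕ) (ε : ℝ) : Kernel n := fun ζ z =>
  (-1 : ℂ) ^ (q + 1) • starZeta (g ζ)
    (conjForm (Cq q (alphaForm r χ ρ φ ε) (betaForm r γ ρ ε) ζ z))

/-- `Γ_{0,q}`. -/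
def GammaKer {n : ℕ} (ρ : Cn n → Cn n → ℝ) (q : ℕ) : Kernel n := fun ζ z =>
  (((n - 2).factorial : ℂ) / (2 * (Real.pi : ℂ) ^ n) *
      (((ρ ζ z ^ (2 * n - 2) : ℝ) : ℂ))⁻¹) •
    wedgePow (delbarZeta (delZ (scalarKernel fun ζ z => ((ρ ζ z ^ 2 : ℝ) : ℂ))) ζ z) q

/-- The kernel of `T_q^ε`, for `q ≥ 1`. -/
def TKer {n : ℕ} (r γ χ : Cn n → ℝ) (g : Cn n → Matrix (Fin n) (Fin n) ℂ)
    (ρ φ : Cn n → Cn n → ℝ) (q : ℕ) (ε : ℝ) : Kernel n := fun ζ z =>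
  thetaZeta g (LKer r γ χ g ρ φ q ε) ζ z - delZ (LKer r γ χ g ρ φ (q - 1) ε) ζ z +
    delbarZeta (GammaKer ρ q) ζ z

/-! ### Operators -/

/-- The integrand, with respect to Lebesgue measure in `ζ`, of `∫ f ∧ ∗_ζ conj(K(·, z))`; the top
form `(i/2)ⁿ dζ_1 ∧ dζ̄_1 ∧ ⋯ ∧ dζ_n ∧ dζ̄_n` is Lebesgue measure. -/
def integrand {n : ℕ} (g : Cn n → Matrix (Fin n) (Fin n) ℂ) (K : Kernel n) (f : Cn n → Form n)
    (z ζ : Cn n) : Form n := fun B =>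
  wedge (inclZeta (f ζ)) (starZeta (g ζ) (conjForm (K ζ z))) (Finset.univ, B) *
    ((Complex.I / 2) ^ n)⁻¹

/-- The operator on `D_ε` with kernel `K`: `f ↦ (f, K(·, z))_{D_ε} = ∫_{D_ε} f ∧ ∗_ζ conj(K)`. -/
def kernelOp {n : ℕ} (r : Cn n → ℝ) (g : Cn n → Matrix (Fin n) (Fin n) ℂ) (ε : ℝ)
    (K : Kernel n) (f : Cn n → Form n) (z : Cn n) : Form n :=
  ∫ ζ in domEps r ε, integrand g K f z ζ

/-! ### Isotropic and admissible kernels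

All families are indexed by `ε ∈ (0, ε₀)`, and all exponents, comparison functions, constants and
neighbourhoods are independent of `ε`. -/

/-- `D̄_ε × D̄_ε` without the boundary diagonal (where `φ_ε` and `P_ε` vanish). -/
def kerDom {n : ℕ} (r : Cn n → ℝ) (ε : ℝ) : Set (Cn n × Cn n) :=
  (closure (domEps r ε) ×ˢ closure (domEps r ε)) \
    {p | p.1 = p.2 ∧ p.1 ∈ frontier (domEps r ε)}

/-- The weights `ξ_k`: smooth in `D` with `|γ^a D_a ξ_k| ≲ γ^k` for all orders `a`. -/
def IsWeight {n : ℕ} (r γ : Cn n → ℝ) (k : ℤ) (ξ : Cn n → ℝ) : Prop :=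
  ContDiffOn ℝ ∞ ξ (dom r) ∧
    ∀ a : ℕ, ∃ C : ℝ, ∀ x ∈ dom r, γ x ^ a * ‖iteratedFDeriv ℝ a ξ x‖ ≤ C * γ x ^ k

/-- `K^ε = 𝓔_{j,k}` on the sets `W ε`, uniformly in `ε`. -/
def IsE {n : ℕ} (r γ : Cn n → ℝ) (ε₀ : ℝ) (W : ℝ → Set (Cn n × Cn n)) (j : ℕ) (k : ℤ)
    (K : ℝ → Kernel n) : Prop :=
  ∃ ξ : Cn n → ℝ, IsWeight r γ k ξ ∧ ∃ C : ℝ, ∀ ε ∈ Set.Ioo 0 ε₀,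
    ContDiffOn ℝ ∞ (fun p : Cn n × Cn n => K ε p.1 p.2) (W ε) ∧
    ∀ p ∈ W ε, ‖K ε p.1 p.2‖ ≤ C * |ξ p.1| * ‖p.1 - p.2‖ ^ j

/-- The double form `K(z, ζ)`. -/
def swapKernel {n : ℕ} (K : Kernel n) : Kernel n := fun ζ z S => K z ζ S.swap

/-- `K^ε = 𝓔*_{j,k}`, that is, `K^ε(ζ, z) = 𝓔_{j,k}(z, ζ)`, on the sets `W ε`. -/
def IsEStar {n : ℕ} (r γ : Cn n → ℝ) (ε₀ : ℝ) (W : ℝ → Set (Cn n × Cn n)) (j : ℕ) (k : ℤ)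
    (K : ℝ → Kernel n) : Prop :=
  IsE r γ ε₀ (fun ε => Prod.swap ⁻¹' W ε) j k (fun ε => swapKernel (K ε))

/-- `R_N`: `R_0 = 1`, and for `N > 0` a finite sum of `N`-fold products of first derivatives
`∂r/∂ζ_j`, `∂r/∂ζ̄_j` of `r`. -/
def IsR {n : ℕ} (r : Cn n → ℝ) (N : ℕ) (R : Cn n → ℂ) : Prop :=
  if N = 0 then R = fun _ => 1
  else ∃ (m : ℕ) (c : Fin m → Fin N → Fin n × Bool), ∀ x,
    R x = ∑ i, ∏ k, if (c i k).2 then conj (dr r (c i k).1 x) else dr r (c i k).1 x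

/-- The exponents in the representation of an admissible kernel. -/
structure Exponents where
  N : ℕ
  M : ℕ
  j : ℕ
  k : ℕ
  α : ℤ
  β : ℤ
  t₀ : ℕ
  t₁ : ℤ
  t₂ : ℤ
  t₃ : ℤ
  t₄ : ℤ
  l : ℕ
  m : ℕ
  sum_nonpos : t₁ + t₂ + t₃ + t₄ ≤ 0
  N_add_nonneg : 0 ≤ N + α
  M_add_nonneg : 0 ≤ M + β

/-- `t = -(t₁ + t₂ + t₃ + t₄)`. -/
def Exponents.t (e : Exponents) : ℤ := -(e.t₁ + e.t₂ + e.t₃ + e.t₄)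

/-- The smooth type `s`. -/
def Exponents.smoothType (e : Exponents) (n : ℕ) : ℤ :=
  2 * n + e.j + min 2 (e.t - e.l - e.m) - 2 * (e.t₀ + e.t - e.l - e.m)

/-- The type `τ`. -/
def Exponents.type (e : Exponents) (n : ℕ) : ℤ :=
  e.smoothType n - max 0 (2 - e.N - e.M - e.α - e.β)

/-- `R_N R_M^* 𝓔 𝓔^* P^{-t₀} φ^{t₁} φ̄^{t₂} φ^{* t₃} φ̄^{* t₄} r^l r^{* m}`. -/
def admissibleForm {n : ℕ} (r γ : Cn n → ℝ) (ρ φ : Cn n → Cn n → ℝ) (e : Exponents)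
    (R Rs : Cn n → ℂ) (E Es : Kernel n) (ε : ℝ) : Kernel n := fun ζ z =>
  (R ζ * Rs z * ((PP r γ ρ ε ζ z : ℂ) ^ e.t₀)⁻¹ *
      phi r ρ φ ε ζ z ^ e.t₁ * conj (phi r ρ φ ε ζ z) ^ e.t₂ *
      phi r ρ φ ε z ζ ^ e.t₃ * conj (phi r ρ φ ε z ζ) ^ e.t₄ *
      ((r ζ + ε : ℝ) : ℂ) ^ e.l * ((r z + ε : ℝ) : ℂ) ^ e.m) • wedge (E ζ z) (Es ζ z)

/-- Admissible kernels of type `≥ τ` on `D̄_ε × D̄_ε`, uniformly in `ε ∈ (0, ε₀)`. -/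
structure IsAdmissible {n : ℕ} (r γ : Cn n → ℝ) (ρ φ : Cn n → Cn n → ℝ) (ε₀ : ℝ) (τ : ℤ)
    (A : ℝ → Kernel n) : Prop where
  smooth : ∀ ε ∈ Set.Ioo 0 ε₀, ContDiffOn ℝ ∞ (fun p : Cn n × Cn n => A ε p.1 p.2)
    ((closure (domEps r ε) ×ˢ closure (domEps r ε)) \ {p | p.1 = p.2})
  representation : ∀ x ∈ closure (dom r), ∃ V ∈ 𝓝 x, ∃ e : Exponents, τ ≤ e.type n ∧
    ∃ (R Rs : Cn n → ℂ) (E Es : ℝ → Kernel n),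
      IsR r e.N R ∧ IsR r e.M Rs ∧
      IsE r γ ε₀ (fun ε => V ×ˢ V ∩ kerDom r ε) e.j e.α E ∧
      IsEStar r γ ε₀ (fun ε => V ×ˢ V ∩ kerDom r ε) e.k e.β Es ∧
      ((∀ ε ∈ Set.Ioo 0 ε₀, ∀ p ∈ V ×ˢ V ∩ kerDom r ε,
          A ε p.1 p.2 = admissibleForm r γ ρ φ e R Rs (E ε) (Es ε) ε p.1 p.2) ∨
        (∀ ε ∈ Set.Ioo 0 ε₀, ∀ p ∈ V ×ˢ V ∩ kerDom r ε,
          conjForm (A ε p.1 p.2) = admissibleForm r γ ρ φ e R Rs (E ε) (Es ε) ε p.1 p.2))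

/-- Isotropic kernels `𝓔_{m,0} / ρ^{2k}` with `m - 2k ≥ s`, uniformly in `ε ∈ (0, ε₀)`. -/
def IsIsotropic {n : ℕ} (r γ : Cn n → ℝ) (ρ : Cn n → Cn n → ℝ) (ε₀ : ℝ) (s : ℤ)
    (K : ℝ → Kernel n) : Prop :=
  ∃ (m k : ℕ) (E : ℝ → Kernel n), s ≤ (m : ℤ) - 2 * k ∧
    IsE r γ ε₀ (kerDom r) m 0 E ∧
    ∀ ε ∈ Set.Ioo 0 ε₀, ∀ ζ ∈ closure (domEps r ε), ∀ z ∈ closure (domEps r ε), ζ ≠ z →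
      K ε ζ z = (((ρ ζ z ^ (2 * k) : ℝ) : ℂ))⁻¹ • E ε ζ z

end

end HL

namespace HL

noncomputable section

/-! ### Algebra of double forms -/

section Algebra

variable {n : ℕ}

/-! Write d = |ζ - z|, r_ε = r + ε and H = ϑ_ζ L_q - ∂_z L_{q-1}. The classes 𝓔_{j,k} ask a
numerator to be smooth and of a given size; they ask nothing about the size of its derivatives. It
is therefore enough to cut H smoothly into two pieces of the right size, and everything reduces to
one pointwise estimate, uniform in ε (`exists_homotopyKer_bound`): |H| ≤ C (1/d + |∂r(ζ)|² d /
|φ_ε|²) P_ε^{-(n-1)}.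

The cut is made with w = x²/(1+x²), where x = |∂r(ζ)|² d² / |φ_ε|² is the ratio of the two terms in
the bracket (`splitWeight`, `weight_ineq`). The piece wH is bounded by |∂r|² d |φ_ε|⁻² P_ε^{-(n-1)}.
Since |∂r|² is a weight of order 2 (`isWeight_gradSq`), this is an admissible kernel with j = 1, α =
2, t₀ = n-1, t₁ = -2, whose type is exactly 1. The piece (1-w)H is bounded by d⁻¹ P_ε^{-(n-1)},
which is at most a multiple of d^{1-2n} because P_ε ≥ ρ² and ρ is comparable to d. Together with
∂̄_ζ Γ_{0,q} it forms the isotropic part.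

The estimate of H starts from algebra. The 2-form ∂r ∧ ∂_ζρ² commutes with everything and kills all
multiples of its factors. In C_q all derivatives of the scalar factors χ/φ_ε and 1/P_ε therefore
drop out. As ∂r(ζ) does not depend on z, ∂̄_z α_ε is a multiple of ∂r and only ν = 0 survives. Thus
C_q is a sum of terms (χ/φ_ε)^{μ+1} P_ε^{-(n-1-μ)} N_μ (`Cq_smulKernel`), where N_μ = O(|∂r| d) and
DN_μ = O(|∂r| + d) (`exists_numer_bound`). H involves C_q, C_{q-1} and their first derivatives only.

The analytic input is as follows. Strict plurisubharmonicity and Taylor's formula give Re φ_ε ≥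
c(|r_ε(ζ)| + |r_ε(z)| + d²) (`exists_phi_lower`), and P_ε is bounded above by the same quantity. The
Morse condition gives |r| = O(|∂r|²) near the boundary, hence |r| = O(γ²). With s = r_ε/γ this
yields s² = O(|r_ε|) and Ds = O(1), so DP_ε = O(d + |s(ζ)| + |s(z)|), while Dφ_ε = O(|∂r(ζ)| + d).
The inequality `term_bound` combines these.

Where φ_ε might vanish, χ is zero and so is H. For the operators, the isotropic part is dominated by
the integrable convolution kernel d^{1-2n}. For fixed z in D_ε the admissible part is bounded in ζ.
-/

lemma wedge_add (F G H : DForm n) : wedge F (G + H) = wedge F G + wedge F H := by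
  funext S
  simp only [wedge, Pi.add_apply, mul_add, Finset.sum_add_distrib]

lemma add_wedge (F G H : DForm n) : wedge (F + G) H = wedge F H + wedge G H := by
  funext S
  simp only [wedge, Pi.add_apply, mul_add, add_mul, Finset.sum_add_distrib]

lemma smul_wedge (c : ℂ) (F G : DForm n) : wedge (c • F) G = c • wedge F G := by
  funext S
  simp only [wedge, Pi.smul_apply, smul_eq_mul, Finset.mul_sum]
  refine Finset.sum_congr rfl fun A _ => Finset.sum_congr rfl fun B _ => ?_
  ring

lemma wedge_smul (c : ℂ) (F G : DForm n) : wedge F (c • G) = c • wedge F G := by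
  funext S
  simp only [wedge, Pi.smul_apply, smul_eq_mul, Finset.mul_sum]
  refine Finset.sum_congr rfl fun A _ => Finset.sum_congr rfl fun B _ => ?_
  ring

/-- The wedge product as a bilinear map. -/
def wedgeLin : DForm n →ₗ[ℂ] DForm n →ₗ[ℂ] DForm n :=
  LinearMap.mk₂ ℂ wedge add_wedge smul_wedge wedge_add wedge_smul

@[simp] lemma wedge_zero (F : DForm n) : wedge F 0 = 0 := (wedgeLin F).map_zero

@[simp] lemma zero_wedge (F : DForm n) : wedge 0 F = 0 := wedgeLin.map_zero₂ F

lemma sum_wedge {ι : Type*} (s : Finset ι) (F : ι → DForm n) (G : DForm n) :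
    wedge (∑ i ∈ s, F i) G = ∑ i ∈ s, wedge (F i) G := wedgeLin.map_sum₂ s F G

/-! ### Shuffle signs, associativity and graded commutativity of the wedge product -/

lemma shuffleSign_union_left {A B : Finset (Gen n)} (h : Disjoint A B) (C : Finset (Gen n)) :
    shuffleSign (A ∪ B) C = shuffleSign A C * shuffleSign B C := by
  rw [shuffleSign, shuffleSign, shuffleSign, ← pow_add, Finset.union_product,
    Finset.filter_union, Finset.card_union_of_disjoint]
  refine Finset.disjoint_filter_filter ?_
  exact Finset.disjoint_product.2 (Or.inl h)

lemma shuffleSign_union_right {B C : Finset (Gen n)} (h : Disjoint B C) (A : Finset (Gen n)) :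
    shuffleSign A (B ∪ C) = shuffleSign A B * shuffleSign A C := by
  rw [shuffleSign, shuffleSign, shuffleSign, ← pow_add, Finset.product_union,
    Finset.filter_union, Finset.card_union_of_disjoint]
  refine Finset.disjoint_filter_filter ?_
  exact Finset.disjoint_product.2 (Or.inr h)

@[simp] lemma shuffleSign_empty_left (A : Finset (Gen n)) : shuffleSign ∅ A = 1 := by
  simp [shuffleSign]

@[simp] lemma shuffleSign_empty_right (A : Finset (Gen n)) : shuffleSign A ∅ = 1 := by
  simp [shuffleSign]

/-- Each pair (a, b) in A × B is an inversion in exactly one of the two orders, since disjointness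
excludes a = b. The two inversion counts therefore add up to |A||B|. -/
lemma shuffleSign_comm {A B : Finset (Gen n)} (h : Disjoint A B) :
    shuffleSign A B = (-1) ^ (A.card * B.card) * shuffleSign B A := by
  have key : ((A ×ˢ B).filter (fun p => p.2 < p.1)).card
      + ((B ×ˢ A).filter (fun p => p.2 < p.1)).card = A.card * B.card := by
    have h1 : ((B ×ˢ A).filter (fun p => p.2 < p.1)).card
        = ((A ×ˢ B).filter (fun p => ¬ p.2 < p.1)).card := by
      refine Finset.card_bij (fun p _ => p.swap) ?_ ?_ ?_
      · rintro ⟨x, y⟩ hp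
        simp only [Finset.mem_filter, Finset.mem_product, Prod.swap] at hp ⊢
        exact ⟨⟨hp.1.2, hp.1.1⟩, not_lt.2 hp.2.le⟩
      · rintro p _ q _ hpq
        exact Prod.swap_injective hpq
      · rintro ⟨x, y⟩ hp
        simp only [Finset.mem_filter, Finset.mem_product] at hp
        refine ⟨(y, x), ?_, rfl⟩
        simp only [Finset.mem_filter, Finset.mem_product]
        refine ⟨⟨hp.1.2, hp.1.1⟩, lt_of_le_of_ne (not_lt.1 hp.2) ?_⟩
        rintro rfl
        exact Finset.disjoint_left.1 h hp.1.1 hp.1.2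
    rw [h1, Finset.card_filter_add_card_filter_not, Finset.card_product]
  rw [← key, pow_add, shuffleSign, shuffleSign, mul_assoc, ← mul_pow]
  simp

/-- Both sides run over the ordered partitions of S into three pieces; a nested pair B ⊆ A
corresponds to the pieces B, A \ B, S \ A. This is the reindexing behind associativity. -/
lemma sum_powerset_powerset (S : Finset (Gen n))
    (f : Finset (Gen n) → Finset (Gen n) → Finset (Gen n) → ℂ) :
    ∑ A ∈ S.powerset, ∑ B ∈ A.powerset, f B (A \ B) (S \ A) =
      ∑ B ∈ S.powerset, ∑ C ∈ (S \ B).powerset, f B C ((S \ B) \ C) := by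
  rw [Finset.sum_sigma', Finset.sum_sigma']
  refine Finset.sum_nbij' (fun p => ⟨p.2, p.1 \ p.2⟩) (fun p => ⟨p.1 ∪ p.2, p.1⟩) ?_ ?_ ?_ ?_ ?_
  · rintro ⟨A, B⟩ h
    simp only [Finset.mem_sigma, Finset.mem_powerset] at h ⊢
    exact ⟨h.2.trans h.1, Finset.sdiff_subset_sdiff h.1 le_rfl⟩
  · rintro ⟨B, C⟩ h
    simp only [Finset.mem_sigma, Finset.mem_powerset] at h ⊢
    exact ⟨Finset.union_subset h.1 (h.2.trans Finset.sdiff_subset), Finset.subset_union_left⟩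
  · rintro ⟨A, B⟩ h
    simp only [Finset.mem_sigma, Finset.mem_powerset] at h
    simp [Finset.union_sdiff_of_subset h.2]
  · rintro ⟨B, C⟩ h
    simp only [Finset.mem_sigma, Finset.mem_powerset] at h
    have : Disjoint B C := Finset.disjoint_of_subset_right h.2 Finset.disjoint_sdiff
    simp [Finset.union_sdiff_cancel_left this]
  · rintro ⟨A, B⟩ h
    simp only [Finset.mem_sigma, Finset.mem_powerset] at h
    congr 1
    rw [sdiff_sdiff_left]
    congr 1
    exact (Finset.union_sdiff_of_subset h.2).symm

lemma shuffleSign_cocycle {S B C : Finset (Gen n)} (hC : C ⊆ S \ B) :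
    shuffleSign (B ∪ C) (S \ (B ∪ C)) * shuffleSign B C =
      shuffleSign B (S \ B) * shuffleSign C ((S \ B) \ C) := by
  have h1 : Disjoint B C := Finset.disjoint_of_subset_right hC Finset.disjoint_sdiff
  have h2 : S \ (B ∪ C) = (S \ B) \ C := by rw [sdiff_sdiff_left]; rfl
  have h3 : S \ B = C ∪ ((S \ B) \ C) := (Finset.union_sdiff_of_subset hC).symm
  have h4 : shuffleSign B (S \ B) = shuffleSign B C * shuffleSign B ((S \ B) \ C) := by
    rw [← shuffleSign_union_right Finset.disjoint_sdiff, ← h3]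
  rw [h2, shuffleSign_union_left h1, h4]
  ring

/-- Either bracketing expands into a sum over partitions of the ζ-labels and of the z-labels into
three pieces. The signs agree by `shuffleSign_cocycle`, once for each set of labels. -/
lemma wedge_assoc (F G H : DForm n) : wedge (wedge F G) H = wedge F (wedge G H) := by
  funext S
  have hL : wedge (wedge F G) H S = ∑ A ∈ S.1.powerset, ∑ B ∈ A.powerset,
      ∑ A' ∈ S.2.powerset, ∑ B' ∈ A'.powerset,
        (shuffleSign (B ∪ A \ B) (S.1 \ (B ∪ A \ B)) * shuffleSign B (A \ B)) *
          (shuffleSign (B' ∪ A' \ B') (S.2 \ (B' ∪ A' \ B')) * shuffleSign B' (A' \ B')) *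
          F (B, B') * G (A \ B, A' \ B') * H (S.1 \ A, S.2 \ A') := by
    rw [wedge]
    refine Finset.sum_congr rfl fun A hA => ?_
    rw [Finset.sum_comm]
    refine Finset.sum_congr rfl fun A' hA' => ?_
    rw [wedge, Finset.mul_sum, Finset.sum_mul]
    refine Finset.sum_congr rfl fun B hB => ?_
    rw [Finset.mul_sum, Finset.sum_mul]
    refine Finset.sum_congr rfl fun B' hB' => ?_
    rw [Finset.union_sdiff_of_subset (Finset.mem_powerset.1 hB),
      Finset.union_sdiff_of_subset (Finset.mem_powerset.1 hB')]
    ring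
  have hR : wedge F (wedge G H) S = ∑ B ∈ S.1.powerset, ∑ C ∈ (S.1 \ B).powerset,
      ∑ B' ∈ S.2.powerset, ∑ C' ∈ (S.2 \ B').powerset,
        (shuffleSign B (S.1 \ B) * shuffleSign C ((S.1 \ B) \ C)) *
          (shuffleSign B' (S.2 \ B') * shuffleSign C' ((S.2 \ B') \ C')) *
          F (B, B') * G (C, C') * H ((S.1 \ B) \ C, (S.2 \ B') \ C') := by
    rw [wedge]
    refine Finset.sum_congr rfl fun B hB => ?_
    rw [Finset.sum_comm]
    refine Finset.sum_congr rfl fun B' hB' => ?_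
    rw [wedge, Finset.mul_sum]
    refine Finset.sum_congr rfl fun C hC => ?_
    rw [Finset.mul_sum]
    refine Finset.sum_congr rfl fun C' hC' => ?_
    ring
  rw [hL, hR]
  have e1 := sum_powerset_powerset S.1 (fun B C D => ∑ A' ∈ S.2.powerset, ∑ B' ∈ A'.powerset,
        (shuffleSign (B ∪ C) (S.1 \ (B ∪ C)) * shuffleSign B C) *
          (shuffleSign (B' ∪ A' \ B') (S.2 \ (B' ∪ A' \ B')) * shuffleSign B' (A' \ B')) *
          F (B, B') * G (C, A' \ B') * H (D, S.2 \ A'))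
  rw [e1]
  refine Finset.sum_congr rfl fun B _ => Finset.sum_congr rfl fun C hC => ?_
  have e2 := sum_powerset_powerset S.2 (fun B' C' D' =>
        (shuffleSign (B ∪ C) (S.1 \ (B ∪ C)) * shuffleSign B C) *
          (shuffleSign (B' ∪ C') (S.2 \ (B' ∪ C')) * shuffleSign B' C') *
          F (B, B') * G (C, C') * H ((S.1 \ B) \ C, D'))
  rw [e2]
  refine Finset.sum_congr rfl fun B' _ => Finset.sum_congr rfl fun C' hC' => ?_
  rw [shuffleSign_cocycle (Finset.mem_powerset.1 hC), shuffleSign_cocycle (Finset.mem_powerset.1 hC')]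

lemma oneForm_wedge (F : DForm n) : wedge oneForm F = F := by
  funext S
  rw [wedge, Finset.sum_eq_single ∅, Finset.sum_eq_single ∅]
  · simp [oneForm]
  · intro B _ hB
    simp [oneForm, hB]
  · intro h; simp at h
  · intro A _ hA
    refine Finset.sum_eq_zero fun B _ => ?_
    simp [oneForm, hA]
  · intro h; simp at h

lemma wedge_oneForm (F : DForm n) : wedge F oneForm = F := by
  funext S
  rw [wedge, Finset.sum_eq_single S.1, Finset.sum_eq_single S.2]
  · simp [oneForm]
  · intro B hB hne
    have : S.2 \ B ≠ ∅ := by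
      rw [Ne, Finset.sdiff_eq_empty_iff_subset]
      exact fun h => hne (Finset.Subset.antisymm (Finset.mem_powerset.1 hB) h)
    simp [oneForm, this]
  · intro h; simp at h
  · intro A hA hne
    have : S.1 \ A ≠ ∅ := by
      rw [Ne, Finset.sdiff_eq_empty_iff_subset]
      exact fun h => hne (Finset.Subset.antisymm (Finset.mem_powerset.1 hA) h)
    refine Finset.sum_eq_zero fun B _ => ?_
    simp [oneForm, this]
  · intro h; simp at h

/-- `F` has degree `k` in `ζ` and degree `0` in `z`. -/
def IsZetaDegree (k : ℕ) (F : DForm n) : Prop :=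
  ∀ A B, F (A, B) ≠ 0 → A.card = k ∧ B = ∅

/-- As F has no differentials in z, only the ζ-labels contribute a sign. When k is even that sign is
1 whatever the degree of G, so G need not be homogeneous and l is arbitrary; this makes a product of
two 1-forms central. -/
lemma IsZetaDegree.wedge_comm {k l : ℕ} {F G : DForm n} (hF : IsZetaDegree k F)
    (h : Even k ∨ ∀ A B, G (A, B) ≠ 0 → A.card = l) :
    wedge F G = (-1 : ℂ) ^ (k * l) • wedge G F := by
  have hflip : ∀ S : Finset (Gen n) × Finset (Gen n), wedge G F S =
      ∑ A ∈ S.1.powerset, ∑ B ∈ S.2.powerset,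
        shuffleSign (S.1 \ A) A * shuffleSign (S.2 \ B) B * G (S.1 \ A, S.2 \ B) * F (A, B) := by
    intro S
    rw [wedge]
    refine Finset.sum_nbij' (fun A => S.1 \ A) (fun A => S.1 \ A) ?_ ?_ ?_ ?_ ?_
    · intro A _; simp
    · intro A _; simp
    · intro A hA; exact Finset.sdiff_sdiff_eq_self (Finset.mem_powerset.1 hA)
    · intro A hA; exact Finset.sdiff_sdiff_eq_self (Finset.mem_powerset.1 hA)
    intro A hA
    refine Finset.sum_nbij' (fun A => S.2 \ A) (fun A => S.2 \ A) ?_ ?_ ?_ ?_ ?_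
    · intro A _; simp
    · intro A _; simp
    · intro A hA; exact Finset.sdiff_sdiff_eq_self (Finset.mem_powerset.1 hA)
    · intro A hA; exact Finset.sdiff_sdiff_eq_self (Finset.mem_powerset.1 hA)
    intro B hB
    rw [Finset.sdiff_sdiff_eq_self (Finset.mem_powerset.1 hA),
      Finset.sdiff_sdiff_eq_self (Finset.mem_powerset.1 hB)]
  funext S
  rw [Pi.smul_apply, hflip, wedge, smul_eq_mul, Finset.mul_sum]
  refine Finset.sum_congr rfl fun A hA => ?_
  rw [Finset.mul_sum]
  refine Finset.sum_congr rfl fun B hB => ?_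
  by_cases hFA : F (A, B) = 0
  · simp [hFA]
  obtain ⟨h1, rfl⟩ := hF A B hFA
  by_cases hGA : G (S.1 \ A, S.2 \ ∅) = 0
  · simp only [hGA, mul_zero, zero_mul]
  rw [shuffleSign_comm Finset.disjoint_sdiff, h1]
  have h2 : (-1 : ℂ) ^ (k * (S.1 \ A).card) = (-1) ^ (k * l) := by
    rcases h with h | h
    · rw [pow_mul, pow_mul, h.neg_one_pow]; simp
    · rw [h _ _ hGA]
  rw [h2]
  simp only [shuffleSign_empty_left, shuffleSign_empty_right]
  ring

lemma IsZetaDegree.wedge {k l : ℕ} {F G : DForm n} (hF : IsZetaDegree k F)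
    (hG : IsZetaDegree l G) : IsZetaDegree (k + l) (wedge F G) := by
  intro A B h
  obtain ⟨A', hA', h⟩ := Finset.exists_ne_zero_of_sum_ne_zero h
  obtain ⟨B', hB', h⟩ := Finset.exists_ne_zero_of_sum_ne_zero h
  have hF' := hF A' B' (right_ne_zero_of_mul (left_ne_zero_of_mul h))
  have hG' := hG _ _ (right_ne_zero_of_mul h)
  have hA'' := Finset.mem_powerset.1 hA'
  refine ⟨?_, ?_⟩
  · rw [← hF'.1, ← hG'.1, add_comm]
    exact (Finset.card_sdiff_add_card_eq_card hA'').symm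
  · have := hG'.2
    rw [hF'.2] at this
    simpa using this

lemma IsZetaDegree.sum {ι : Type*} {k : ℕ} (s : Finset ι) (c : ι → ℂ) {F : ι → DForm n}
    (hF : ∀ i, IsZetaDegree k (F i)) : IsZetaDegree k (∑ i ∈ s, c i • F i) := by
  intro A B h
  rw [Finset.sum_apply] at h
  obtain ⟨i, _, h⟩ := Finset.exists_ne_zero_of_sum_ne_zero h
  exact hF i A B (right_ne_zero_of_mul h)

lemma isZetaDegree_genZeta (a : Gen n) : IsZetaDegree 1 (genZeta a) := by
  intro A B h
  have h' : (A, B) = ({a}, ∅) := by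
    by_contra hne
    exact h (by simp [genZeta, hne])
  obtain ⟨rfl, rfl⟩ := Prod.mk.inj h'
  simp

lemma IsZetaDegree.wedge_anticomm {F G : DForm n} (hF : IsZetaDegree 1 F)
    (hG : IsZetaDegree 1 G) : HL.wedge F G = -HL.wedge G F := by
  rw [hF.wedge_comm (l := 1) (Or.inr fun A B h => (hG A B h).1)]
  simp

lemma IsZetaDegree.wedge_self {F : DForm n} (hF : IsZetaDegree 1 F) : HL.wedge F F = 0 :=
  self_eq_neg.1 (hF.wedge_anticomm hF)

lemma IsZetaDegree.wedge_wedge_comm {a b : DForm n} (ha : IsZetaDegree 1 a)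
    (hb : IsZetaDegree 1 b) (X : DForm n) :
    HL.wedge (HL.wedge a b) X = HL.wedge X (HL.wedge a b) := by
  have := (ha.wedge hb).wedge_comm (l := 0) (G := X) (Or.inl (by norm_num))
  simpa using this

lemma wedge_wedge_left {a b : DForm n} (ha : IsZetaDegree 1 a) (hb : IsZetaDegree 1 b) :
    wedge (wedge a b) a = 0 := by
  rw [wedge_assoc, hb.wedge_anticomm ha, ← neg_one_smul ℂ, wedge_smul, ← wedge_assoc,
    ha.wedge_self, zero_wedge, smul_zero]

lemma wedge_wedge_right {a b : DForm n} (hb : IsZetaDegree 1 b) :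
    wedge (wedge a b) b = 0 := by
  rw [wedge_assoc, hb.wedge_self, wedge_zero]

/-- Multiplication by `ω = a ∧ b` only depends on the factors modulo `a` and `b`. -/
lemma wedge_congr_mod {w X X' Y Y' : DForm n} (hw : ∀ Z, wedge w Z = wedge Z w)
    (hX : wedge w X = wedge w X') (hY : wedge w Y = wedge w Y') :
    wedge w (wedge X Y) = wedge w (wedge X' Y') := by
  rw [← wedge_assoc, hX, hw X', wedge_assoc, hY, ← wedge_assoc, ← hw X', wedge_assoc]

lemma wedgePow_congr_mod {w X X' : DForm n} (hw : ∀ Z, wedge w Z = wedge Z w)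
    (hX : wedge w X = wedge w X') (k : ℕ) :
    wedge w (wedgePow X k) = wedge w (wedgePow X' k) := by
  induction k with
  | zero => rfl
  | succ k ih => exact wedge_congr_mod hw hX ih

lemma wedgePow_smul (c : ℂ) (X : DForm n) (k : ℕ) :
    wedgePow (c • X) k = c ^ k • wedgePow X k := by
  induction k with
  | zero => simp [wedgePow]
  | succ k ih => rw [wedgePow, wedgePow, ih, smul_wedge, wedge_smul, smul_smul, pow_succ']

/-- The part of `C_{qμν}` that is left after the terms killed by `a ∧ b` are dropped. -/
lemma wedge_reduction {a b A B B' c e f e' : DForm n} (ha : IsZetaDegree 1 a)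
    (hb : IsZetaDegree 1 b) (u v : ℂ) (k l m : ℕ) (ν : ℕ) :
    wedge (u • a) (wedge (v • b) (wedge (wedgePow (u • A + wedge c a) k)
      (wedge (wedgePow (v • B + wedge e b) l)
        (wedge (wedgePow (wedge f a) ν) (wedgePow (v • B' + wedge e' b) m))))) =
    if ν = 0 then (u ^ (k + 1) * v ^ (l + m + 1)) •
      wedge a (wedge b (wedge (wedgePow A k) (wedge (wedgePow B l) (wedgePow B' m)))) else 0 := by
  -- The 2-form a ∧ b is central and annihilates every multiple of a or of b. Each remaining factor
  -- may thus be replaced by its class modulo a and b.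
  have hw : ∀ Z, wedge (wedge a b) Z = wedge Z (wedge a b) := ha.wedge_wedge_comm hb
  have hkill_a : ∀ c, wedge (wedge a b) (wedge c a) = 0 := fun c => by
    rw [← wedge_assoc, hw c, wedge_assoc, wedge_wedge_left ha hb, wedge_zero]
  have hkill_b : ∀ c, wedge (wedge a b) (wedge c b) = 0 := fun c => by
    rw [← wedge_assoc, hw c, wedge_assoc, wedge_wedge_right hb, wedge_zero]
  have h1 : wedge (wedge a b) (u • A + wedge c a) = wedge (wedge a b) (u • A) := by
    rw [wedge_add, hkill_a, add_zero]
  have h2 : wedge (wedge a b) (v • B + wedge e b) = wedge (wedge a b) (v • B) := by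
    rw [wedge_add, hkill_b, add_zero]
  have h3 : wedge (wedge a b) (wedge f a) = wedge (wedge a b) 0 := by
    rw [hkill_a, wedge_zero]
  have h4 : wedge (wedge a b) (v • B' + wedge e' b) = wedge (wedge a b) (v • B') := by
    rw [wedge_add, hkill_b, add_zero]
  have key := wedge_congr_mod hw (wedgePow_congr_mod hw h1 k)
    (wedge_congr_mod hw (wedgePow_congr_mod hw h2 l)
      (wedge_congr_mod hw (wedgePow_congr_mod hw h3 ν) (wedgePow_congr_mod hw h4 m)))
  rw [smul_wedge, smul_wedge, wedge_smul, ← wedge_assoc a b, key]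
  split_ifs with hν
  · subst hν
    have h0 : wedgePow (0 : DForm n) 0 = oneForm := rfl
    rw [h0, oneForm_wedge, wedgePow_smul, wedgePow_smul, wedgePow_smul]
    simp only [smul_wedge, wedge_smul, smul_smul, wedge_assoc]
    rw [show u * (v * (v ^ m * v ^ l * u ^ k)) = u ^ (k + 1) * v ^ (l + m + 1) by ring]
  -- Modulo a the factor `wedge f a` is 0, so any positive power of it kills the product.
  · obtain ⟨ν, rfl⟩ := Nat.exists_eq_succ_of_ne_zero hν
    simp [wedgePow]

end Algebra

/-! ### Bilinear operations on double forms and their derivatives -/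

section Calculus

variable {n : ℕ}

/-- The wedge product as a continuous bilinear map. -/
def wedgeCLM : DForm n →L[ℝ] DForm n →L[ℝ] DForm n :=
  (LinearMap.mk₂ ℝ (wedge (n := n)) add_wedge (fun c F G => smul_wedge (c : ℂ) F G) wedge_add
    (fun c F G => wedge_smul (c : ℂ) F G)).toContinuousBilinearMap

/-- Conjugation as a continuous real linear map. -/
def conjCLM : DForm n →L[ℝ] DForm n :=
  LinearMap.toContinuousLinearMap
    { toFun := conjForm
      map_add' := fun F G => by
        funext S
        simp only [conjForm, Pi.add_apply, map_add, mul_add]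
      map_smul' := fun c F => by
        funext S
        simp only [conjForm, Pi.smul_apply, Complex.real_smul, map_mul, Complex.conj_ofReal,
          RingHom.id_apply]
        ring }

/-- The coefficients of the Hodge operator. -/
def starCoeff (g : Matrix (Fin n) (Fin n) ℂ) (S B : Finset (Gen n)) : ℂ :=
  shuffleSign Sᶜ S * volCoeff g * formPairing g Sᶜ B

/-- The Hodge operator as a bilinear expression in its coefficients and the form. -/
def starCLM : (Finset (Gen n) → Finset (Gen n) → ℂ) →L[ℝ] DForm n →L[ℝ] DForm n :=
  (LinearMap.mk₂ ℝ (fun (c : Finset (Gen n) → Finset (Gen n) → ℂ) (F : DForm n) =>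
      (fun S => ∑ B, c S.1 B * F (B, S.2) : DForm n))
    (fun c c' F => by
      funext S; simp only [Pi.add_apply, add_mul, Finset.sum_add_distrib])
    (fun a c F => by
      funext S
      simp only [Pi.smul_apply, Complex.real_smul, Finset.mul_sum, mul_assoc])
    (fun c F F' => by
      funext S; simp only [Pi.add_apply, mul_add, Finset.sum_add_distrib])
    (fun a c F => by
      funext S
      simp only [Pi.smul_apply, Complex.real_smul, Finset.mul_sum]
      exact Finset.sum_congr rfl fun B _ => by ring)).toContinuousBilinearMap

lemma starZeta_eq (g : Matrix (Fin n) (Fin n) ℂ) (F : DForm n) :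
    starZeta g F = starCLM (starCoeff g) F := by
  funext S
  change _ = ∑ B, starCoeff g S.1 B * F (B, S.2)
  simp only [starZeta, starCoeff, Finset.mul_sum, mul_assoc]

/-! ### Product rules in norm and smoothness of the algebraic operations -/

variable {E F G : Type*} [NormedAddCommGroup E] [NormedSpace ℝ E] [NormedAddCommGroup F]
  [NormedSpace ℝ F] [NormedAddCommGroup G] [NormedSpace ℝ G]
  {X : Type*} [NormedAddCommGroup X] [NormedSpace ℝ X]

lemma norm_fderiv_bilinear_le (B : E →L[ℝ] F →L[ℝ] G) {f : X → E} {g : X → F} {x : X}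
    (hf : DifferentiableAt ℝ f x) (hg : DifferentiableAt ℝ g x) :
    ‖fderiv ℝ (fun y => B (f y) (g y)) x‖ ≤
      ‖B‖ * (‖f x‖ * ‖fderiv ℝ g x‖ + ‖fderiv ℝ f x‖ * ‖g x‖) := by
  rw [B.fderiv_of_bilinear hf hg]
  refine (norm_add_le _ _).trans ?_
  rw [mul_add]
  refine add_le_add ?_ ?_
  · refine (ContinuousLinearMap.le_opNorm₂ _ _ _).trans ?_
    rw [← mul_assoc]
    gcongr
    exact B.norm_precompR_le X
  · refine (ContinuousLinearMap.le_opNorm₂ _ _ _).trans ?_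
    rw [← mul_assoc]
    gcongr
    exact B.norm_precompL_le X

lemma wedge_norm_le (F G : DForm n) :
    ‖wedge F G‖ ≤ ‖(wedgeCLM : DForm n →L[ℝ] _)‖ * ‖F‖ * ‖G‖ :=
  ContinuousLinearMap.le_opNorm₂ wedgeCLM F G

lemma contDiffAt_wedge {m : WithTop ℕ∞} {f g : X → DForm n} {x : X} (hf : ContDiffAt ℝ m f x)
    (hg : ContDiffAt ℝ m g x) : ContDiffAt ℝ m (fun y => wedge (f y) (g y)) x :=
  ((wedgeCLM (n := n)).contDiff.contDiffAt.comp x hf).clm_apply hg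

lemma contDiffAt_wedgePow {m : WithTop ℕ∞} {f : X → DForm n} {x : X} (hf : ContDiffAt ℝ m f x)
    (k : ℕ) : ContDiffAt ℝ m (fun y => wedgePow (f y) k) x := by
  induction k with
  | zero => exact contDiffAt_const
  | succ k ih => exact contDiffAt_wedge hf ih

lemma contDiffAt_conjForm {m : WithTop ℕ∞} {f : X → DForm n} {x : X} (hf : ContDiffAt ℝ m f x) :
    ContDiffAt ℝ m (fun y => conjForm (f y)) x :=
  (conjCLM (n := n)).contDiff.contDiffAt.comp x hf

lemma contDiffAt_det {ι : Type*} [Fintype ι] [DecidableEq ι] {m : WithTop ℕ∞}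
    {M : X → Matrix ι ι ℂ} {x : X} (hM : ∀ i j, ContDiffAt ℝ m (fun y => M y i j) x) :
    ContDiffAt ℝ m (fun y => (M y).det) x := by
  simp only [Matrix.det_apply']
  refine ContDiffAt.sum fun σ _ => ?_
  exact contDiffAt_const.mul (contDiffAt_prod fun i _ => hM _ _)

/-- Cramer's rule: the entries are cofactor determinants divided by the determinant. -/
lemma contDiffAt_matrix_inv {ι : Type*} [Fintype ι] [DecidableEq ι] {m : WithTop ℕ∞}
    {M : X → Matrix ι ι ℂ} {x : X} (hM : ∀ i j, ContDiffAt ℝ m (fun y => M y i j) x)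
    (h0 : (M x).det ≠ 0) (i j : ι) : ContDiffAt ℝ m (fun y => (M y)⁻¹ i j) x := by
  simp only [Matrix.inv_def, Ring.inverse_eq_inv', Matrix.smul_apply, smul_eq_mul,
    Matrix.adjugate_apply]
  refine ((contDiffAt_det hM).inv h0).mul (contDiffAt_det fun k l => ?_)
  by_cases hk : k = j
  · subst hk
    simp only [Matrix.updateRow_self]
    exact contDiffAt_const
  · simp only [Matrix.updateRow_ne hk]
    exact hM k l

lemma contDiffAt_starCoeff {m : WithTop ℕ∞} {g : X → Matrix (Fin n) (Fin n) ℂ} {x : X}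
    (hg : ∀ i j, ContDiffAt ℝ m (fun y => g y i j) x) (h0 : (g x).det ≠ 0) :
    ContDiffAt ℝ m (fun y => starCoeff (g y)) x := by
  refine contDiffAt_pi.2 fun S => contDiffAt_pi.2 fun B => ?_
  unfold starCoeff volCoeff
  refine (contDiffAt_const.mul (contDiffAt_const.mul (contDiffAt_det hg))).mul ?_
  unfold formPairing
  split_ifs with h
  · refine contDiffAt_det fun i j => ?_
    simp only [Matrix.of_apply, genPairing]
    split_ifs
    · exact contDiffAt_const.mul (contDiffAt_matrix_inv hg h0 _ _)
    · exact contDiffAt_const.mul (contDiffAt_matrix_inv hg h0 _ _)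
    · exact contDiffAt_const
  · exact contDiffAt_const

lemma contDiffAt_starZeta {m : WithTop ℕ∞} {g : X → Matrix (Fin n) (Fin n) ℂ} {f : X → DForm n}
    {x : X} (hg : ContDiffAt ℝ m (fun y => starCoeff (g y)) x) (hf : ContDiffAt ℝ m f x) :
    ContDiffAt ℝ m (fun y => starZeta (g y) (f y)) x := by
  simp only [starZeta_eq]
  exact ((starCLM (n := n)).contDiff.contDiffAt.comp x hg).clm_apply hf

/-! ### Partial derivatives of functions of two variables -/

variable {V : Type*} [NormedAddCommGroup V] [NormedSpace ℝ V] [NormedSpace ℂ V]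

lemma norm_dd_le (j : Fin n) (f : Cn n → V) (x : Cn n) : ‖dd j f x‖ ≤ ‖fderiv ℝ f x‖ := by
  rw [dd, norm_smul]
  have h1 : ‖fderiv ℝ f x (EuclideanSpace.single j 1)‖ ≤ ‖fderiv ℝ f x‖ := by
    simpa using (fderiv ℝ f x).le_opNorm (EuclideanSpace.single j (1 : ℂ))
  have h2 : ‖Complex.I • fderiv ℝ f x (EuclideanSpace.single j Complex.I)‖ ≤ ‖fderiv ℝ f x‖ := by
    rw [norm_smul]
    simpa using (fderiv ℝ f x).le_opNorm (EuclideanSpace.single j Complex.I)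
  have h3 := norm_sub_le (fderiv ℝ f x (EuclideanSpace.single j 1))
    (Complex.I • fderiv ℝ f x (EuclideanSpace.single j Complex.I))
  have h4 : ‖(1 / 2 : ℂ)‖ = 1 / 2 := by norm_num
  rw [h4]
  linarith

/-- A function of two variables as a function on the product. -/
abbrev onProd {W : Type*} (f : Cn n → Cn n → W) : Cn n × Cn n → W := fun p => f p.1 p.2

lemma hasFDerivAt_onProd_left {f : Cn n → Cn n → G} {p : Cn n × Cn n}
    (hf : DifferentiableAt ℝ (onProd f) p) :
    HasFDerivAt (fun w => f w p.2)
      ((fderiv ℝ (onProd f) p).comp (ContinuousLinearMap.inl ℝ (Cn n) (Cn n))) p.1 :=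
  HasFDerivAt.comp (f := fun w : Cn n => (w, p.2)) (g := onProd f) p.1 hf.hasFDerivAt
    (hasFDerivAt_prodMk_left p.1 p.2)

lemma hasFDerivAt_onProd_right {f : Cn n → Cn n → G} {p : Cn n × Cn n}
    (hf : DifferentiableAt ℝ (onProd f) p) :
    HasFDerivAt (fun w => f p.1 w)
      ((fderiv ℝ (onProd f) p).comp (ContinuousLinearMap.inr ℝ (Cn n) (Cn n))) p.2 :=
  HasFDerivAt.comp (f := fun w : Cn n => (p.1, w)) (g := onProd f) p.2 hf.hasFDerivAt
    (hasFDerivAt_prodMk_right p.1 p.2)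

lemma norm_fderiv_left_le {f : Cn n → Cn n → G} {p : Cn n × Cn n}
    (hf : DifferentiableAt ℝ (onProd f) p) :
    ‖fderiv ℝ (fun w => f w p.2) p.1‖ ≤ ‖fderiv ℝ (onProd f) p‖ := by
  rw [(hasFDerivAt_onProd_left hf).fderiv]
  refine (ContinuousLinearMap.opNorm_comp_le _ _).trans ?_
  exact mul_le_of_le_one_right (norm_nonneg _) (ContinuousLinearMap.norm_inl_le_one ℝ _ _)

lemma norm_fderiv_right_le {f : Cn n → Cn n → G} {p : Cn n × Cn n}
    (hf : DifferentiableAt ℝ (onProd f) p) :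
    ‖fderiv ℝ (fun w => f p.1 w) p.2‖ ≤ ‖fderiv ℝ (onProd f) p‖ := by
  rw [(hasFDerivAt_onProd_right hf).fderiv]
  refine (ContinuousLinearMap.opNorm_comp_le _ _).trans ?_
  exact mul_le_of_le_one_right (norm_nonneg _) (ContinuousLinearMap.norm_inr_le_one ℝ _ _)

lemma contDiffAt_fderiv_left {f : Cn n → Cn n → G} {p : Cn n × Cn n}
    (hf : ContDiffAt ℝ ∞ (onProd f) p) :
    ContDiffAt ℝ ∞ (fun p : Cn n × Cn n => fderiv ℝ (fun w => f w p.2) p.1) p := by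
  refine ContDiffAt.fderiv (n := ∞) (f := fun (p : Cn n × Cn n) w => f w p.2) ?_ contDiffAt_fst
    (by simp)
  have h : ContDiffAt ℝ ∞ (fun x : (Cn n × Cn n) × Cn n => (x.2, x.1.2)) (p, p.1) := by fun_prop
  exact ContDiffAt.comp (g := onProd f) (p, p.1) hf h

lemma contDiffAt_fderiv_right {f : Cn n → Cn n → G} {p : Cn n × Cn n}
    (hf : ContDiffAt ℝ ∞ (onProd f) p) :
    ContDiffAt ℝ ∞ (fun p : Cn n × Cn n => fderiv ℝ (fun w => f p.1 w) p.2) p := by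
  refine ContDiffAt.fderiv (n := ∞) (f := fun (p : Cn n × Cn n) w => f p.1 w) ?_ contDiffAt_snd
    (by simp)
  have h : ContDiffAt ℝ ∞ (fun x : (Cn n × Cn n) × Cn n => (x.1.1, x.2)) (p, p.2) := by fun_prop
  exact ContDiffAt.comp (g := onProd f) (p, p.2) hf h

lemma contDiffAt_dd_of_fderiv {m : WithTop ℕ∞} (j : Fin n) {h : X → Cn n → V}
    {y : X → Cn n} {x : X} (hf : ContDiffAt ℝ m (fun t => fderiv ℝ (h t) (y t)) x) :
    ContDiffAt ℝ m (fun t => dd j (h t) (y t)) x := by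
  unfold dd
  exact ((hf.clm_apply contDiffAt_const).sub
    ((hf.clm_apply contDiffAt_const).const_smul Complex.I)).const_smul (1 / 2 : ℂ)

lemma contDiffAt_ddbar_of_fderiv {m : WithTop ℕ∞} (j : Fin n) {h : X → Cn n → V}
    {y : X → Cn n} {x : X} (hf : ContDiffAt ℝ m (fun t => fderiv ℝ (h t) (y t)) x) :
    ContDiffAt ℝ m (fun t => ddbar j (h t) (y t)) x := by
  unfold ddbar
  exact ((hf.clm_apply contDiffAt_const).add
    ((hf.clm_apply contDiffAt_const).const_smul Complex.I)).const_smul (1 / 2 : ℂ)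

lemma contDiffAt_delZeta {K : Kernel n} {p : Cn n × Cn n} (hK : ContDiffAt ℝ ∞ (onProd K) p) :
    ContDiffAt ℝ ∞ (onProd (delZeta K)) p :=
  ContDiffAt.sum fun j _ => contDiffAt_wedge contDiffAt_const
    (contDiffAt_dd_of_fderiv j (contDiffAt_fderiv_left hK))

lemma contDiffAt_delbarZeta {K : Kernel n} {p : Cn n × Cn n}
    (hK : ContDiffAt ℝ ∞ (onProd K) p) : ContDiffAt ℝ ∞ (onProd (delbarZeta K)) p :=
  ContDiffAt.sum fun j _ => contDiffAt_wedge contDiffAt_const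
    (contDiffAt_ddbar_of_fderiv j (contDiffAt_fderiv_left hK))

lemma contDiffAt_delZ {K : Kernel n} {p : Cn n × Cn n} (hK : ContDiffAt ℝ ∞ (onProd K) p) :
    ContDiffAt ℝ ∞ (onProd (delZ K)) p :=
  ContDiffAt.sum fun j _ => contDiffAt_wedge contDiffAt_const
    (contDiffAt_dd_of_fderiv j (contDiffAt_fderiv_right hK))

lemma contDiffAt_delbarZ {K : Kernel n} {p : Cn n × Cn n} (hK : ContDiffAt ℝ ∞ (onProd K) p) :
    ContDiffAt ℝ ∞ (onProd (delbarZ K)) p :=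
  ContDiffAt.sum fun j _ => contDiffAt_wedge contDiffAt_const
    (contDiffAt_ddbar_of_fderiv j (contDiffAt_fderiv_right hK))

lemma contDiffAt_Cqmn {α β : Kernel n} {p : Cn n × Cn n} (hα : ContDiffAt ℝ ∞ (onProd α) p)
    (hβ : ContDiffAt ℝ ∞ (onProd β) p) (q μ ν : ℕ) :
    ContDiffAt ℝ ∞ (onProd (Cqmn q μ ν α β)) p :=
  contDiffAt_wedge hα <| contDiffAt_wedge hβ <|
    contDiffAt_wedge (contDiffAt_wedgePow (contDiffAt_delbarZeta hα) _) <|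
    contDiffAt_wedge (contDiffAt_wedgePow (contDiffAt_delbarZeta hβ) _) <|
    contDiffAt_wedge (contDiffAt_wedgePow (contDiffAt_delbarZ hα) _)
      (contDiffAt_wedgePow (contDiffAt_delbarZ hβ) _)

lemma contDiffAt_Cq {α β : Kernel n} {p : Cn n × Cn n} (hα : ContDiffAt ℝ ∞ (onProd α) p)
    (hβ : ContDiffAt ℝ ∞ (onProd β) p) (q : ℕ) : ContDiffAt ℝ ∞ (onProd (Cq q α β)) p :=
  ContDiffAt.sum fun μ _ => ContDiffAt.sum fun ν _ =>
    (contDiffAt_Cqmn hα hβ q μ ν).const_smul _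

/-! ### Bounds for the Hodge operator and for `ϑ` -/

lemma contDiff_starCoeff {g : Cn n → Matrix (Fin n) (Fin n) ℂ}
    (hg : ∀ j k, ContDiff ℝ ∞ (fun x => g x j k)) (hpos : ∀ x, (g x).PosDef) :
    ContDiff ℝ ∞ (fun x => starCoeff (g x)) :=
  contDiff_iff_contDiffAt.2 fun x =>
    contDiffAt_starCoeff (fun i j => (hg i j).contDiffAt) (hpos x).det_pos.ne'

/-- `c ∗_ζ conj(Q)`. -/
def starConj (g : Cn n → Matrix (Fin n) (Fin n) ℂ) (c : ℂ) (Q : Kernel n) : Kernel n :=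
  fun ζ z => c • starZeta (g ζ) (conjForm (Q ζ z))

variable {g : Cn n → Matrix (Fin n) (Fin n) ℂ}

lemma contDiffAt_starConj (hg : ContDiff ℝ ∞ (fun x => starCoeff (g x))) (c : ℂ) {Q : Kernel n}
    {p : Cn n × Cn n} (hQ : ContDiffAt ℝ ∞ (onProd Q) p) :
    ContDiffAt ℝ ∞ (onProd (starConj g c Q)) p :=
  (contDiffAt_starZeta (g := fun p : Cn n × Cn n => g p.1)
    (hg.contDiffAt.comp p contDiffAt_fst) (contDiffAt_conjForm hQ)).const_smul c

lemma contDiffAt_thetaZeta (hg : ContDiff ℝ ∞ (fun x => starCoeff (g x))) {K : Kernel n}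
    {p : Cn n × Cn n} (hK : ContDiffAt ℝ ∞ (onProd K) p) :
    ContDiffAt ℝ ∞ (onProd (thetaZeta g K)) p := by
  have hs : ContDiffAt ℝ ∞ (fun p : Cn n × Cn n => starCoeff (g p.1)) p :=
    hg.contDiffAt.comp p contDiffAt_fst
  have h1 : ContDiffAt ℝ ∞ (onProd fun ζ z => starZeta (g ζ) (K ζ z)) p :=
    contDiffAt_starZeta (g := fun p : Cn n × Cn n => g p.1) hs hK
  exact (contDiffAt_starZeta (g := fun p : Cn n × Cn n => g p.1) hs (contDiffAt_delZeta h1)).neg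

lemma exists_starZeta_bound (hg : ContDiff ℝ ∞ (fun x => starCoeff (g x))) {S : Set (Cn n)}
    (hS : IsCompact S) : ∃ C : ℝ, 0 ≤ C ∧ ∀ x ∈ S, ∀ F, ‖starZeta (g x) F‖ ≤ C * ‖F‖ := by
  obtain ⟨C, hC⟩ := hS.exists_bound_of_continuousOn hg.continuous.continuousOn
  refine ⟨‖(starCLM : _ →L[ℝ] DForm n →L[ℝ] _)‖ * max C 0, by positivity, fun x hx F => ?_⟩
  rw [starZeta_eq]
  refine (ContinuousLinearMap.le_opNorm₂ _ _ _).trans ?_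
  gcongr
  exact (hC x hx).trans (le_max_left _ _)

lemma exists_fderiv_starZeta_bound (hg : ContDiff ℝ ∞ (fun x => starCoeff (g x)))
    {S : Set (Cn n)} (hS : IsCompact S) :
    ∃ C : ℝ, 0 ≤ C ∧ ∀ p : Cn n × Cn n, p.1 ∈ S → ∀ f : Cn n × Cn n → DForm n,
      DifferentiableAt ℝ f p →
        ‖fderiv ℝ (fun p => starZeta (g p.1) (f p)) p‖ ≤ C * (‖f p‖ + ‖fderiv ℝ f p‖) := by
  obtain ⟨C, hC⟩ := hS.exists_bound_of_continuousOn hg.continuous.continuousOn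
  obtain ⟨C', hC'⟩ := hS.exists_bound_of_continuousOn
    (hg.continuous_fderiv (by simp)).continuousOn
  set B := (starCLM : _ →L[ℝ] DForm n →L[ℝ] DForm n)
  refine ⟨‖B‖ * max (max C C') 0, by positivity, fun p hp f hf => ?_⟩
  simp only [starZeta_eq]
  have hd : DifferentiableAt ℝ (fun p : Cn n × Cn n => starCoeff (g p.1)) p :=
    ((hg.differentiable (by simp)).differentiableAt).comp p differentiableAt_fst
  have hnorm : ‖fderiv ℝ (fun p : Cn n × Cn n => starCoeff (g p.1)) p‖ ≤
      ‖fderiv ℝ (fun x => starCoeff (g x)) p.1‖ := by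
    have h1 : HasFDerivAt (fun p : Cn n × Cn n => starCoeff (g p.1)) _ p :=
      ((hg.differentiable (by simp)).differentiableAt (x := p.1)).hasFDerivAt.comp p hasFDerivAt_fst
    rw [h1.fderiv]
    refine (ContinuousLinearMap.opNorm_comp_le _ _).trans ?_
    exact mul_le_of_le_one_right (norm_nonneg _) (ContinuousLinearMap.norm_fst_le ℝ _ _)
  refine (norm_fderiv_bilinear_le B hd hf).trans ?_
  rw [mul_assoc]
  gcongr
  have h1 : ‖starCoeff (g p.1)‖ ≤ max (max C C') 0 :=
    (hC _ hp).trans ((le_max_left _ _).trans (le_max_left _ _))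
  have h2 := hnorm.trans ((hC' _ hp).trans ((le_max_right C C').trans (le_max_left _ 0)))
  have := mul_le_mul_of_nonneg_right h1 (norm_nonneg (fderiv ℝ f p))
  have := mul_le_mul_of_nonneg_right h2 (norm_nonneg (f p))
  linarith

lemma exists_delZeta_bound :
    ∃ C : ℝ, 0 ≤ C ∧ ∀ (K : Kernel n) (p : Cn n × Cn n), DifferentiableAt ℝ (onProd K) p →
      ‖delZeta K p.1 p.2‖ ≤ C * ‖fderiv ℝ (onProd K) p‖ := by
  refine ⟨∑ j : Fin n, ‖(wedgeCLM : DForm n →L[ℝ] _)‖ * ‖(genZeta (gen j false) : DForm n)‖,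
    by positivity, fun K p hK => ?_⟩
  rw [Finset.sum_mul]
  refine (norm_sum_le _ _).trans (Finset.sum_le_sum fun j _ => ?_)
  refine (wedge_norm_le _ _).trans ?_
  gcongr
  exact (norm_dd_le _ _ _).trans (norm_fderiv_left_le hK)

lemma exists_delZ_bound :
    ∃ C : ℝ, 0 ≤ C ∧ ∀ (K : Kernel n) (p : Cn n × Cn n), DifferentiableAt ℝ (onProd K) p →
      ‖delZ K p.1 p.2‖ ≤ C * ‖fderiv ℝ (onProd K) p‖ := by
  refine ⟨∑ j : Fin n, ‖(wedgeCLM : DForm n →L[ℝ] _)‖ * ‖(genZ (gen j false) : DForm n)‖,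
    by positivity, fun K p hK => ?_⟩
  rw [Finset.sum_mul]
  refine (norm_sum_le _ _).trans (Finset.sum_le_sum fun j _ => ?_)
  refine (wedge_norm_le _ _).trans ?_
  gcongr
  exact (norm_dd_le _ _ _).trans (norm_fderiv_right_le hK)

/-- `ϑ_ζ` and `∂_z` of `c ∗_ζ conj(Q)` are controlled by `Q` and its first derivatives. -/
lemma exists_first_order_bound (hg : ContDiff ℝ ∞ (fun x => starCoeff (g x))) {S : Set (Cn n)}
    (hS : IsCompact S) (c c' : ℂ) :
    ∃ C : ℝ, 0 ≤ C ∧ ∀ p : Cn n × Cn n, p.1 ∈ S → ∀ Q Q' : Kernel n,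
      ContDiffAt ℝ ∞ (onProd Q) p → ContDiffAt ℝ ∞ (onProd Q') p →
        ‖thetaZeta g (starConj g c Q) p.1 p.2 - delZ (starConj g c' Q') p.1 p.2‖ ≤
          C * ((‖Q p.1 p.2‖ + ‖fderiv ℝ (onProd Q) p‖) +
            (‖Q' p.1 p.2‖ + ‖fderiv ℝ (onProd Q') p‖)) := by
  obtain ⟨A, hA0, hA⟩ := exists_starZeta_bound hg hS
  obtain ⟨B, hB0, hB⟩ := exists_fderiv_starZeta_bound hg hS
  obtain ⟨D, hD0, hD⟩ := exists_delZeta_bound (n := n)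
  obtain ⟨D', hD'0, hD'⟩ := exists_delZ_bound (n := n)
  set N := ‖(conjCLM : DForm n →L[ℝ] DForm n)‖
  have hconj : ∀ (Q : Kernel n) (p : Cn n × Cn n), ‖conjForm (Q p.1 p.2)‖ ≤ N * ‖Q p.1 p.2‖ :=
    fun Q p => (conjCLM (n := n)).le_opNorm _
  have hconj' : ∀ (Q : Kernel n) (p : Cn n × Cn n), ContDiffAt ℝ ∞ (onProd Q) p →
      ‖fderiv ℝ (fun p : Cn n × Cn n => conjForm (Q p.1 p.2)) p‖ ≤ N * ‖fderiv ℝ (onProd Q) p‖ := by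
    intro Q p hQ
    have h1 : HasFDerivAt (fun p : Cn n × Cn n => conjForm (Q p.1 p.2)) _ p :=
      (conjCLM (n := n)).hasFDerivAt.comp p (hQ.differentiableAt (by simp)).hasFDerivAt
    rw [h1.fderiv]
    exact ContinuousLinearMap.opNorm_comp_le _ _
  have hL : ∀ (c : ℂ) (Q : Kernel n) (p : Cn n × Cn n), p.1 ∈ S → ContDiffAt ℝ ∞ (onProd Q) p →
      ‖starConj g c Q p.1 p.2‖ ≤ ‖c‖ * (A * (N * ‖Q p.1 p.2‖)) := by
    intro c Q p hp hQ
    rw [starConj, norm_smul]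
    gcongr
    exact (hA _ hp _).trans (by gcongr; exact hconj Q p)
  have hL' : ∀ (c : ℂ) (Q : Kernel n) (p : Cn n × Cn n), p.1 ∈ S →
      ContDiffAt ℝ ∞ (onProd Q) p → ‖fderiv ℝ (onProd (starConj g c Q)) p‖ ≤
        ‖c‖ * (B * (N * ‖Q p.1 p.2‖ + N * ‖fderiv ℝ (onProd Q) p‖)) := by
    intro c Q p hp hQ
    have hd : ContDiffAt ℝ ∞ (fun p : Cn n × Cn n => starZeta (g p.1) (conjForm (Q p.1 p.2))) p :=
      contDiffAt_starZeta (g := fun p : Cn n × Cn n => g p.1)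
        (hg.contDiffAt.comp p contDiffAt_fst) (contDiffAt_conjForm hQ)
    have h1 : fderiv ℝ (onProd (starConj g c Q)) p =
        c • fderiv ℝ (fun p : Cn n × Cn n => starZeta (g p.1) (conjForm (Q p.1 p.2))) p :=
      fderiv_const_smul (hd.differentiableAt (by simp)) c
    rw [h1, norm_smul]
    gcongr
    refine (hB p hp (fun p => conjForm (Q p.1 p.2))
      ((contDiffAt_conjForm hQ).differentiableAt (by simp))).trans ?_
    gcongr
    · exact hconj Q p
    · exact hconj' Q p hQ
  have h1 : ∀ (Q : Kernel n) (p : Cn n × Cn n), p.1 ∈ S → ContDiffAt ℝ ∞ (onProd Q) p →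
      ‖thetaZeta g (starConj g c Q) p.1 p.2‖ ≤ A * (D * (B * (‖c‖ * (A * (N * ‖Q p.1 p.2‖)) +
        ‖c‖ * (B * (N * ‖Q p.1 p.2‖ + N * ‖fderiv ℝ (onProd Q) p‖))))) := by
    intro Q p hp hQ
    have hd := contDiffAt_starConj hg c hQ
    rw [thetaZeta, norm_neg]
    refine (hA _ hp _).trans ?_
    gcongr
    refine (hD (fun ζ z => starZeta (g ζ) (starConj g c Q ζ z)) p ?_).trans ?_
    · exact (contDiffAt_starZeta (g := fun p : Cn n × Cn n => g p.1)
        (hg.contDiffAt.comp p contDiffAt_fst) hd).differentiableAt (by simp)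
    gcongr
    refine (hB p hp (onProd (starConj g c Q)) (hd.differentiableAt (by simp))).trans ?_
    gcongr
    · exact hL c Q p hp hQ
    · exact hL' c Q p hp hQ
  have h2 : ∀ (Q : Kernel n) (p : Cn n × Cn n), p.1 ∈ S → ContDiffAt ℝ ∞ (onProd Q) p →
      ‖delZ (starConj g c' Q) p.1 p.2‖ ≤
        D' * (‖c'‖ * (B * (N * ‖Q p.1 p.2‖ + N * ‖fderiv ℝ (onProd Q) p‖))) := by
    intro Q p hp hQ
    refine (hD' _ p ((contDiffAt_starConj hg c' hQ).differentiableAt (by simp))).trans ?_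
    gcongr
    exact hL' c' Q p hp hQ
  have hN : 0 ≤ N := norm_nonneg _
  refine ⟨A * (D * (B * (‖c‖ * (A * N) + ‖c‖ * (B * N)))) + D' * (‖c'‖ * (B * N)), by positivity,
    fun p hp Q Q' hQ hQ' => ?_⟩
  refine (norm_sub_le _ _).trans ((add_le_add (h1 Q p hp hQ) (h2 Q' p hp hQ')).trans ?_)
  rw [add_mul]
  have e1 : A * (D * (B * (‖c‖ * (A * (N * ‖Q p.1 p.2‖)) +
        ‖c‖ * (B * (N * ‖Q p.1 p.2‖ + N * ‖fderiv ℝ (onProd Q) p‖))))) ≤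
      A * (D * (B * (‖c‖ * (A * N) + ‖c‖ * (B * N)))) *
        (‖Q p.1 p.2‖ + ‖fderiv ℝ (onProd Q) p‖) := by
    have : 0 ≤ A * (D * (B * (‖c‖ * (A * N)))) * ‖fderiv ℝ (onProd Q) p‖ := by positivity
    linarith
  have e2 : 0 ≤ A * (D * (B * (‖c‖ * (A * N) + ‖c‖ * (B * N)))) *
        (‖Q' p.1 p.2‖ + ‖fderiv ℝ (onProd Q') p‖) := by positivity
  have e3 : 0 ≤ D' * (‖c'‖ * (B * N)) * (‖Q p.1 p.2‖ + ‖fderiv ℝ (onProd Q) p‖) := by positivity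
  linarith

end Calculus

/-! ### The structure of the kernels `C_q` -/

section Structure

variable {n : ℕ}

/-! ### Leibniz rules for ∂̄ and the reduction of C_q to its ν = 0 terms -/

lemma ddbar_smul (j : Fin n) {u : Cn n → ℂ} {F : Cn n → DForm n} {x : Cn n}
    (hu : DifferentiableAt ℝ u x) (hF : DifferentiableAt ℝ F x) :
    ddbar j (fun w => u w • F w) x = u x • ddbar j F x + ddbar j u x • F x := by
  simp only [ddbar, fderiv_fun_smul hu hF, add_apply, smul_apply,
    ContinuousLinearMap.smulRight_apply, smul_eq_mul]
  module

lemma dd_smul (j : Fin n) {u : Cn n → ℂ} {F : Cn n → DForm n} {x : Cn n}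
    (hu : DifferentiableAt ℝ u x) (hF : DifferentiableAt ℝ F x) :
    dd j (fun w => u w • F w) x = u x • dd j F x + dd j u x • F x := by
  simp only [dd, fderiv_fun_smul hu hF, add_apply, smul_apply,
    ContinuousLinearMap.smulRight_apply, smul_eq_mul]
  module

lemma dd_const {V : Type*} [NormedAddCommGroup V] [NormedSpace ℝ V] [NormedSpace ℂ V] (j : Fin n)
    (c : V) (x : Cn n) : dd j (fun _ => c) x = 0 := by
  simp [dd]

lemma ddbar_const {V : Type*} [NormedAddCommGroup V] [NormedSpace ℝ V] [NormedSpace ℂ V]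
    (j : Fin n) (c : V) (x : Cn n) : ddbar j (fun _ => c) x = 0 := by
  simp [ddbar]

/-- The product of a scalar kernel with a kernel. -/
def smulKernel (u : Cn n → Cn n → ℂ) (K : Kernel n) : Kernel n := fun ζ z => u ζ z • K ζ z

lemma delbarZeta_smulKernel {u : Cn n → Cn n → ℂ} {K : Kernel n} {p : Cn n × Cn n}
    (hu : DifferentiableAt ℝ (onProd u) p) (hK : DifferentiableAt ℝ (onProd K) p) :
    delbarZeta (smulKernel u K) p.1 p.2 = u p.1 p.2 • delbarZeta K p.1 p.2 +
      wedge (∑ j, ddbar j (fun w => u w p.2) p.1 • genZeta (gen j true)) (K p.1 p.2) := by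
  simp only [delbarZeta, smulKernel]
  rw [sum_wedge, Finset.smul_sum, ← Finset.sum_add_distrib]
  refine Finset.sum_congr rfl fun j _ => ?_
  rw [ddbar_smul j (hasFDerivAt_onProd_left hu).differentiableAt
    (hasFDerivAt_onProd_left hK).differentiableAt, wedge_add, wedge_smul, wedge_smul, smul_wedge]

lemma delbarZ_smulKernel {u : Cn n → Cn n → ℂ} {K : Kernel n} {p : Cn n × Cn n}
    (hu : DifferentiableAt ℝ (onProd u) p) (hK : DifferentiableAt ℝ (onProd K) p) :
    delbarZ (smulKernel u K) p.1 p.2 = u p.1 p.2 • delbarZ K p.1 p.2 +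
      wedge (∑ j, ddbar j (fun w => u p.1 w) p.2 • genZ (gen j true)) (K p.1 p.2) := by
  simp only [delbarZ, smulKernel]
  rw [sum_wedge, Finset.smul_sum, ← Finset.sum_add_distrib]
  refine Finset.sum_congr rfl fun j _ => ?_
  rw [ddbar_smul j (hasFDerivAt_onProd_right hu).differentiableAt
    (hasFDerivAt_onProd_right hK).differentiableAt, wedge_add, wedge_smul, wedge_smul, smul_wedge]

/-- The numerator of the `μ`-th term of `C_q`. -/
def numer (q μ : ℕ) (a b : Kernel n) : Kernel n := fun ζ z =>
  wedge (a ζ z) <| wedge (b ζ z) <| wedge (wedgePow (delbarZeta a ζ z) μ) <|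
    wedge (wedgePow (delbarZeta b ζ z) (n - q - μ - 2)) (wedgePow (delbarZ b ζ z) q)

lemma contDiffAt_numer {a b : Kernel n} {p : Cn n × Cn n} (ha : ContDiffAt ℝ ∞ (onProd a) p)
    (hb : ContDiffAt ℝ ∞ (onProd b) p) (q μ : ℕ) :
    ContDiffAt ℝ ∞ (onProd (numer q μ a b)) p :=
  contDiffAt_wedge ha <| contDiffAt_wedge hb <|
    contDiffAt_wedge (contDiffAt_wedgePow (contDiffAt_delbarZeta ha) _) <|
    contDiffAt_wedge (contDiffAt_wedgePow (contDiffAt_delbarZeta hb) _)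
      (contDiffAt_wedgePow (contDiffAt_delbarZ hb) _)

/-- In ∂̄(ua) = u ∂̄a + ∂̄u ∧ a the second term dies against a ∧ b, and likewise for vb. Because
∂̄_z a = 0, the form ∂̄_z(ua) consists of the second term alone, so every term with ν > 0 vanishes.
-/
lemma Cqmn_smulKernel {a b : Kernel n} {u v : Cn n → Cn n → ℂ} {p : Cn n × Cn n}
    (ha1 : ∀ ζ z, IsZetaDegree 1 (a ζ z)) (hb1 : ∀ ζ z, IsZetaDegree 1 (b ζ z))
    (ha : DifferentiableAt ℝ (onProd a) p) (hb : DifferentiableAt ℝ (onProd b) p)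
    (haz : ∀ ζ z, delbarZ a ζ z = 0)
    (hu : DifferentiableAt ℝ (onProd u) p) (hv : DifferentiableAt ℝ (onProd v) p) (q μ ν : ℕ) :
    Cqmn q μ ν (smulKernel u a) (smulKernel v b) p.1 p.2 =
      if ν = 0 then (u p.1 p.2 ^ (μ + 1) * v p.1 p.2 ^ (n - q - μ - 2 + (q - ν) + 1)) •
        numer q μ a b p.1 p.2 else 0 := by
  have h := wedge_reduction (ha1 p.1 p.2) (hb1 p.1 p.2) (u p.1 p.2) (v p.1 p.2) μ (n - q - μ - 2)
    (q - ν) ν (A := delbarZeta a p.1 p.2) (B := delbarZeta b p.1 p.2) (B' := delbarZ b p.1 p.2)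
    (c := ∑ j, ddbar j (fun w => u w p.2) p.1 • genZeta (gen j true))
    (e := ∑ j, ddbar j (fun w => v w p.2) p.1 • genZeta (gen j true))
    (f := ∑ j, ddbar j (fun w => u p.1 w) p.2 • genZ (gen j true))
    (e' := ∑ j, ddbar j (fun w => v p.1 w) p.2 • genZ (gen j true))
  rw [Cqmn, delbarZeta_smulKernel hu ha, delbarZeta_smulKernel hv hb, delbarZ_smulKernel hu ha,
    delbarZ_smulKernel hv hb, haz, smul_zero, zero_add]
  refine h.trans ?_
  split_ifs with hν
  · subst hν
    rfl
  · rfl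

/-- The constant in the `μ`-th term of `C_q`. -/
def coeffCq (n q μ : ℕ) : ℂ :=
  (1 / (2 * Real.pi * Complex.I)) ^ n * ((μ + 0).choose μ : ℂ) * ((n - 2 - μ - 0).choose (q - 0) : ℂ)

lemma Cq_smulKernel {a b : Kernel n} {u v : Cn n → Cn n → ℂ} {p : Cn n × Cn n}
    (ha1 : ∀ ζ z, IsZetaDegree 1 (a ζ z)) (hb1 : ∀ ζ z, IsZetaDegree 1 (b ζ z))
    (ha : DifferentiableAt ℝ (onProd a) p) (hb : DifferentiableAt ℝ (onProd b) p)
    (haz : ∀ ζ z, delbarZ a ζ z = 0)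
    (hu : DifferentiableAt ℝ (onProd u) p) (hv : DifferentiableAt ℝ (onProd v) p) (q : ℕ) :
    Cq q (smulKernel u a) (smulKernel v b) p.1 p.2 =
      ∑ μ ∈ Finset.range (n - q - 1), coeffCq n q μ •
        ((u p.1 p.2 ^ (μ + 1) * v p.1 p.2 ^ (n - 1 - μ)) • numer q μ a b p.1 p.2) := by
  rw [Cq]
  refine Finset.sum_congr rfl fun μ hμ => ?_
  rw [Finset.sum_eq_single 0]
  · rw [Cqmn_smulKernel ha1 hb1 ha hb haz hu hv, if_pos rfl, coeffCq]
    -- The truncated subtractions are exact because μ < n - q - 1.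
    have : n - q - μ - 2 + (q - 0) + 1 = n - 1 - μ := by
      have := Finset.mem_range.1 hμ
      omega
    rw [this]
  · intro ν _ hν
    rw [Cqmn_smulKernel ha1 hb1 ha hb haz hu hv, if_neg hν, smul_zero]
  · intro h
    simp at h

lemma norm_fderiv_pow_le {X : Type*} [NormedAddCommGroup X] [NormedSpace ℝ X] {u : X → ℂ} {x : X}
    (hu : DifferentiableAt ℝ u x) (k : ℕ) :
    ‖fderiv ℝ (fun y => u y ^ k) x‖ ≤ k * ‖u x‖ ^ (k - 1) * ‖fderiv ℝ u x‖ := by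
  rw [fderiv_fun_pow k hu, norm_smul]
  simp

lemma norm_fderiv_smul_le {X : Type*} [NormedAddCommGroup X] [NormedSpace ℝ X] {u : X → ℂ}
    {F : X → DForm n} {x : X} (hu : DifferentiableAt ℝ u x) (hF : DifferentiableAt ℝ F x) :
    ‖fderiv ℝ (fun y => u y • F y) x‖ ≤ ‖u x‖ * ‖fderiv ℝ F x‖ + ‖fderiv ℝ u x‖ * ‖F x‖ := by
  rw [fderiv_fun_smul hu hF]
  refine (norm_add_le _ _).trans (add_le_add ?_ ?_)
  · rw [norm_smul]
  · refine ContinuousLinearMap.opNorm_le_bound _ (by positivity) fun w => ?_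
    rw [ContinuousLinearMap.smulRight_apply, norm_smul, mul_right_comm]
    gcongr
    exact ContinuousLinearMap.le_opNorm _ _

lemma norm_fderiv_mul_le {X : Type*} [NormedAddCommGroup X] [NormedSpace ℝ X] {u v : X → ℂ}
    {x : X} (hu : DifferentiableAt ℝ u x) (hv : DifferentiableAt ℝ v x) :
    ‖fderiv ℝ (fun y => u y * v y) x‖ ≤ ‖u x‖ * ‖fderiv ℝ v x‖ + ‖fderiv ℝ u x‖ * ‖v x‖ := by
  rw [fderiv_fun_mul hu hv]
  refine (norm_add_le _ _).trans (add_le_add ?_ ?_)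
  · rw [norm_smul]
  · rw [norm_smul, mul_comm]

/-- `C_q` and its first derivatives in terms of `u`, `v` and the numerators. -/
lemma Cq_first_order_bound {a b : Kernel n} {u v : Cn n → Cn n → ℂ} {p : Cn n × Cn n}
    (ha1 : ∀ ζ z, IsZetaDegree 1 (a ζ z)) (hb1 : ∀ ζ z, IsZetaDegree 1 (b ζ z))
    (ha : ContDiff ℝ ∞ (onProd a)) (hb : ContDiff ℝ ∞ (onProd b))
    (haz : ∀ ζ z, delbarZ a ζ z = 0)
    (hu : ContDiffAt ℝ ∞ (onProd u) p) (hv : ContDiffAt ℝ ∞ (onProd v) p) (q : ℕ) :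
    ‖Cq q (smulKernel u a) (smulKernel v b) p.1 p.2‖ +
      ‖fderiv ℝ (onProd (Cq q (smulKernel u a) (smulKernel v b))) p‖ ≤
      ∑ μ ∈ Finset.range (n - q - 1), ‖coeffCq n q μ‖ * n *
        (‖u p.1 p.2‖ ^ (μ + 1) * ‖v p.1 p.2‖ ^ (n - 1 - μ) *
          (‖numer q μ a b p.1 p.2‖ + ‖fderiv ℝ (onProd (numer q μ a b)) p‖) +
        (‖u p.1 p.2‖ ^ μ * ‖fderiv ℝ (onProd u) p‖ * ‖v p.1 p.2‖ ^ (n - 1 - μ) +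
          ‖u p.1 p.2‖ ^ (μ + 1) * ‖v p.1 p.2‖ ^ (n - 2 - μ) * ‖fderiv ℝ (onProd v) p‖) *
            ‖numer q μ a b p.1 p.2‖) := by
  -- The closed formula for C_q is needed in a neighbourhood of p, since it will be differentiated.
  -- Differentiability at nearby points is obtained from C¹ regularity: for finite order, being
  -- smooth at p passes to a neighbourhood.
  have hev : onProd (Cq q (smulKernel u a) (smulKernel v b)) =ᶠ[𝓝 p] fun p =>
      ∑ μ ∈ Finset.range (n - q - 1), coeffCq n q μ •
        ((u p.1 p.2 ^ (μ + 1) * v p.1 p.2 ^ (n - 1 - μ)) • numer q μ a b p.1 p.2) := by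
    have hu1 : ∀ᶠ p' in 𝓝 p, ContDiffAt ℝ 1 (onProd u) p' :=
      (hu.of_le (by simp)).eventually (by simp)
    have hv1 : ∀ᶠ p' in 𝓝 p, ContDiffAt ℝ 1 (onProd v) p' :=
      (hv.of_le (by simp)).eventually (by simp)
    filter_upwards [hu1, hv1] with p' hu' hv'
    exact Cq_smulKernel ha1 hb1 (ha.differentiable (by simp)).differentiableAt
      (hb.differentiable (by simp)).differentiableAt haz (hu'.differentiableAt (by simp))
      (hv'.differentiableAt (by simp)) q
  have hud : DifferentiableAt ℝ (fun p : Cn n × Cn n => u p.1 p.2) p :=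
    hu.differentiableAt (by simp)
  have hvd : DifferentiableAt ℝ (fun p : Cn n × Cn n => v p.1 p.2) p :=
    hv.differentiableAt (by simp)
  have hN : ∀ μ, DifferentiableAt ℝ (fun p : Cn n × Cn n => numer q μ a b p.1 p.2) p := fun μ =>
    (contDiffAt_numer ha.contDiffAt hb.contDiffAt q μ).differentiableAt (by simp)
  have hs : ∀ μ, DifferentiableAt ℝ (fun p : Cn n × Cn n =>
      u p.1 p.2 ^ (μ + 1) * v p.1 p.2 ^ (n - 1 - μ)) p := fun μ =>
    (hud.fun_pow _).fun_mul (hvd.fun_pow _)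
  have ht : ∀ μ, DifferentiableAt ℝ (fun p : Cn n × Cn n =>
      (u p.1 p.2 ^ (μ + 1) * v p.1 p.2 ^ (n - 1 - μ)) • numer q μ a b p.1 p.2) p := fun μ =>
    (hs μ).fun_smul (hN μ)
  rw [hev.fderiv_eq, show Cq q (smulKernel u a) (smulKernel v b) p.1 p.2 = _ from hev.eq_of_nhds,
    fderiv_fun_sum fun μ _ => (ht μ).fun_const_smul _]
  refine (add_le_add (norm_sum_le _ _) (norm_sum_le _ _)).trans ?_
  rw [← Finset.sum_add_distrib]
  refine Finset.sum_le_sum fun μ hμ => ?_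
  have hμn : μ + 1 ≤ n ∧ n - 1 - μ ≤ n ∧ 1 ≤ n := by
    have := Finset.mem_range.1 hμ; omega
  rw [fderiv_fun_const_smul (ht μ), norm_smul (coeffCq n q μ), norm_smul (coeffCq n q μ),
    ← mul_add, mul_assoc]
  gcongr
  set U := ‖u p.1 p.2‖
  set W := ‖v p.1 p.2‖
  have h1 := norm_fderiv_smul_le (hs μ) (hN μ)
  have h2 := norm_fderiv_mul_le (hud.fun_pow (μ + 1)) (hvd.fun_pow (n - 1 - μ))
  have h3 := norm_fderiv_pow_le hud (μ + 1)
  have h4 := norm_fderiv_pow_le hvd (n - 1 - μ)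
  have h5 : ‖u p.1 p.2 ^ (μ + 1) * v p.1 p.2 ^ (n - 1 - μ)‖ = U ^ (μ + 1) * W ^ (n - 1 - μ) := by
    rw [norm_mul, norm_pow, norm_pow]
  rw [norm_smul, h5]
  rw [norm_pow, norm_pow] at h2
  rw [h5] at h1
  have h6 : ‖fderiv ℝ (fun y : Cn n × Cn n => u y.1 y.2 ^ (μ + 1)) p‖ ≤
      n * (U ^ μ * ‖fderiv ℝ (onProd u) p‖) := by
    refine h3.trans ?_
    rw [Nat.add_sub_cancel, mul_assoc]
    gcongr
    exact_mod_cast hμn.1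
  have h7 : ‖fderiv ℝ (fun y : Cn n × Cn n => v y.1 y.2 ^ (n - 1 - μ)) p‖ ≤
      n * (W ^ (n - 2 - μ) * ‖fderiv ℝ (onProd v) p‖) := by
    refine h4.trans ?_
    rw [show n - 1 - μ - 1 = n - 2 - μ by omega, mul_assoc]
    gcongr
    exact_mod_cast hμn.2.1
  have hn1 : (1 : ℝ) ≤ n := by exact_mod_cast hμn.2.2
  have h8 : ‖fderiv ℝ (fun y : Cn n × Cn n => u y.1 y.2 ^ (μ + 1) * v y.1 y.2 ^ (n - 1 - μ)) p‖ ≤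
      n * (U ^ μ * ‖fderiv ℝ (onProd u) p‖ * W ^ (n - 1 - μ) +
        U ^ (μ + 1) * W ^ (n - 2 - μ) * ‖fderiv ℝ (onProd v) p‖) := by
    refine h2.trans ?_
    have e1 := mul_le_mul_of_nonneg_left h7 (show 0 ≤ U ^ (μ + 1) by positivity)
    have e2 := mul_le_mul_of_nonneg_right h6 (show 0 ≤ W ^ (n - 1 - μ) by positivity)
    refine (add_le_add e1 e2).trans_eq ?_
    ring
  have h9 := mul_le_mul_of_nonneg_right h8 (norm_nonneg (numer q μ a b p.1 p.2))
  have h10 : U ^ (μ + 1) * W ^ (n - 1 - μ) *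
      (‖numer q μ a b p.1 p.2‖ + ‖fderiv ℝ (onProd (numer q μ a b)) p‖) ≤
      n * (U ^ (μ + 1) * W ^ (n - 1 - μ) *
      (‖numer q μ a b p.1 p.2‖ + ‖fderiv ℝ (onProd (numer q μ a b)) p‖)) :=
    le_mul_of_one_le_left (by positivity) hn1
  have h11 := h1.trans (add_le_add le_rfl h9)
  refine (add_le_add le_rfl h11).trans ?_
  linarith

end Structure

/-! ### Complex coordinates and real derivatives -/

section Coordinates

variable {n : ℕ} {V : Type*} [NormedAddCommGroup V] [NormedSpace ℝ V] [NormedSpace ℂ V]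

lemma eq_sum_single (v : Cn n) : v = ∑ j, ((v j).re • EuclideanSpace.single j (1 : ℂ) +
    (v j).im • EuclideanSpace.single j Complex.I) := by
  ext k
  simp only [WithLp.ofLp_sum, Finset.sum_apply, PiLp.add_apply, PiLp.smul_apply,
    PiLp.single_apply, Complex.real_smul, mul_ite, mul_one, mul_zero]
  rw [Finset.sum_eq_single k]
  · simp [Complex.re_add_im]
  · intro j _ hj
    simp [Ne.symm hj]
  · simp

lemma fderiv_apply_eq_sum [IsScalarTower ℝ ℂ V] (f : Cn n → V) (x v : Cn n) :
    fderiv ℝ f x v = ∑ j, (v j • dd j f x + conj (v j) • ddbar j f x) := by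
  conv_lhs => rw [eq_sum_single v]
  rw [map_sum]
  refine Finset.sum_congr rfl fun j _ => ?_
  rw [map_add, map_smul, map_smul]
  set A := fderiv ℝ f x (EuclideanSpace.single j 1)
  set B := fderiv ℝ f x (EuclideanSpace.single j Complex.I)
  have hv : v j = (v j).re + (v j).im * Complex.I := (Complex.re_add_im _).symm
  have hc : conj (v j) = (v j).re - (v j).im * Complex.I := by
    apply Complex.ext <;> simp
  simp only [dd, ddbar]
  change _ = v j • (1 / 2 : ℂ) • (A - Complex.I • B) + conj (v j) • (1 / 2 : ℂ) • (A + Complex.I • B)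
  have h1 : (v j).re • A = ((v j).re : ℂ) • A :=
    (algebraMap_smul ℂ (v j).re A).symm
  have h2 : (v j).im • B = ((v j).im : ℂ) • B := 
    (algebraMap_smul ℂ (v j).im B).symm
  rw [h1, h2, hc]
  nth_rw 3 [hv]
  have hI : Complex.I * Complex.I = -1 := Complex.I_mul_I
  have e : ∀ (s t : ℂ), (s + t * Complex.I) • (1 / 2 : ℂ) • (A - Complex.I • B) +
      (s - t * Complex.I) • (1 / 2 : ℂ) • (A + Complex.I • B) =
      s • A - (t * (Complex.I * Complex.I)) • B := by
    intro s t
    module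
  rw [e, hI]
  module

variable {r : Cn n → ℝ}

lemma fderiv_ofReal_comp (hr : DifferentiableAt ℝ r x) :
    fderiv ℝ (fun y => (r y : ℂ)) x = Complex.ofRealCLM.comp (fderiv ℝ r x) :=
  (Complex.ofRealCLM.hasFDerivAt.comp x hr.hasFDerivAt).fderiv

lemma dr_eq (hr : ContDiff ℝ ∞ r) (j : Fin n) (x : Cn n) :
    dr r j x = (1 / 2 : ℂ) * ((fderiv ℝ r x (EuclideanSpace.single j 1) : ℝ) -
      Complex.I * (fderiv ℝ r x (EuclideanSpace.single j Complex.I) : ℝ)) := by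
  rw [dr, dd, fderiv_ofReal_comp (hr.differentiable (by simp)).differentiableAt]
  simp

lemma ddbar_ofReal (hr : ContDiff ℝ ∞ r) (j : Fin n) (x : Cn n) :
    ddbar j (fun y => (r y : ℂ)) x = conj (dr r j x) := by
  rw [dr_eq hr, ddbar, fderiv_ofReal_comp (hr.differentiable (by simp)).differentiableAt]
  apply Complex.ext <;> simp

lemma fderiv_eq_re_sum (hr : ContDiff ℝ ∞ r) (x v : Cn n) :
    fderiv ℝ r x v = 2 * (∑ j, dr r j x * v j).re := by
  have h := fderiv_apply_eq_sum (fun y => (r y : ℂ)) x v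
  rw [fderiv_ofReal_comp (hr.differentiable (by simp)).differentiableAt] at h
  simp only [ddbar_ofReal hr] at h
  have h2 := congrArg Complex.re h
  simp only [ContinuousLinearMap.comp_apply, Complex.ofRealCLM_apply, Complex.ofReal_re,
    Complex.re_sum, Complex.add_re, smul_eq_mul] at h2
  rw [h2, Complex.re_sum, Finset.mul_sum]
  refine Finset.sum_congr rfl fun j _ => ?_
  change (v j * dr r j x).re + _ = _
  simp only [Complex.mul_re, Complex.conj_re, Complex.conj_im]
  ring

lemma contDiff_dr (hr : ContDiff ℝ ∞ r) (j : Fin n) : ContDiff ℝ ∞ (dr r j) := by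
  refine contDiff_iff_contDiffAt.2 fun x => ?_
  have h : ContDiff ℝ ∞ (fun y => (r y : ℂ)) := Complex.ofRealCLM.contDiff.comp hr
  exact contDiffAt_dd_of_fderiv j (h := fun _ y => (r y : ℂ)) (y := id)
    (h.fderiv_right (by simp)).contDiffAt

lemma contDiff_dd_dr (hr : ContDiff ℝ ∞ r) (j k : Fin n) : ContDiff ℝ ∞ (dd k (dr r j)) :=
  contDiff_iff_contDiffAt.2 fun _ => contDiffAt_dd_of_fderiv k (h := fun _ => dr r j) (y := id)
    ((contDiff_dr hr j).fderiv_right (by simp)).contDiffAt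

lemma contDiff_leviMatrix (hr : ContDiff ℝ ∞ r) (j k : Fin n) :
    ContDiff ℝ ∞ (fun x => leviMatrix r x j k) :=
  contDiff_iff_contDiffAt.2 fun _ => contDiffAt_ddbar_of_fderiv k (h := fun _ => dr r j) (y := id)
    ((contDiff_dr hr j).fderiv_right (by simp)).contDiffAt

/-- The real Hessian splits into a holomorphic part and the Levi form. The Levi polynomial contains
the holomorphic part, so that the Levi form is what remains in `two_re_leviPoly`. -/
lemma fderiv_fderiv_eq (hr : ContDiff ℝ ∞ r) (x v : Cn n) :
    fderiv ℝ (fderiv ℝ r) x v v = 2 * (∑ j, ∑ k, dd k (dr r j) x * v j * v k).re +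
      2 * (∑ j, ∑ k, leviMatrix r x j k * v j * conj (v k)).re := by
  have hd : DifferentiableAt ℝ (fderiv ℝ r) x :=
    ((hr.fderiv_right (m := ∞) (by simp)).differentiable (by simp)).differentiableAt
  have h1 : fderiv ℝ (fderiv ℝ r) x v v = fderiv ℝ (fun y => fderiv ℝ r y v) x v := by
    rw [fderiv_clm_apply hd (differentiableAt_const v)]
    simp
  have h2 : (fun y => fderiv ℝ r y v) = fun y => 2 * Complex.reCLM (∑ j, dr r j y * v j) :=
    funext fun y => fderiv_eq_re_sum hr y v
  have h3 : HasFDerivAt (fun y => ∑ j, dr r j y * v j)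
      (∑ j, (v j) • fderiv ℝ (dr r j) x) x :=
    HasFDerivAt.fun_sum fun j _ =>
      (((contDiff_dr hr j).differentiable (by simp)).differentiableAt.hasFDerivAt).mul_const _
  have h4 : HasFDerivAt (fun y => 2 * Complex.reCLM (∑ j, dr r j y * v j)) _ x :=
    (Complex.reCLM.hasFDerivAt.comp x h3).const_mul (2 : ℝ)
  rw [h1, h2, h4.fderiv, ← mul_add, ← Complex.add_re, ← Finset.sum_add_distrib]
  simp only [smul_apply, ContinuousLinearMap.comp_apply, sum_apply,
    Complex.reCLM_apply, smul_eq_mul]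
  congr 2
  refine Finset.sum_congr rfl fun j _ => ?_
  rw [fderiv_apply_eq_sum, Finset.mul_sum, ← Finset.sum_add_distrib]
  refine Finset.sum_congr rfl fun k _ => ?_
  simp only [leviMatrix, Matrix.of_apply, smul_eq_mul]
  ring

/-! ### The size of the gradient -/

/-- `∑ |∂r/∂ζ_j|²`. -/
def gradSq (r : Cn n → ℝ) (x : Cn n) : ℝ := ∑ j, ‖dr r j x‖ ^ 2

/-- The Euclidean length of `∂r`. -/
def grad (r : Cn n → ℝ) (x : Cn n) : ℝ := Real.sqrt (gradSq r x)

lemma gradSq_nonneg (x : Cn n) : 0 ≤ gradSq r x := Finset.sum_nonneg fun _ _ => sq_nonneg _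

lemma grad_nonneg (x : Cn n) : 0 ≤ grad r x := Real.sqrt_nonneg _

lemma grad_sq (x : Cn n) : grad r x ^ 2 = gradSq r x := Real.sq_sqrt (gradSq_nonneg x)

lemma norm_dr_le_grad (j : Fin n) (x : Cn n) : ‖dr r j x‖ ≤ grad r x := by
  refine Real.le_sqrt_of_sq_le ?_
  exact Finset.single_le_sum (f := fun j => ‖dr r j x‖ ^ 2) (fun _ _ => sq_nonneg _)
    (Finset.mem_univ j)

lemma norm_fderiv_le_grad (hr : ContDiff ℝ ∞ r) (x : Cn n) :
    ‖fderiv ℝ r x‖ ≤ 2 * n * grad r x := by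
  refine ContinuousLinearMap.opNorm_le_bound _ (by have := grad_nonneg (r := r) x; positivity)
    fun v => ?_
  rw [fderiv_eq_re_sum hr, norm_mul, Real.norm_ofNat, mul_assoc, mul_assoc]
  refine mul_le_mul_of_nonneg_left ?_ (by norm_num)
  refine (Complex.abs_re_le_norm _).trans ((norm_sum_le _ _).trans ?_)
  refine (Finset.sum_le_card_nsmul _ _ (grad r x * ‖v‖) fun j _ => ?_).trans_eq (by simp)
  rw [norm_mul]
  exact mul_le_mul (norm_dr_le_grad j x) (PiLp.norm_apply_le v j) (norm_nonneg _) (grad_nonneg x)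

lemma norm_fderiv_sq_le (hr : ContDiff ℝ ∞ r) (x : Cn n) :
    ‖fderiv ℝ r x‖ ^ 2 ≤ (2 * n) ^ 2 * gradSq r x := by
  rw [← grad_sq, ← mul_pow]
  exact pow_le_pow_left₀ (norm_nonneg _) (norm_fderiv_le_grad hr x) 2

lemma contDiff_gradSq (hr : ContDiff ℝ ∞ r) : ContDiff ℝ ∞ (gradSq r) :=
  ContDiff.sum fun j _ => (contDiff_dr hr j).norm_sq ℝ

end Coordinates

/-! ### Estimates near the diagonal -/

section Diagonal

variable {n : ℕ} {E F : Type*} [NormedAddCommGroup E] [NormedSpace ℝ E] [NormedAddCommGroup F]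
  [NormedSpace ℝ F]

lemma exists_lipschitz_bound {f : E → F} (hf : ContDiff ℝ ∞ f) {S : Set E} (hS : IsCompact S)
    (hc : Convex ℝ S) : ∃ C : ℝ, 0 ≤ C ∧ ∀ x ∈ S, ∀ y ∈ S, ‖f x - f y‖ ≤ C * ‖x - y‖ := by
  obtain ⟨C, hC⟩ := hS.exists_bound_of_continuousOn (hf.continuous_fderiv (by simp)).continuousOn
  refine ⟨max C 0, le_max_right _ _, fun x hx y hy => ?_⟩
  refine hc.norm_image_sub_le_of_norm_fderiv_le (𝕜 := ℝ)
    (fun x _ => (hf.differentiable (by simp)).differentiableAt) (fun x hx => ?_) hy hx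
  exact (hC x hx).trans (le_max_left _ _)

/-- A smooth function controlled by `a` on the diagonal is controlled by `a(ζ) + |ζ - z|`. -/
lemma exists_near_diagonal_bound {f : Cn n × Cn n → F} (hf : ContDiff ℝ ∞ f) (R : ℝ)
    {a : Cn n → ℝ} {C₀ : ℝ} (ha : ∀ x ∈ Metric.closedBall (0 : Cn n) R, ‖f (x, x)‖ ≤ C₀ * a x) :
    ∃ C : ℝ, 0 ≤ C ∧ ∀ ζ ∈ Metric.closedBall (0 : Cn n) R, ∀ z ∈ Metric.closedBall (0 : Cn n) R,
      ‖f (ζ, z)‖ ≤ C₀ * a ζ + C * ‖ζ - z‖ := by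
  obtain ⟨C, hC0, hC⟩ := exists_lipschitz_bound hf
    ((isCompact_closedBall (0 : Cn n) R).prod (isCompact_closedBall (0 : Cn n) R))
    ((convex_closedBall _ _).prod (convex_closedBall _ _))
  refine ⟨C, hC0, fun ζ hζ z hz => ?_⟩
  have h1 := hC (ζ, z) ⟨hζ, hz⟩ (ζ, ζ) ⟨hζ, hζ⟩
  have h2 : ‖((ζ, z) : Cn n × Cn n) - (ζ, ζ)‖ = ‖ζ - z‖ := by
    rw [Prod.mk_sub_mk, sub_self, Prod.norm_mk, norm_zero, max_eq_right (norm_nonneg _),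
      norm_sub_rev]
  rw [h2] at h1
  calc ‖f (ζ, z)‖ = ‖f (ζ, ζ) + (f (ζ, z) - f (ζ, ζ))‖ := by rw [add_sub_cancel]
    _ ≤ ‖f (ζ, ζ)‖ + ‖f (ζ, z) - f (ζ, ζ)‖ := norm_add_le _ _
    _ ≤ _ := add_le_add (ha ζ hζ) h1

lemma exists_vanishing_bound {f : Cn n × Cn n → F} (hf : ContDiff ℝ ∞ f) (R : ℝ)
    (h0 : ∀ x, f (x, x) = 0) :
    ∃ C : ℝ, 0 ≤ C ∧ ∀ ζ ∈ Metric.closedBall (0 : Cn n) R, ∀ z ∈ Metric.closedBall (0 : Cn n) R,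
      ‖f (ζ, z)‖ ≤ C * ‖ζ - z‖ := by
  obtain ⟨C, hC0, hC⟩ := exists_near_diagonal_bound hf R (a := fun _ => 0) (C₀ := 0)
    (fun x _ => by simp [h0])
  exact ⟨C, hC0, fun ζ hζ z hz => by simpa using hC ζ hζ z hz⟩

/-- The derivative is O(|ζ - w|) at (ζ, w); the mean value inequality with ζ fixed and w running
from ζ to z gives the second factor |ζ - z|. -/
lemma exists_second_order_bound {f : Cn n × Cn n → F} (hf : ContDiff ℝ ∞ f) (R : ℝ)
    (h0 : ∀ x, f (x, x) = 0) (h1 : ∀ x, fderiv ℝ f (x, x) = 0) :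
    ∃ C : ℝ, 0 ≤ C ∧ ∀ ζ ∈ Metric.closedBall (0 : Cn n) R, ∀ z ∈ Metric.closedBall (0 : Cn n) R,
      ‖f (ζ, z)‖ ≤ C * ‖ζ - z‖ ^ 2 := by
  obtain ⟨C, hC0, hC⟩ := exists_vanishing_bound (hf.fderiv_right (m := ∞) (by simp)) R h1
  refine ⟨C, hC0, fun ζ hζ z hz => ?_⟩
  have hseg : segment ℝ ζ z ⊆ Metric.closedBall (0 : Cn n) R :=
    (convex_closedBall _ _).segment_subset hζ hz
  have hconv : Convex ℝ (({ζ} : Set (Cn n)) ×ˢ segment ℝ ζ z) :=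
    (convex_singleton ζ).prod (convex_segment ζ z)
  have h := hconv.norm_image_sub_le_of_norm_fderiv_le (𝕜 := ℝ) (f := f) (C := C * ‖ζ - z‖)
    (x := (ζ, ζ)) (y := (ζ, z)) (fun x _ => (hf.differentiable (by simp)).differentiableAt) ?_
    ⟨rfl, left_mem_segment ℝ ζ z⟩ ⟨rfl, right_mem_segment ℝ ζ z⟩
  · rw [h0, sub_zero, Prod.mk_sub_mk, sub_self, Prod.norm_mk, norm_zero,
      max_eq_right (norm_nonneg _), norm_sub_rev z ζ] at h
    exact h.trans_eq (by ring)
  · rintro ⟨x, w⟩ ⟨hx, hw⟩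
    obtain rfl : x = ζ := hx
    refine (hC x hζ w (hseg hw)).trans ?_
    gcongr
    obtain ⟨s, t, hs, ht, hst, rfl⟩ := hw
    change ‖x - (s • x + t • z)‖ ≤ _
    have : x - (s • x + t • z) = t • (x - z) := by
      rw [smul_sub, ← sub_sub]
      congr 1
      rw [sub_eq_iff_eq_add, ← add_smul, add_comm t s, hst, one_smul]
    rw [this, norm_smul, Real.norm_of_nonneg ht]
    exact mul_le_of_le_one_left (norm_nonneg _) (by linarith)

end Diagonal

/-! ### Comparison of `ρ` with the Euclidean distance -/

section Distance

variable {n : ℕ}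

/-- The quadratic form of a Hermitian matrix. -/
def quadForm (M : Matrix (Fin n) (Fin n) ℂ) (v : Cn n) : ℝ :=
  (∑ j, ∑ k, M j k * v j * conj (v k)).re

lemma quadForm_smul (M : Matrix (Fin n) (Fin n) ℂ) (t : ℝ) (v : Cn n) :
    quadForm M (t • v) = t ^ 2 * quadForm M v := by
  have : ∑ j, ∑ k, M j k * (t • v) j * conj ((t • v) k) =
      ((t ^ 2 : ℝ) : ℂ) * ∑ j, ∑ k, M j k * v j * conj (v k) := by
    simp only [Finset.mul_sum]
    refine Finset.sum_congr rfl fun j _ => Finset.sum_congr rfl fun k _ => ?_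
    simp only [PiLp.smul_apply, Complex.real_smul, map_mul, Complex.conj_ofReal, Complex.ofReal_pow]
    ring
  rw [quadForm, this, Complex.re_ofReal_mul, quadForm]

lemma quadForm_pos {M : Matrix (Fin n) (Fin n) ℂ} (hM : M.PosDef) {v : Cn n} (hv : v ≠ 0) :
    0 < quadForm M v := by
  have hx : (fun j => conj (v j)) ≠ 0 := fun h => hv <| by
    ext j
    simpa using congrFun h j
  have h := hM.dotProduct_mulVec_pos hx
  have h2 := (Complex.lt_def.1 h).1
  rw [Complex.zero_re] at h2
  refine h2.trans_eq ?_
  rw [quadForm]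
  congr 1
  simp only [dotProduct, Matrix.mulVec, Finset.mul_sum]
  refine Finset.sum_congr rfl fun j _ => Finset.sum_congr rfl fun k _ => ?_
  simp
  ring

lemma continuousOn_quadForm {M : Cn n → Matrix (Fin n) (Fin n) ℂ} {S : Set (Cn n)}
    (hM : ∀ j k, ContinuousOn (fun x => M x j k) S) :
    ContinuousOn (fun p : Cn n × Cn n => quadForm (M p.1) p.2) (S ×ˢ Set.univ) := by
  unfold quadForm
  refine Complex.continuous_re.comp_continuousOn ?_
  refine continuousOn_finsetSum _ fun j _ => continuousOn_finsetSum _ fun k _ => ?_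
  have h1 : ContinuousOn (fun p : Cn n × Cn n => M p.1 j k) (S ×ˢ Set.univ) :=
    (hM j k).comp continuousOn_fst fun p hp => hp.1
  have h2 : Continuous fun p : Cn n × Cn n => p.2 j := by fun_prop
  have h3 : Continuous fun p : Cn n × Cn n => conj (p.2 k) :=
    Complex.continuous_conj.comp (by fun_prop)
  exact (h1.mul h2.continuousOn).mul h3.continuousOn

/-- Uniform positivity of a continuous family of positive definite matrices on a compact set. -/
lemma exists_quadForm_lower {M : Cn n → Matrix (Fin n) (Fin n) ℂ} {S : Set (Cn n)}
    (hS : IsCompact S) (hM : ∀ j k, ContinuousOn (fun x => M x j k) S)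
    (hpos : ∀ x ∈ S, (M x).PosDef) :
    ∃ c > 0, ∀ x ∈ S, ∀ v, c * ‖v‖ ^ 2 ≤ quadForm (M x) v := by
  have hT : IsCompact (S ×ˢ Metric.sphere (0 : Cn n) 1) := hS.prod (isCompact_sphere _ _)
  have hcont : ContinuousOn (fun p : Cn n × Cn n => quadForm (M p.1) p.2)
      (S ×ˢ Metric.sphere (0 : Cn n) 1) :=
    (continuousOn_quadForm hM).mono (Set.prod_mono le_rfl (Set.subset_univ _))
  have hlow : ∃ c > 0, ∀ p ∈ S ×ˢ Metric.sphere (0 : Cn n) 1, c ≤ quadForm (M p.1) p.2 := by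
    rcases (S ×ˢ Metric.sphere (0 : Cn n) 1).eq_empty_or_nonempty with h | h
    · exact ⟨1, one_pos, by simp [h]⟩
    · obtain ⟨p, hp, hmin⟩ := hT.exists_isMinOn h hcont
      refine ⟨_, quadForm_pos (hpos p.1 hp.1) ?_, fun p' hp' => hmin hp'⟩
      rintro h0
      have := hp.2
      simp [h0] at this
  obtain ⟨c, hc, hlow⟩ := hlow
  refine ⟨c, hc, fun x hx v => ?_⟩
  by_cases hv : v = 0
  · subst hv
    simp [quadForm]
  have hn : ‖v‖ ≠ 0 := norm_ne_zero_iff.2 hv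
  have h := hlow (x, ‖v‖⁻¹ • v) ⟨hx, by simp [norm_smul, hn]⟩
  have hv' : v = ‖v‖ • (‖v‖⁻¹ • v) := by rw [smul_smul, mul_inv_cancel₀ hn, one_smul]
  conv_rhs => rw [hv', quadForm_smul]
  rw [mul_comm]
  gcongr

/-- The length of a `C¹` curve dominates the distance of its end points. -/
lemma exists_geodDist_lower {g : Cn n → Matrix (Fin n) (Fin n) ℂ}
    (hg : ∀ j k, ContDiff ℝ ∞ (fun x => g x j k)) (hpos : ∀ x, (g x).PosDef) (R : ℝ) :
    ∃ c > 0, ∀ x ∈ Metric.closedBall (0 : Cn n) R, ∀ y ∈ Metric.closedBall (0 : Cn n) R,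
      c * ‖x - y‖ ≤ geodDist g x y := by
  -- A competing curve may leave the ball, where the metric need not be bounded below uniformly. It
  -- is replaced by its image under a compactly supported map u that is the identity on the ball, so
  -- that compactness of the support suffices.
  obtain ⟨u, hu, hsupp, hux⟩ : ∃ u : Cn n → Cn n, ContDiff ℝ ∞ u ∧ HasCompactSupport u ∧
      ∀ x ∈ Metric.closedBall (0 : Cn n) R, u x = x := by
    let ψ : ContDiffBump (0 : Cn n) := ⟨max R 1, max R 1 + 1, by positivity, by linarith⟩
    refine ⟨fun x => ψ x • x, ψ.contDiff.smul contDiff_id, ψ.hasCompactSupport.smul_right,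
      fun x hx => ?_⟩
    have : ψ x = 1 :=
      ψ.one_of_mem_closedBall (Metric.closedBall_subset_closedBall (le_max_left _ _) hx)
    simp [this]
  obtain ⟨c, hc, hlow⟩ := exists_quadForm_lower (M := g) hsupp
    (fun j k => (hg j k).continuous.continuousOn) (fun x _ => hpos x)
  obtain ⟨M, hM⟩ := (IsCompact.exists_bound_of_continuousOn hsupp
    (hu.continuous_fderiv (by simp)).continuousOn)
  have hcs : 0 < Real.sqrt c := Real.sqrt_pos.2 hc
  set L := (max M 1) / Real.sqrt c with hL
  have hLpos : 0 < L := by positivity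
  -- On the support of u the metric is uniformly positive; off it the derivative of u is zero. So u
  -- shortens g-lengths up to the factor L everywhere.
  have hDu : ∀ x v, ‖fderiv ℝ u x v‖ ≤ L * Real.sqrt (quadForm (g x) v) := by
    intro x v
    by_cases hx : x ∈ tsupport u
    · refine ((fderiv ℝ u x).le_opNorm v).trans ?_
      have h1 : ‖fderiv ℝ u x‖ ≤ max M 1 := (hM x hx).trans (le_max_left _ _)
      have h2 : Real.sqrt c * ‖v‖ ≤ Real.sqrt (quadForm (g x) v) := by
        refine Real.le_sqrt_of_sq_le ?_
        rw [mul_pow, Real.sq_sqrt hc.le]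
        exact hlow x hx v
      calc ‖fderiv ℝ u x‖ * ‖v‖ ≤ max M 1 * ‖v‖ := by gcongr
        _ = L * (Real.sqrt c * ‖v‖) := by rw [hL]; field_simp
        _ ≤ _ := by gcongr
    · rw [fderiv_of_notMem_tsupport ℝ hx]
      simp only [zero_apply, norm_zero]
      positivity
  refine ⟨L⁻¹, by positivity, fun x hx y hy => ?_⟩
  rw [geodDist]
  -- The straight segment shows that the set of lengths is nonempty, which the infimum bound
  -- requires.
  refine le_csInf ⟨_, fun t => x + t • (y - x), by fun_prop, by simp, by simp, rfl⟩ ?_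
  rintro l ⟨γ, hγ, h0, h1, rfl⟩
  have hder : ∀ t, HasDerivAt (fun t => u (γ t)) (fderiv ℝ u (γ t) (deriv γ t)) t := fun t =>
    HasFDerivAt.comp_hasDerivAt (f := γ) (l := u) t
      (hu.differentiable (by simp)).differentiableAt.hasFDerivAt
      (hγ.differentiable (by simp)).differentiableAt.hasDerivAt
  have hu' : Continuous (fderiv ℝ u) := hu.continuous_fderiv (by simp)
  have hγ' : Continuous (deriv γ) := hγ.continuous_deriv (by simp)
  have hcont : Continuous fun t => fderiv ℝ u (γ t) (deriv γ t) :=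
    (hu'.comp hγ.continuous).clm_apply hγ'
  have hquad : Continuous fun t => quadForm (g (γ t)) (deriv γ t) := by
    have := continuousOn_quadForm (M := g) (S := Set.univ) fun j k => (hg j k).continuous.continuousOn
    rw [Set.univ_prod_univ, continuousOn_univ] at this
    have h3 : Continuous fun t => (γ t, deriv γ t) := hγ.continuous.prodMk hγ'
    exact Continuous.comp (g := fun p : Cn n × Cn n => quadForm (g p.1) p.2)
      (f := fun t => (γ t, deriv γ t)) this h3
  have hint := intervalIntegral.integral_eq_sub_of_hasDerivAt (a := 0) (b := 1)
    (fun t _ => hder t) (hcont.intervalIntegrable _ _)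
  rw [h0, h1, hux x hx, hux y hy] at hint
  have hle : ‖x - y‖ ≤ L * ∫ t in (0 : ℝ)..1, Real.sqrt (quadForm (g (γ t)) (deriv γ t)) := by
    rw [norm_sub_rev, ← hint, ← intervalIntegral.integral_const_mul]
    refine (intervalIntegral.norm_integral_le_integral_norm zero_le_one).trans ?_
    refine intervalIntegral.integral_mono_on zero_le_one (hcont.norm.intervalIntegrable _ _)
      ((continuous_const.mul hquad.sqrt).intervalIntegrable _ _) fun t _ => hDu _ _
  rw [inv_mul_le_iff₀ hLpos]
  exact hle

lemma geodDist_self (g : Cn n → Matrix (Fin n) (Fin n) ℂ) (x : Cn n) : geodDist g x x = 0 := by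
  refine le_antisymm (csInf_le ⟨0, ?_⟩ ?_) (Real.sInf_nonneg ?_)
  · rintro l ⟨γ, -, -, -, rfl⟩
    exact intervalIntegral.integral_nonneg zero_le_one fun t _ => Real.sqrt_nonneg _
  · exact ⟨fun _ => x, contDiff_const, rfl, rfl, by simp⟩
  · rintro l ⟨γ, -, -, -, rfl⟩
    exact intervalIntegral.integral_nonneg zero_le_one fun t _ => Real.sqrt_nonneg _

variable {g : Cn n → Matrix (Fin n) (Fin n) ℂ} {ρ : Cn n → Cn n → ℝ}

/-- `ρ²` as a function on the product. -/
def rhoSq (ρ : Cn n → Cn n → ℝ) (p : Cn n × Cn n) : ℝ := ρ p.1 p.2 ^ 2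

lemma IsDistance.rho_self (hρ : IsDistance g ρ) (x : Cn n) : ρ x x = 0 := by
  have h := Filter.Eventually.self_of_nhdsSet hρ.eq_geodDist (x, x) rfl
  rw [h, geodDist_self]

lemma IsDistance.rhoSq_self (hρ : IsDistance g ρ) (x : Cn n) : rhoSq ρ (x, x) = 0 := by
  simp [rhoSq, hρ.rho_self]

lemma IsDistance.contDiff_rhoSq (hρ : IsDistance g ρ) : ContDiff ℝ ∞ (rhoSq ρ) := hρ.smooth_sq

/-- The square ρ² is nonnegative and zero on the diagonal, so it has a minimum there. -/
lemma IsDistance.fderiv_rhoSq_self (hρ : IsDistance g ρ) (x : Cn n) :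
    fderiv ℝ (rhoSq ρ) (x, x) = 0 := by
  refine IsLocalMin.fderiv_eq_zero (Filter.Eventually.of_forall fun p => ?_)
  rw [hρ.rhoSq_self]
  exact sq_nonneg _

/-- Near the diagonal ρ is the geodesic distance, which dominates the Euclidean one. The rest of the
product of balls is compact and ρ² has a positive minimum on it. -/
lemma IsDistance.exists_lower (hρ : IsDistance g ρ)
    (hg : ∀ j k, ContDiff ℝ ∞ (fun x => g x j k)) (hpos : ∀ x, (g x).PosDef) (R : ℝ) :
    ∃ c > 0, ∀ x ∈ Metric.closedBall (0 : Cn n) R, ∀ y ∈ Metric.closedBall (0 : Cn n) R,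
      c * ‖x - y‖ ^ 2 ≤ ρ x y ^ 2 := by
  obtain ⟨c, hc, hlow⟩ := exists_geodDist_lower hg hpos R
  obtain ⟨O, hO, hdiag, hOsub⟩ := mem_nhdsSet_iff_exists.1 hρ.eq_geodDist
  set B := Metric.closedBall (0 : Cn n) R
  have hT : IsCompact ((B ×ˢ B) \ O) :=
    ((isCompact_closedBall _ _).prod (isCompact_closedBall _ _)).diff hO
  have hm : ∃ m > 0, ∀ p ∈ (B ×ˢ B) \ O, m ≤ rhoSq ρ p := by
    rcases ((B ×ˢ B) \ O).eq_empty_or_nonempty with h | h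
    · exact ⟨1, one_pos, by simp [h]⟩
    · obtain ⟨p, hp, hmin⟩ := hT.exists_isMinOn h hρ.contDiff_rhoSq.continuous.continuousOn
      refine ⟨_, ?_, fun p' hp' => hmin hp'⟩
      refine pow_pos (hρ.pos _ _ fun h => hp.2 (hdiag h)) 2
  obtain ⟨m, hm, hmle⟩ := hm
  -- The number 2|R| + 1 bounds the diameter of the ball and is positive for every R.
  refine ⟨min (c ^ 2) (m / ((2 * |R| + 1) ^ 2)), by positivity, fun x hx y hy => ?_⟩
  by_cases hxy : (x, y) ∈ O
  · have h1 : ρ x y = geodDist g x y := hOsub hxy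
    have h2 := hlow x hx y hy
    rw [h1]
    calc _ ≤ c ^ 2 * ‖x - y‖ ^ 2 := by gcongr; exact min_le_left _ _
      _ = (c * ‖x - y‖) ^ 2 := by ring
      _ ≤ _ := by gcongr
  · have h1 := hmle (x, y) ⟨⟨hx, hy⟩, hxy⟩
    have h2 : ‖x - y‖ ≤ 2 * |R| + 1 := by
      have hx' : ‖x‖ ≤ R := by simpa [B] using hx
      have hy' : ‖y‖ ≤ R := by simpa [B] using hy
      have := norm_sub_le x y
      have := le_abs_self R
      linarith
    calc _ ≤ m / ((2 * |R| + 1) ^ 2) * (2 * |R| + 1) ^ 2 := by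
          gcongr
          exact min_le_right _ _
      _ = m := by field_simp
      _ ≤ _ := h1

end Distance

/-! ### The domain and the function `γ` -/

section Domain

variable {n : ℕ} {r : Cn n → ℝ} {U : Set (Cn n)}

/-! ### The closed domain and the behaviour of r near its boundary -/

lemma isOpen_dom (hr : Continuous r) : IsOpen (dom r) := isOpen_lt hr continuous_const

lemma isOpen_domEps (hr : Continuous r) (ε : ℝ) : IsOpen (domEps r ε) :=
  isOpen_lt (hr.add continuous_const) continuous_const

lemma closure_domEps_subset (hr : Continuous r) (ε : ℝ) :
    closure (domEps r ε) ⊆ {x | r x + ε ≤ 0} :=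
  closure_minimal (fun x (hx : r x + ε < 0) => hx.le) (isClosed_le (hr.add continuous_const) continuous_const)

lemma closure_domEps_subset_dom (hr : Continuous r) {ε : ℝ} (hε : 0 < ε) :
    closure (domEps r ε) ⊆ dom r := fun x hx => by
  have : r x + ε ≤ 0 := closure_domEps_subset hr ε hx
  change r x < 0
  linarith

lemma IsHenkinLeiterer.isCompact_closure (hr : IsHenkinLeiterer r U) :
    IsCompact (closure (dom r)) := hr.bounded.isCompact_closure

lemma IsHenkinLeiterer.exists_ball (hr : IsHenkinLeiterer r U) :
    ∃ R : ℝ, closure (dom r) ⊆ Metric.closedBall 0 R :=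
  hr.isCompact_closure.isBounded.subset_closedBall 0

lemma IsHenkinLeiterer.mem_dom_or_mem_frontier (hr : IsHenkinLeiterer r U) {x : Cn n}
    (hx : x ∈ closure (dom r)) : x ∈ dom r ∨ x ∈ frontier (dom r) := by
  by_cases h : x ∈ dom r
  · exact Or.inl h
  · refine Or.inr ⟨hx, ?_⟩
    rwa [(isOpen_dom hr.smooth.continuous).interior_eq]

lemma IsHenkinLeiterer.frontier_eq_zero (hr : IsHenkinLeiterer r U) {x : Cn n}
    (hx : x ∈ frontier (dom r)) : r x = 0 := by
  rw [hr.boundary] at hx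
  exact hx

/-- Near the boundary one is in the region where `r` is strictly plurisubharmonic. -/
lemma IsHenkinLeiterer.exists_collar (hr : IsHenkinLeiterer r U) :
    ∃ m > 0, ∀ x ∈ closure (dom r), -m ≤ r x → x ∈ U := by
  have hT : IsCompact (closure (dom r) \ U) := hr.isCompact_closure.diff hr.isOpen
  rcases (closure (dom r) \ U).eq_empty_or_nonempty with h | h
  · refine ⟨1, one_pos, fun x hx _ => ?_⟩
    by_contra hxU
    exact (Set.mem_empty_iff_false x).1 (h ▸ ⟨hx, hxU⟩)
  -- Outside U the closure contains only interior points, where r < 0. The maximum of r over this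
  -- compact set is negative, and half its absolute value serves as collar width.
  · obtain ⟨y, hy, hmax⟩ := hT.exists_isMaxOn h hr.smooth.continuous.continuousOn
    have hy' : r y < 0 := by
      rcases hr.mem_dom_or_mem_frontier hy.1 with h1 | h1
      · exact h1
      · exact absurd (hr.boundary_subset h1) hy.2
    refine ⟨-r y / 2, by linarith, fun x hx hxr => ?_⟩
    by_contra hxU
    have : r x ≤ r y := hmax ⟨hx, hxU⟩
    linarith

/-- A function on `D` is bounded if it is bounded near every point of the closure. -/
lemma IsHenkinLeiterer.exists_bound_of_local (hr : IsHenkinLeiterer r U) {f : Cn n → ℝ}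
    (hf : ∀ x ∈ dom r, ContinuousAt f x)
    (hb : ∀ x ∈ frontier (dom r), ∃ V ∈ 𝓝 x, ∃ C : ℝ, ∀ y ∈ V ∩ dom r, f y ≤ C) :
    ∃ C : ℝ, 0 ≤ C ∧ ∀ y ∈ dom r, f y ≤ C := by
  have key : ∃ C : ℝ, 0 ≤ C ∧ ∀ y ∈ closure (dom r) ∩ dom r, f y ≤ C := by
    refine hr.isCompact_closure.induction_on
      (p := fun S => ∃ C : ℝ, 0 ≤ C ∧ ∀ y ∈ S ∩ dom r, f y ≤ C) ⟨0, le_rfl, by simp⟩ ?_ ?_ ?_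
    · rintro S T hST ⟨C, hC0, hC⟩
      exact ⟨C, hC0, fun y hy => hC y ⟨hST hy.1, hy.2⟩⟩
    · rintro S T ⟨C, hC0, hC⟩ ⟨C', hC0', hC'⟩
      refine ⟨max C C', hC0.trans (le_max_left _ _), ?_⟩
      rintro y ⟨hy | hy, hyd⟩
      · exact (hC y ⟨hy, hyd⟩).trans (le_max_left _ _)
      · exact (hC' y ⟨hy, hyd⟩).trans (le_max_right _ _)
    · intro x hx
      rcases hr.mem_dom_or_mem_frontier hx with h | h
      · have hev : ∀ᶠ y in 𝓝 x, f y < f x + 1 :=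
          (hf x h).eventually_lt continuousAt_const (by linarith)
        exact ⟨_, mem_nhdsWithin_of_mem_nhds hev, max (f x + 1) 0, le_max_right _ _,
          fun y hy => (le_of_lt hy.1).trans (le_max_left _ _)⟩
      · obtain ⟨V, hV, C, hC⟩ := hb x h
        exact ⟨V, mem_nhdsWithin_of_mem_nhds hV, max C 0, le_max_right _ _,
          fun y hy => (hC y hy).trans (le_max_left _ _)⟩
  obtain ⟨C, hC0, hC⟩ := key
  exact ⟨C, hC0, fun y hy => hC y ⟨subset_closure hy, hy⟩⟩

/-- Near a boundary point `r` is controlled by the square of its gradient. -/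
lemma IsHenkinLeiterer.exists_le_gradSq (hr : IsHenkinLeiterer r U) {p : Cn n}
    (hp : p ∈ frontier (dom r)) : ∃ V ∈ 𝓝 p, ∃ C : ℝ, 0 ≤ C ∧ ∀ y ∈ V, |r y| ≤ C * gradSq r y := by
  have hr0 := hr.frontier_eq_zero hp
  have hsm := hr.smooth
  have hDr : ContDiff ℝ ∞ (fderiv ℝ r) := hsm.fderiv_right (by simp)
  -- At a critical boundary point r vanishes to second order while, by nondegeneracy, |y - p| =
  -- O(|Dr(y)|). At a regular point the gradient is bounded below nearby and there is nothing to
  -- compare.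
  by_cases hd : fderiv ℝ r p = 0
  · set T := fderiv ℝ (fderiv ℝ r) p
    have hT : HasFDerivAt (fderiv ℝ r) T p :=
      (hDr.differentiable (by simp)).differentiableAt.hasFDerivAt
    have hker : LinearMap.ker (T : Cn n →ₗ[ℝ] (Cn n →L[ℝ] ℝ)) = ⊥ := by
      rw [LinearMap.ker_eq_bot']
      intro v hv
      refine hr.morse p (hr.boundary_subset hp) hd v fun w => ?_
      exact congrArg (fun L : Cn n →L[ℝ] ℝ => L w) hv
    obtain ⟨K, hK, hanti⟩ := LinearMap.exists_antilipschitzWith _ hker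
    have hlow : ∀ v, ‖v‖ ≤ K * ‖T v‖ := fun v => by
      have h := hanti.le_mul_dist v 0
      rw [dist_zero_right, map_zero, dist_zero_right] at h
      exact h
    have hKpos : (0 : ℝ) < K := hK
    -- With linearization error below |y - p|/(2K), the lower bound |v| ≤ K|Tv| absorbs half of |y -
    -- p|.
    have hev : ∀ᶠ y in 𝓝 p, ‖fderiv ℝ r y - fderiv ℝ r p - T (y - p)‖ ≤
        (1 / (2 * K)) * ‖y - p‖ := hT.isLittleO.def (by positivity)
    obtain ⟨M, hM0, hM⟩ := exists_lipschitz_bound hDr (isCompact_closedBall p 1)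
      (convex_closedBall p 1)
    refine ⟨_, Filter.inter_mem hev (Metric.closedBall_mem_nhds p one_pos),
      M * (2 * K) ^ 2 * (2 * n) ^ 2, by positivity, fun y hy => ?_⟩
    have h1 : ‖fderiv ℝ r y - fderiv ℝ r p - T (y - p)‖ ≤ (1 / (2 * K)) * ‖y - p‖ := hy.1
    rw [hd, sub_zero] at h1
    have h2 : ‖y - p‖ ≤ 2 * K * ‖fderiv ℝ r y‖ := by
      have h3 := hlow (y - p)
      have h4 : ‖T (y - p)‖ ≤ ‖fderiv ℝ r y‖ + (1 / (2 * K)) * ‖y - p‖ := by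
        have := norm_sub_norm_le (T (y - p)) (fderiv ℝ r y)
        rw [norm_sub_rev] at this
        linarith
      have h5 := mul_le_mul_of_nonneg_left h4 hKpos.le
      have h6 : (K : ℝ) * (‖fderiv ℝ r y‖ + (1 / (2 * K)) * ‖y - p‖) =
          K * ‖fderiv ℝ r y‖ + ‖y - p‖ / 2 := by field_simp
      linarith
    have h7 : |r y| ≤ M * ‖y - p‖ ^ 2 := by
      have hseg : segment ℝ p y ⊆ Metric.closedBall p 1 :=
        (convex_closedBall _ _).segment_subset (Metric.mem_closedBall_self zero_le_one) hy.2
      have h := (convex_segment p y).norm_image_sub_le_of_norm_fderiv_le (𝕜 := ℝ) (f := r)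
        (C := M * ‖y - p‖) (fun x _ => (hsm.differentiable (by simp)).differentiableAt) ?_
        (left_mem_segment ℝ p y) (right_mem_segment ℝ p y)
      · rw [hr0, sub_zero, Real.norm_eq_abs] at h
        exact h.trans_eq (by ring)
      · intro x hx
        have h8 := hM x (hseg hx) p (Metric.mem_closedBall_self zero_le_one)
        rw [hd, sub_zero] at h8
        refine h8.trans ?_
        gcongr
        obtain ⟨s, t, hs, ht, hst, rfl⟩ := hx
        have : s • p + t • y - p = t • (y - p) := by
          have : s = 1 - t := by linarith
          rw [this]
          module
        rw [this, norm_smul, Real.norm_of_nonneg ht]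
        exact mul_le_of_le_one_left (norm_nonneg _) (by linarith)
    calc |r y| ≤ M * ‖y - p‖ ^ 2 := h7
      _ ≤ M * (2 * K * ‖fderiv ℝ r y‖) ^ 2 := by gcongr
      _ = M * (2 * K) ^ 2 * ‖fderiv ℝ r y‖ ^ 2 := by ring
      _ ≤ M * (2 * K) ^ 2 * ((2 * n) ^ 2 * gradSq r y) := by
          gcongr
          exact norm_fderiv_sq_le hsm y
      _ = _ := by ring
  · have hpos : 0 < gradSq r p := by
      have h1 := norm_fderiv_sq_le hsm p
      have h2 : 0 < ‖fderiv ℝ r p‖ ^ 2 := pow_pos (norm_pos_iff.2 hd) 2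
      by_contra h
      have h3 : gradSq r p = 0 := le_antisymm (not_lt.1 h) (gradSq_nonneg p)
      rw [h3, mul_zero] at h1
      linarith
    have h1 : ∀ᶠ y in 𝓝 p, gradSq r p / 2 < gradSq r y :=
      continuousAt_const.eventually_lt (contDiff_gradSq hsm).continuous.continuousAt (by linarith)
    have h2 : ∀ᶠ y in 𝓝 p, |r y| < 1 :=
      hsm.continuous.abs.continuousAt.eventually_lt continuousAt_const (by simp [hr0])
    refine ⟨_, Filter.inter_mem h1 h2, 2 / gradSq r p, by positivity, fun y hy => ?_⟩
    have h3 : gradSq r p / 2 < gradSq r y := hy.1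
    have h4 : |r y| < 1 := hy.2
    rw [div_mul_eq_mul_div, le_div_iff₀ hpos]
    nlinarith

/-! ### Comparison of γ with |∂r| and with r -/

variable {g : Cn n → Matrix (Fin n) (Fin n) ℂ} {γ : Cn n → ℝ}

/-- The square of the length of `∂r` in the metric `g`. -/
def normDrSq (r : Cn n → ℝ) (g : Cn n → Matrix (Fin n) (Fin n) ℂ) (x : Cn n) : ℝ :=
  (∑ j, ∑ k, 2 * (g x)⁻¹ k j * dr r j x * conj (dr r k x)).re

/-- The vector with components `∂r/∂ζ_j`. -/
def gradVec (r : Cn n → ℝ) (x : Cn n) : Cn n := WithLp.toLp 2 fun j => dr r j x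

lemma norm_gradVec (x : Cn n) : ‖gradVec r x‖ = grad r x := by
  rw [EuclideanSpace.norm_eq]
  rfl

lemma normDrSq_eq (x : Cn n) : normDrSq r g x = 2 * quadForm ((g x)⁻¹.transpose) (gradVec r x) := by
  have : (2 : ℝ) * quadForm ((g x)⁻¹.transpose) (gradVec r x) =
      (((2 : ℝ) : ℂ) * ∑ j, ∑ k, (g x)⁻¹.transpose j k * gradVec r x j *
        conj (gradVec r x k)).re := by
    rw [Complex.re_ofReal_mul]
    rfl
  rw [this, normDrSq, Finset.mul_sum]
  congr 1
  refine Finset.sum_congr rfl fun j _ => ?_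
  rw [Finset.mul_sum]
  refine Finset.sum_congr rfl fun k _ => ?_
  simp [gradVec]
  ring

lemma IsLeviMetric.contDiff_inv (hg : IsLeviMetric r U g) (j k : Fin n) :
    ContDiff ℝ ∞ (fun x => (g x)⁻¹ j k) :=
  contDiff_iff_contDiffAt.2 fun x =>
    contDiffAt_matrix_inv (fun i j => (hg.smooth i j).contDiffAt) (hg.posDef x).det_pos.ne' j k

lemma IsLeviMetric.exists_grad_le (hg : IsLeviMetric r U g) (R : ℝ) :
    ∃ c > 0, ∀ x ∈ Metric.closedBall (0 : Cn n) R, c * gradSq r x ≤ normDrSq r g x := by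
  obtain ⟨c, hc, h⟩ := exists_quadForm_lower (M := fun x => (g x)⁻¹.transpose)
    (isCompact_closedBall (0 : Cn n) R)
    (fun j k => (hg.contDiff_inv k j).continuous.continuousOn)
    (fun x _ => (hg.posDef x).inv.transpose)
  refine ⟨2 * c, by positivity, fun x hx => ?_⟩
  have h1 := h x hx (gradVec r x)
  rw [norm_gradVec, grad_sq] at h1
  rw [normDrSq_eq]
  linarith

lemma contDiff_normDrSq (hr : ContDiff ℝ ∞ r) (hg : IsLeviMetric r U g) :
    ContDiff ℝ ∞ (normDrSq r g) := by
  refine Complex.reCLM.contDiff.comp ?_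
  refine ContDiff.sum fun j _ => ContDiff.sum fun k _ => ?_
  exact ((contDiff_const.mul (hg.contDiff_inv k j)).mul (contDiff_dr hr j)).mul
    (Complex.conjCLE.contDiff.comp (contDiff_dr hr k))

/-- Every summand contains two first derivatives of r, so after one differentiation at least one of
them is left. -/
lemma exists_fderiv_normDrSq_le (hr : ContDiff ℝ ∞ r) (hg : IsLeviMetric r U g) (R : ℝ) :
    ∃ C : ℝ, 0 ≤ C ∧ ∀ x ∈ Metric.closedBall (0 : Cn n) R,
      ‖fderiv ℝ (normDrSq r g) x‖ ≤ C * grad r x := by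
  have hA : ∀ j k, ContDiff ℝ ∞ fun x => 2 * (g x)⁻¹ k j * dr r j x := fun j k =>
    (contDiff_const.mul (hg.contDiff_inv k j)).mul (contDiff_dr hr j)
  have hB : ∀ k, ContDiff ℝ ∞ fun x => conj (dr r k x) := fun k =>
    Complex.conjCLE.contDiff.comp (contDiff_dr hr k)
  have hcpt := isCompact_closedBall (0 : Cn n) R
  have hterm : ∀ j k, ∃ C : ℝ, 0 ≤ C ∧ ∀ x ∈ Metric.closedBall (0 : Cn n) R,
      ‖fderiv ℝ (fun x => 2 * (g x)⁻¹ k j * dr r j x * conj (dr r k x)) x‖ ≤ C * grad r x := by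
    intro j k
    obtain ⟨C₁, h1⟩ := hcpt.exists_bound_of_continuousOn
      ((hA j k).continuous_fderiv (by simp)).continuousOn
    obtain ⟨C₂, h2⟩ := hcpt.exists_bound_of_continuousOn
      ((hB k).continuous_fderiv (by simp)).continuousOn
    obtain ⟨C₃, h3⟩ := hcpt.exists_bound_of_continuousOn
      (f := fun x => 2 * (g x)⁻¹ k j)
      (contDiff_const.mul (hg.contDiff_inv k j)).continuous.continuousOn
    refine ⟨max C₃ 0 * max C₂ 0 + max C₁ 0, by positivity, fun x hx => ?_⟩
    have hga := grad_nonneg (r := r) x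
    refine (norm_fderiv_mul_le ((hA j k).differentiable (by simp)).differentiableAt
      ((hB k).differentiable (by simp)).differentiableAt).trans ?_
    rw [add_mul]
    refine add_le_add ?_ ?_
    · rw [norm_mul, mul_right_comm _ (max C₂ 0)]
      refine mul_le_mul (mul_le_mul ((h3 x hx).trans (le_max_left _ _)) (norm_dr_le_grad j x)
        (norm_nonneg _) (by positivity)) ((h2 x hx).trans (le_max_left _ _)) (norm_nonneg _)
        (by positivity)
    · refine mul_le_mul ((h1 x hx).trans (le_max_left _ _)) ?_ (norm_nonneg _) (by positivity)
      rw [RCLike.norm_conj]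
      exact norm_dr_le_grad k x
  choose C hC0 hC using hterm
  refine ⟨∑ j, ∑ k, C j k, by exact Finset.sum_nonneg fun j _ => Finset.sum_nonneg fun k _ => hC0 j k,
    fun x hx => ?_⟩
  have hd : ∀ j k, DifferentiableAt ℝ
      (fun x => 2 * (g x)⁻¹ k j * dr r j x * conj (dr r k x)) x := fun j k =>
    (((hA j k).mul (hB k)).differentiable (by simp)).differentiableAt
  have h1 : HasFDerivAt (normDrSq r g) (Complex.reCLM.comp (∑ j, ∑ k,
      fderiv ℝ (fun x => 2 * (g x)⁻¹ k j * dr r j x * conj (dr r k x)) x)) x :=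
    Complex.reCLM.hasFDerivAt.comp x (HasFDerivAt.fun_sum fun j _ => HasFDerivAt.fun_sum fun k _ =>
      (hd j k).hasFDerivAt)
  rw [h1.fderiv]
  refine (ContinuousLinearMap.opNorm_comp_le _ _).trans ?_
  rw [Complex.reCLM_norm, one_mul, Finset.sum_mul]
  refine (norm_sum_le _ _).trans (Finset.sum_le_sum fun j _ => ?_)
  rw [Finset.sum_mul]
  exact (norm_sum_le _ _).trans (Finset.sum_le_sum fun k _ => hC j k x hx)

lemma IsGamma.continuousAt (hγ : IsGamma r U g γ) (hr : Continuous r) {x : Cn n}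
    (hx : x ∈ dom r) : ContinuousAt γ x :=
  (hγ.smooth.continuousOn).continuousAt ((isOpen_dom hr).mem_nhds hx)

lemma IsGamma.contDiffAt (hγ : IsGamma r U g γ) (hr : Continuous r) {x : Cn n}
    (hx : x ∈ dom r) : ContDiffAt ℝ ∞ γ x :=
  hγ.smooth.contDiffAt ((isOpen_dom hr).mem_nhds hx)

lemma continuous_grad (hr : ContDiff ℝ ∞ r) : Continuous (grad r) :=
  (contDiff_gradSq hr).continuous.sqrt

/-- Near the boundary γ is the length of ∂r in g, comparable from below to the Euclidean length;
near interior points the quotient is bounded by continuity. Compactness of the closure does the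
rest, here and for the next bounds. -/
lemma IsGamma.exists_grad_le (hγ : IsGamma r U g γ) (hr : IsHenkinLeiterer r U)
    (hg : IsLeviMetric r U g) : ∃ C : ℝ, 0 ≤ C ∧ ∀ x ∈ dom r, grad r x ≤ C * γ x := by
  obtain ⟨R, hR⟩ := hr.exists_ball
  obtain ⟨c, hc, hlow⟩ := hg.exists_grad_le R
  have hrc := hr.smooth.continuous
  obtain ⟨C, hC0, hC⟩ := hr.exists_bound_of_local (f := fun x => grad r x / γ x)
    (fun x hx => (continuous_grad hr.smooth).continuousAt.div (hγ.continuousAt hrc hx)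
      (hγ.pos x hx).ne') fun x hx => by
    refine ⟨U, hr.isOpen.mem_nhds (hr.boundary_subset hx), (Real.sqrt c)⁻¹, fun y hy => ?_⟩
    have hpos := hγ.pos y hy.2
    rw [div_le_iff₀ hpos, hγ.eq_norm y ⟨hy.2, hy.1⟩, inv_mul_eq_div,
      le_div_iff₀ (Real.sqrt_pos.2 hc)]
    refine Real.le_sqrt_of_sq_le ?_
    rw [mul_pow, Real.sq_sqrt hc.le, grad_sq, mul_comm]
    exact hlow y (hR (subset_closure hy.2))
  exact ⟨C, hC0, fun x hx => (div_le_iff₀ (hγ.pos x hx)).1 (hC x hx)⟩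

lemma IsGamma.exists_upper (hγ : IsGamma r U g γ) (hr : IsHenkinLeiterer r U)
    (hg : IsLeviMetric r U g) : ∃ C : ℝ, 0 ≤ C ∧ ∀ x ∈ dom r, γ x ≤ C := by
  have hrc := hr.smooth.continuous
  obtain ⟨M, hM⟩ := hr.isCompact_closure.exists_bound_of_continuousOn
    (contDiff_normDrSq hr.smooth hg).continuous.continuousOn
  refine hr.exists_bound_of_local (fun x hx => hγ.continuousAt hrc hx) fun x hx =>
    ⟨U, hr.isOpen.mem_nhds (hr.boundary_subset hx), Real.sqrt M, fun y hy => ?_⟩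
  rw [hγ.eq_norm y ⟨hy.2, hy.1⟩]
  exact Real.sqrt_le_sqrt ((le_abs_self _).trans (hM y (subset_closure hy.2)))

/-- The Morse estimate |r| = O(|∂r|²) near the boundary is combined with |∂r| = O(γ). This makes
r_ε/γ and its derivative bounded although 1/γ is not. -/
lemma IsGamma.exists_abs_le (hγ : IsGamma r U g γ) (hr : IsHenkinLeiterer r U)
    (hg : IsLeviMetric r U g) : ∃ C : ℝ, 0 ≤ C ∧ ∀ x ∈ dom r, |r x| ≤ C * γ x ^ 2 := by
  have hrc := hr.smooth.continuous
  obtain ⟨A, hA0, hA⟩ := hγ.exists_grad_le hr hg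
  obtain ⟨C, hC0, hC⟩ := hr.exists_bound_of_local (f := fun x => |r x| / γ x ^ 2)
    (fun x hx => hrc.abs.continuousAt.div ((hγ.continuousAt hrc hx).pow 2)
      (pow_ne_zero 2 (hγ.pos x hx).ne')) fun x hx => by
    obtain ⟨V, hV, C, hC0, hC⟩ := hr.exists_le_gradSq hx
    refine ⟨V, hV, C * A ^ 2, fun y hy => ?_⟩
    have hpos := hγ.pos y hy.2
    rw [div_le_iff₀ (by positivity)]
    refine (hC y hy.1).trans ?_
    rw [mul_assoc, ← mul_pow, ← grad_sq]
    gcongr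
    · exact grad_nonneg y
    · exact hA y hy.2
  exact ⟨C, hC0, fun x hx => (div_le_iff₀ (pow_pos (hγ.pos x hx) 2)).1 (hC x hx)⟩

/-- Near the boundary γ² is the smooth function `normDrSq`, whose derivative is O(|∂r|) = O(γ).
Dividing 2γ Dγ = O(γ) by γ gives the bound, even close to critical points of r. -/
lemma IsGamma.exists_fderiv_le (hγ : IsGamma r U g γ) (hr : IsHenkinLeiterer r U)
    (hg : IsLeviMetric r U g) : ∃ C : ℝ, 0 ≤ C ∧ ∀ x ∈ dom r, ‖fderiv ℝ γ x‖ ≤ C := by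
  have hrc := hr.smooth.continuous
  obtain ⟨R, hR⟩ := hr.exists_ball
  obtain ⟨A, hA0, hA⟩ := hγ.exists_grad_le hr hg
  obtain ⟨B, hB0, hB⟩ := exists_fderiv_normDrSq_le hr.smooth hg R
  refine hr.exists_bound_of_local (fun x hx => ?_) fun x hx =>
    ⟨U, hr.isOpen.mem_nhds (hr.boundary_subset hx), B * A, fun y hy => ?_⟩
  · exact (((hγ.contDiffAt hrc hx).fderiv_right (m := 0) (by simp)).continuousAt).norm
  · have hpos := hγ.pos y hy.2
    have hev : (fun y => γ y ^ 2) =ᶠ[𝓝 y] normDrSq r g := by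
      filter_upwards [((isOpen_dom hrc).inter hr.isOpen).mem_nhds ⟨hy.2, hy.1⟩] with w hw
      have hw0 := hγ.pos w hw.1
      rw [hγ.eq_norm w hw] at hw0 ⊢
      exact Real.sq_sqrt (Real.sqrt_pos.1 hw0).le
    have hd : HasFDerivAt (fun y => γ y ^ 2) _ y :=
      ((hγ.contDiffAt hrc hy.2).differentiableAt (by simp)).hasFDerivAt.pow 2
    have h1 := hev.fderiv_eq (𝕜 := ℝ)
    rw [hd.fderiv] at h1
    have h2 := hB y (hR (subset_closure hy.2))
    rw [← h1, norm_smul] at h2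
    have h3 := hA y hy.2
    have h4 : ‖(2 : ℕ) • γ y ^ (2 - 1)‖ = 2 * γ y := by
      rw [Real.norm_of_nonneg (by positivity)]
      simp
    rw [h4] at h2
    have h5 : 2 * γ y * ‖fderiv ℝ γ y‖ ≤ B * (A * γ y) := h2.trans (by gcongr)
    have h6 : 0 ≤ B * A := by positivity
    have h7 := norm_nonneg (fderiv ℝ γ y)
    by_contra hcon
    push Not at hcon
    nlinarith [mul_lt_mul_of_pos_left hcon hpos]

/-- `∑ |∂r/∂ζ_j|²` is a weight of order two. -/
lemma isWeight_gradSq (hγ : IsGamma r U g γ) (hr : IsHenkinLeiterer r U)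
    (hg : IsLeviMetric r U g) : IsWeight r γ 2 (gradSq r) := by
  refine ⟨(contDiff_gradSq hr.smooth).contDiffOn, fun a => ?_⟩
  obtain ⟨A, hA0, hA⟩ := hγ.exists_grad_le hr hg
  obtain ⟨G, hG0, hG⟩ := hγ.exists_upper hr hg
  have hzp : ∀ x, γ x ^ (2 : ℤ) = γ x ^ 2 := fun x => by norm_cast
  match a with
  | 0 =>
    refine ⟨A ^ 2, fun x hx => ?_⟩
    rw [pow_zero, one_mul, norm_iteratedFDeriv_zero, Real.norm_of_nonneg (gradSq_nonneg x), hzp,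
      ← mul_pow, ← grad_sq]
    exact pow_le_pow_left₀ (grad_nonneg x) (hA x hx) 2
  | 1 =>
    have hterm : ∀ j : Fin n, ∃ C : ℝ, 0 ≤ C ∧ ∀ x ∈ closure (dom r),
        ‖fderiv ℝ (fun x => ‖dr r j x‖ ^ 2) x‖ ≤ C * grad r x := by
      intro j
      obtain ⟨C, hC⟩ := hr.isCompact_closure.exists_bound_of_continuousOn
        ((contDiff_dr hr.smooth j).continuous_fderiv (by simp)).continuousOn
      refine ⟨2 * max C 0, by positivity, fun x hx => ?_⟩
      have hd : HasFDerivAt (fun x => ‖dr r j x‖ ^ 2) _ x :=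
        (((contDiff_dr hr.smooth j).differentiable (by simp)).differentiableAt.hasFDerivAt
          (x := x)).norm_sq
      have hga := grad_nonneg (r := r) x
      rw [hd.fderiv]
      refine ContinuousLinearMap.opNorm_le_bound _ (by positivity) fun v => ?_
      have h1 := norm_dr_le_grad (r := r) j x
      have h2 := ((fderiv ℝ (dr r j) x).le_opNorm v).trans
        (mul_le_mul_of_nonneg_right ((hC x hx).trans (le_max_left C 0)) (norm_nonneg v))
      have h3 := norm_inner_le_norm (𝕜 := ℝ) (dr r j x) (fderiv ℝ (dr r j) x v)
      have h4 := mul_le_mul h1 h2 (norm_nonneg _) hga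
      have h5 := h3.trans h4
      change ‖(2 : ℕ) • inner ℝ (dr r j x) (fderiv ℝ (dr r j) x v)‖ ≤ _
      rw [nsmul_eq_mul, norm_mul, Nat.cast_ofNat, Real.norm_ofNat]
      linarith
    choose C hC0 hC using hterm
    refine ⟨(∑ j, C j) * A, fun x hx => ?_⟩
    have hpos := hγ.pos x hx
    rw [hzp, pow_one, norm_iteratedFDeriv_one]
    have h1 : fderiv ℝ (gradSq r) x = ∑ j, fderiv ℝ (fun x => ‖dr r j x‖ ^ 2) x :=
      fderiv_fun_sum fun j _ =>
        (((contDiff_dr hr.smooth j).norm_sq ℝ).differentiable (by simp)).differentiableAt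
    have h2 : ‖fderiv ℝ (gradSq r) x‖ ≤ (∑ j, C j) * grad r x := by
      rw [h1, Finset.sum_mul]
      exact (norm_sum_le _ _).trans (Finset.sum_le_sum fun j _ => hC j x (subset_closure hx))
    have h3 : 0 ≤ ∑ j, C j := Finset.sum_nonneg fun j _ => hC0 j
    calc γ x * ‖fderiv ℝ (gradSq r) x‖ ≤ γ x * ((∑ j, C j) * (A * γ x)) := by
          gcongr
          exact h2.trans (by gcongr; exact hA x hx)
      _ = _ := by ring
  -- From second order on, boundedness of the derivatives of |∂r|² is enough: two of the factors γ
  -- provide γ², and the remaining γ^a is bounded.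
  | a + 2 =>
    obtain ⟨C, hC⟩ := hr.isCompact_closure.exists_bound_of_continuousOn
      ((contDiff_gradSq hr.smooth).continuous_iteratedFDeriv (m := a + 2)
        ENat.LEInfty.out).continuousOn
    refine ⟨G ^ a * max C 0, fun x hx => ?_⟩
    have hpos := hγ.pos x hx
    rw [hzp, pow_add, mul_right_comm]
    gcongr
    · exact hG x hx
    · exact (hC x (subset_closure hx)).trans (le_max_left _ _)

lemma isWeight_one : IsWeight r γ 0 (fun _ => 1) := by
  refine ⟨contDiffOn_const, fun a => ?_⟩
  rcases a with _ | a
  · exact ⟨1, fun x _ => by simp⟩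
  · refine ⟨0, fun x _ => ?_⟩
    rw [iteratedFDeriv_const_of_ne (by simp)]
    simp

end Domain

/-! ### Estimates for `φ_ε` and `P_ε` -/

section Phi

variable {n : ℕ} {r : Cn n → ℝ} {U : Set (Cn n)} {g : Cn n → Matrix (Fin n) (Fin n) ℂ}
  {ρ φ : Cn n → Cn n → ℝ} {γ : Cn n → ℝ} {κ : ℝ}

/-- Taylor's formula of second order. -/
lemma exists_taylor_bound (hr : ContDiff ℝ ∞ r) (R : ℝ) :
    ∃ M : ℝ, 0 ≤ M ∧ ∀ x ∈ Metric.closedBall (0 : Cn n) R, ∀ y ∈ Metric.closedBall (0 : Cn n) R,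
      |r y - r x - fderiv ℝ r x (y - x) - 1 / 2 * fderiv ℝ (fderiv ℝ r) x (y - x) (y - x)| ≤
        M * ‖x - y‖ ^ 3 := by
  have hD1 : ContDiff ℝ ∞ (fderiv ℝ r) := hr.fderiv_right (by simp)
  have hD2 : ContDiff ℝ ∞ (fderiv ℝ (fderiv ℝ r)) := hD1.fderiv_right (by simp)
  obtain ⟨M, hM0, hM⟩ := exists_lipschitz_bound hD2 (isCompact_closedBall (0 : Cn n) R)
    (convex_closedBall _ _)
  refine ⟨M, hM0, fun x hx y hy => ?_⟩
  set v := y - x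
  set T := fderiv ℝ (fderiv ℝ r) x
  have hv : ‖x - y‖ = ‖v‖ := norm_sub_rev _ _
  have hmem : ∀ t ∈ Set.Icc (0 : ℝ) 1, x + t • v ∈ Metric.closedBall (0 : Cn n) R := fun t ht =>
    (convex_closedBall (0 : Cn n) R).add_smul_sub_mem hx hy ht
  have h1 : ∀ t ∈ Set.Icc (0 : ℝ) 1,
      ‖fderiv ℝ r (x + t • v) - fderiv ℝ r x - T (t • v)‖ ≤ M * ‖v‖ ^ 2 := by
    intro t ht
    have hs : segment ℝ x (x + t • v) ⊆ Metric.closedBall (0 : Cn n) R :=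
      (convex_closedBall _ _).segment_subset hx (hmem t ht)
    have h := (convex_segment x (x + t • v)).norm_image_sub_le_of_norm_fderiv_le' (𝕜 := ℝ)
      (f := fderiv ℝ r) (C := M * ‖v‖) (φ := T)
      (fun w _ => (hD1.differentiable (by simp)).differentiableAt) ?_
      (left_mem_segment ℝ _ _) (right_mem_segment ℝ _ _)
    · rw [add_sub_cancel_left] at h
      refine h.trans ?_
      rw [norm_smul, Real.norm_of_nonneg ht.1]
      have : t * ‖v‖ ≤ ‖v‖ := mul_le_of_le_one_left (norm_nonneg _) ht.2
      calc M * ‖v‖ * (t * ‖v‖) ≤ M * ‖v‖ * ‖v‖ := by gcongr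
        _ = _ := by ring
    · intro w hw
      refine (hM w (hs hw) x hx).trans ?_
      gcongr
      obtain ⟨a, b, ha, hb, hab, rfl⟩ := hw
      have : a • x + b • (x + t • v) - x = (b * t) • v := by
        have : a = 1 - b := by linarith
        rw [this]
        module
      rw [this, norm_smul, Real.norm_of_nonneg (mul_nonneg hb ht.1)]
      refine mul_le_of_le_one_left (norm_nonneg _) (mul_le_one₀ (by linarith) ht.1 ht.2)
  have hline : ∀ t : ℝ, HasDerivAt (fun t : ℝ => x + t • v) v t := fun t => by
    simpa using ((hasDerivAt_id t).smul_const v).const_add x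
  -- On the segment, subtracting the second order Taylor polynomial leaves a function of t whose
  -- derivative is O(|v|³). One application of the mean value inequality then suffices.
  have hder : ∀ t : ℝ, HasDerivAt (fun t : ℝ => r (x + t • v) - t * fderiv ℝ r x v -
      t ^ 2 * (1 / 2 * T v v)) (fderiv ℝ r (x + t • v) v - fderiv ℝ r x v - t * T v v) t := by
    intro t
    have ha : HasDerivAt (fun t : ℝ => r (x + t • v)) (fderiv ℝ r (x + t • v) v) t :=
      HasFDerivAt.comp_hasDerivAt (l := r) t
        (hr.differentiable (by simp)).differentiableAt.hasFDerivAt (hline t)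
    have hb := (hasDerivAt_id t).mul_const (fderiv ℝ r x v)
    have hc := (hasDerivAt_pow 2 t).mul_const (1 / 2 * T v v)
    refine ((ha.sub hb).sub hc).congr_deriv ?_
    simp
    ring
  have h2 := (convex_Icc (0 : ℝ) 1).norm_image_sub_le_of_norm_hasDerivWithin_le
    (C := M * ‖v‖ ^ 3) (fun t _ => (hder t).hasDerivWithinAt) ?_
    (Set.left_mem_Icc.2 zero_le_one) (Set.right_mem_Icc.2 zero_le_one)
  · rw [hv]
    have e : x + (1 : ℝ) • v = y := by simp [v]
    simp only [e, zero_smul, add_zero, Real.norm_eq_abs] at h2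
    norm_num at h2
    refine le_trans (le_of_eq ?_) h2
    congr 1
    ring
  · intro t ht
    have e : fderiv ℝ r (x + t • v) v - fderiv ℝ r x v - t * T v v =
        (fderiv ℝ r (x + t • v) - fderiv ℝ r x - T (t • v)) v := by
      simp
    rw [e]
    refine (ContinuousLinearMap.le_opNorm _ _).trans ?_
    calc _ ≤ (M * ‖v‖ ^ 2) * ‖v‖ := by gcongr; exact h1 t ht
      _ = _ := by ring

/-- Up to the Levi form, 2 Re F is minus the first and second order Taylor terms of r at ζ. Taylor's
formula thus turns it into r(ζ) - r(z) plus the Levi form, up to third order. -/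
lemma two_re_leviPoly (hr : ContDiff ℝ ∞ r) (ζ z : Cn n) :
    2 * (leviPoly r ζ z).re = -fderiv ℝ r ζ (z - ζ) -
      1 / 2 * fderiv ℝ (fderiv ℝ r) ζ (z - ζ) (z - ζ) + quadForm (leviMatrix r ζ) (z - ζ) := by
  rw [fderiv_eq_re_sum hr, fderiv_fderiv_eq hr, quadForm]
  have h1 : ∑ j, dr r j ζ * (ζ j - z j) = -∑ j, dr r j ζ * (z - ζ) j := by
    rw [← Finset.sum_neg_distrib]
    exact Finset.sum_congr rfl fun j _ => by simp only [PiLp.sub_apply]; ring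
  have h2 : ∑ j, ∑ k, dd k (dr r j) ζ * (ζ j - z j) * (ζ k - z k) =
      ∑ j, ∑ k, dd k (dr r j) ζ * (z - ζ) j * (z - ζ) k := by
    refine Finset.sum_congr rfl fun j _ => Finset.sum_congr rfl fun k _ => ?_
    simp only [PiLp.sub_apply]
    ring
  rw [leviPoly, h1, h2]
  have h3 : ∀ w : ℂ, (1 / 2 * w).re = 1 / 2 * w.re := fun w => by simp
  rw [Complex.sub_re, Complex.neg_re, h3]
  ring

/-- The basic lower bound for the Levi polynomial. -/
lemma IsHenkinLeiterer.exists_leviPoly_lower (hr : IsHenkinLeiterer r U) (R : ℝ) :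
    ∃ m > 0, ∃ d₀ > 0, ∃ c > 0, ∀ ζ ∈ closure (dom r) ∩ Metric.closedBall (0 : Cn n) R, -m ≤ r ζ →
      ∀ z ∈ Metric.closedBall (0 : Cn n) R, ‖ζ - z‖ ≤ d₀ →
        r ζ - r z + c * ‖ζ - z‖ ^ 2 ≤ 2 * (leviPoly r ζ z).re := by
  obtain ⟨m, hm, hcol⟩ := hr.exists_collar
  obtain ⟨M, hM0, hM⟩ := exists_taylor_bound hr.smooth R
  have hcomp : IsCompact (closure (dom r) ∩ {x | -m ≤ r x}) :=
    hr.isCompact_closure.inter_right (isClosed_le continuous_const hr.smooth.continuous)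
  obtain ⟨c, hc, hlow⟩ := exists_quadForm_lower (M := leviMatrix r) hcomp
    (fun j k => (contDiff_leviMatrix hr.smooth j k).continuous.continuousOn)
    (fun x hx => hr.strictlyPsh x (hcol x hx.1 hx.2))
  -- Within this radius half of the Levi form absorbs the cubic Taylor remainder; the other half
  -- gives the constant c/2.
  refine ⟨m, hm, c / (2 * (M + 1)), by positivity, c / 2, by positivity, ?_⟩
  intro ζ hζ hζm z hz hd
  have h1 := hM ζ hζ.2 z hz
  have h2 := hlow ζ ⟨hζ.1, hζm⟩ (z - ζ)
  have h3 := two_re_leviPoly hr.smooth ζ z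
  rw [norm_sub_rev] at h2
  have h4 : M * ‖ζ - z‖ ^ 3 ≤ c / 2 * ‖ζ - z‖ ^ 2 := by
    have h5 : M * ‖ζ - z‖ ≤ c / 2 := by
      calc M * ‖ζ - z‖ ≤ (M + 1) * (c / (2 * (M + 1))) := by gcongr; linarith
        _ = c / 2 := by field_simp
    calc M * ‖ζ - z‖ ^ 3 = M * ‖ζ - z‖ * ‖ζ - z‖ ^ 2 := by ring
      _ ≤ _ := by gcongr
  have h6 := neg_le_of_abs_le h1
  linarith

/-- The lower bound for `Re φ_ε`. -/
lemma exists_phi_lower (hr : IsHenkinLeiterer r U) (hg : IsLeviMetric r U g)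
    (hρ : IsDistance g ρ) : ∃ κ₀ > 0, ∃ m > 0, ∀ κ ∈ Set.Ioo 0 κ₀, ∀ φ : Cn n → Cn n → ℝ,
      IsPatching ρ κ φ → ∃ c > 0, ∀ ε ∈ Set.Ioo (0 : ℝ) 1, ∀ ζ ∈ closure (domEps r ε),
        ∀ z ∈ closure (domEps r ε), -m ≤ r ζ →
          c * (-(r ζ + ε) + -(r z + ε) + ‖ζ - z‖ ^ 2) ≤ (phi r ρ φ ε ζ z).re := by
  obtain ⟨R, hR⟩ := hr.exists_ball
  obtain ⟨m, hm, d₀, hd₀, c, hc, hlow⟩ := hr.exists_leviPoly_lower R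
  obtain ⟨c', hc', hlow'⟩ := hρ.exists_lower hg.smooth hg.posDef R
  obtain ⟨B, hB⟩ := hr.isCompact_closure.exists_bound_of_continuousOn
    hr.smooth.continuous.continuousOn
  -- This bound on κ forces |ζ - z| ≤ d₀ wherever the patching function is nonzero, so the estimate
  -- of the Levi polynomial applies there.
  refine ⟨c' * d₀ ^ 2, by positivity, m, hm, fun κ hκ φ hφ => ?_⟩
  have hκ0 := hκ.1
  set L := 2 * max B 0 + (2 * |R| + 1) ^ 2
  have hL : 0 < L := by positivity
  -- The first two constants come from Re(F - r_ε(ζ)) ≥ ½(-r_ε(ζ) - r_ε(z)) + (c/2)|ζ - z|². The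
  -- third makes c₁Q at most κ/2, which ρ² exceeds where the patching function is not 1; L bounds Q
  -- on the whole domain.
  refine ⟨min (min (1 / 2) (c / 2)) (κ / 2 / L), by positivity, ?_⟩
  intro ε hε ζ hζ z hz hζm
  have hsub := closure_domEps_subset_dom hr.smooth.continuous hε.1
  have hζd := subset_closure (hsub hζ)
  have hzd := subset_closure (hsub hz)
  have hζR := hR hζd
  have hzR := hR hzd
  have h1 : r ζ + ε ≤ 0 := closure_domEps_subset hr.smooth.continuous ε hζ
  have h2 : r z + ε ≤ 0 := closure_domEps_subset hr.smooth.continuous ε hz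
  set Q := -(r ζ + ε) + -(r z + ε) + ‖ζ - z‖ ^ 2
  have hQ0 : 0 ≤ Q := by have := sq_nonneg ‖ζ - z‖; simp only [Q]; linarith
  set c₁ := min (min (1 / 2) (c / 2)) (κ / 2 / L)
  have hQL : Q ≤ L := by
    have e1 := hB ζ hζd
    have e2 := hB z hzd
    rw [Real.norm_eq_abs] at e1 e2
    have e3 := neg_abs_le (r ζ)
    have e4 := neg_abs_le (r z)
    have e5 := le_max_left B 0
    have e6 : ‖ζ - z‖ ≤ 2 * |R| + 1 := by
      have hx' : ‖ζ‖ ≤ R := by simpa using hζR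
      have hy' : ‖z‖ ≤ R := by simpa using hzR
      have := norm_sub_le ζ z
      have := le_abs_self R
      linarith
    have e7 : ‖ζ - z‖ ^ 2 ≤ (2 * |R| + 1) ^ 2 := by gcongr
    have := hε.1
    simp only [Q, L]
    linarith
  have hphi : (phi r ρ φ ε ζ z).re =
      φ ζ z * ((leviPoly r ζ z).re - (r ζ + ε)) + (1 - φ ζ z) * ρ ζ z ^ 2 := by
    have h3 : ∀ (t : ℝ) (w : ℂ), ((t : ℂ) * w).re = t * w.re := fun t w => Complex.re_ofReal_mul t w
    rw [phi, Complex.add_re, h3, Complex.sub_re, Complex.ofReal_re, ← Complex.ofReal_one,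
      ← Complex.ofReal_sub, h3, Complex.ofReal_re]
  have hr1 := hφ.range ζ z
  have hA : φ ζ z * (c₁ * Q) ≤ φ ζ z * ((leviPoly r ζ z).re - (r ζ + ε)) := by
    by_cases hz0 : φ ζ z = 0
    · simp [hz0]
    refine mul_le_mul_of_nonneg_left ?_ hr1.1
    have hlt : ρ ζ z ^ 2 < 3 / 4 * κ := by
      by_contra hcon
      exact hz0 (hφ.eq_zero ζ z (not_lt.1 hcon))
    have hd : ‖ζ - z‖ ≤ d₀ := by
      have e1 := hlow' ζ hζR z hzR
      have e2 : c' * ‖ζ - z‖ ^ 2 ≤ c' * d₀ ^ 2 := by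
        have := hκ.2
        linarith
      have e3 := le_of_mul_le_mul_left e2 hc'
      exact (sq_le_sq₀ (norm_nonneg _) hd₀.le).1 e3
    have e1 := hlow ζ ⟨hζd, hζR⟩ hζm z hzR hd
    have e2 : c₁ ≤ 1 / 2 := (min_le_left _ _).trans (min_le_left _ _)
    have e3 : c₁ ≤ c / 2 := (min_le_left _ _).trans (min_le_right _ _)
    have e4 : c₁ * (-(r ζ + ε) + -(r z + ε)) ≤ 1 / 2 * (-(r ζ + ε) + -(r z + ε)) := by
      gcongr
      linarith
    have e5 : c₁ * ‖ζ - z‖ ^ 2 ≤ c / 2 * ‖ζ - z‖ ^ 2 := by gcongr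
    have e6 : c₁ * Q = c₁ * (-(r ζ + ε) + -(r z + ε)) + c₁ * ‖ζ - z‖ ^ 2 := by
      simp only [Q]; ring
    linarith
  have hB' : (1 - φ ζ z) * (c₁ * Q) ≤ (1 - φ ζ z) * ρ ζ z ^ 2 := by
    by_cases hz1 : φ ζ z = 1
    · simp [hz1]
    refine mul_le_mul_of_nonneg_left ?_ (by linarith [hr1.2])
    have hlt : κ / 2 < ρ ζ z ^ 2 := by
      by_contra hcon
      exact hz1 (hφ.eq_one ζ z (not_lt.1 hcon))
    calc c₁ * Q ≤ κ / 2 / L * L := by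
          gcongr
          exact min_le_right _ _
      _ = κ / 2 := by field_simp
      _ ≤ _ := hlt.le
  rw [hphi]
  linarith

/-! ### The derivative of `φ_ε` -/

lemma contDiff_leviPoly (hr : ContDiff ℝ ∞ r) : ContDiff ℝ ∞ (onProd (leviPoly r)) := by
  have hw : ∀ j : Fin n, ContDiff ℝ ∞ fun p : Cn n × Cn n => p.1 j - p.2 j := fun j => by fun_prop
  refine (ContDiff.sum fun j _ => ?_).sub (contDiff_const.mul
    (ContDiff.sum fun j _ => ContDiff.sum fun k _ => ?_))
  · exact ((contDiff_dr hr j).comp contDiff_fst).mul (hw j)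
  · exact (((contDiff_dd_dr hr j k).comp contDiff_fst).mul (hw j)).mul (hw k)

/-- On the diagonal the factors ζ_j - z_j vanish. Only the linear part of F contributes, and its
coefficients are the first derivatives of r. -/
lemma exists_fderiv_leviPoly_diag (hr : ContDiff ℝ ∞ r) :
    ∃ C : ℝ, 0 ≤ C ∧ ∀ x, ‖fderiv ℝ (onProd (leviPoly r)) (x, x)‖ ≤ C * grad r x := by
  have hw : ∀ j : Fin n, ContDiff ℝ ∞ fun p : Cn n × Cn n => p.1 j - p.2 j := fun j => by fun_prop
  set L : Fin n → (Cn n × Cn n →L[ℝ] ℂ) := fun j => fderiv ℝ (fun p : Cn n × Cn n => p.1 j - p.2 j) 0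
  have hL : ∀ j (p : Cn n × Cn n), HasFDerivAt (fun p : Cn n × Cn n => p.1 j - p.2 j) (L j) p := by
    intro j p
    set T : Cn n × Cn n →L[ℝ] ℂ := ((PiLp.proj (𝕜 := ℝ) 2 (fun _ : Fin n => ℂ) j).comp
      (ContinuousLinearMap.fst ℝ (Cn n) (Cn n))) -
      ((PiLp.proj (𝕜 := ℝ) 2 (fun _ : Fin n => ℂ) j).comp
      (ContinuousLinearMap.snd ℝ (Cn n) (Cn n)))
    have hT : (fun p : Cn n × Cn n => p.1 j - p.2 j) = T := rfl
    simp only [L, hT, ContinuousLinearMap.fderiv]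
    exact T.hasFDerivAt
  have hlin : ∀ j x, HasFDerivAt (fun p : Cn n × Cn n => dr r j p.1 * (p.1 j - p.2 j))
      (dr r j x • L j) (x, x) := fun j x =>
    ((((contDiff_dr hr j).comp contDiff_fst).differentiable (by simp)).differentiableAt.hasFDerivAt.mul
      (hL j (x, x))).congr_fderiv (ContinuousLinearMap.ext fun v => by simp)
  have hquad : ∀ j k x, HasFDerivAt (fun p : Cn n × Cn n =>
      dd k (dr r j) p.1 * (p.1 j - p.2 j) * (p.1 k - p.2 k)) 0 (x, x) := fun j k x =>
    (((((contDiff_dd_dr hr j k).comp contDiff_fst).differentiable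
      (by simp)).differentiableAt.hasFDerivAt.mul (hL j (x, x))).mul (hL k (x, x))).congr_fderiv
      (ContinuousLinearMap.ext fun v => by simp)
  refine ⟨∑ j, ‖L j‖, by positivity, fun x => ?_⟩
  have h : HasFDerivAt (onProd (leviPoly r)) (∑ j, dr r j x • L j - (1 / 2 : ℂ) •
      ∑ j : Fin n, ∑ k : Fin n, (0 : Cn n × Cn n →L[ℝ] ℂ)) (x, x) :=
    (HasFDerivAt.fun_sum fun j _ => hlin j x).sub
      ((HasFDerivAt.fun_sum fun j _ => HasFDerivAt.fun_sum fun k _ => hquad j k x).const_mul _)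
  rw [h.fderiv]
  simp only [Finset.sum_const_zero, smul_zero, sub_zero]
  rw [Finset.sum_mul]
  refine (norm_sum_le _ _).trans (Finset.sum_le_sum fun j _ => ?_)
  rw [norm_smul, mul_comm]
  gcongr
  exact norm_dr_le_grad j x

lemma IsPatching.eventually_eq_one (hφ : IsPatching ρ κ φ) (hρ : IsDistance g ρ) (hκ : 0 < κ)
    (x : Cn n) : ∀ᶠ p in 𝓝 (x, x), onProd φ p = 1 := by
  have h : ∀ᶠ p in 𝓝 (x, x), rhoSq ρ p < κ / 2 :=
    hρ.contDiff_rhoSq.continuous.continuousAt.eventually_lt continuousAt_const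
      (by rw [hρ.rhoSq_self]; linarith)
  exact h.mono fun p hp => hφ.eq_one _ _ (le_of_lt hp)

lemma contDiff_phi (hr : ContDiff ℝ ∞ r) (hρ : IsDistance g ρ) (hφ : IsPatching ρ κ φ) (ε : ℝ) :
    ContDiff ℝ ∞ (onProd (phi r ρ φ ε)) := by
  have h1 : ContDiff ℝ ∞ fun p : Cn n × Cn n => (φ p.1 p.2 : ℂ) :=
    Complex.ofRealCLM.contDiff.comp hφ.smooth
  have h2 : ContDiff ℝ ∞ fun p : Cn n × Cn n => ((r p.1 + ε : ℝ) : ℂ) :=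
    Complex.ofRealCLM.contDiff.comp ((hr.comp contDiff_fst).add contDiff_const)
  have h3 : ContDiff ℝ ∞ fun p : Cn n × Cn n => ((ρ p.1 p.2 ^ 2 : ℝ) : ℂ) :=
    Complex.ofRealCLM.contDiff.comp hρ.contDiff_rhoSq
  exact (h1.mul ((contDiff_leviPoly hr).sub h2)).add ((contDiff_const.sub h1).mul h3)

/-- Near the diagonal φ_0 = F - r, whose derivative is O(|∂r|) on the diagonal; moving off it costs
O(|ζ - z|). -/
lemma exists_fderiv_phi_le (hr : ContDiff ℝ ∞ r) (hρ : IsDistance g ρ) (hφ : IsPatching ρ κ φ)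
    (hκ : 0 < κ) (R : ℝ) : ∃ C : ℝ, 0 ≤ C ∧ ∀ ε ∈ Set.Ioo (0 : ℝ) 1,
      ∀ ζ ∈ Metric.closedBall (0 : Cn n) R, ∀ z ∈ Metric.closedBall (0 : Cn n) R,
        ‖fderiv ℝ (onProd (phi r ρ φ ε)) (ζ, z)‖ ≤ C * (grad r ζ + ‖ζ - z‖) := by
  obtain ⟨C₁, hC₁, h1⟩ := exists_fderiv_leviPoly_diag hr
  have hc0 := contDiff_phi hr hρ hφ 0
  have hcφ : ContDiff ℝ ∞ fun p : Cn n × Cn n => (φ p.1 p.2 : ℂ) :=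
    Complex.ofRealCLM.contDiff.comp hφ.smooth
  have hdiag : ∀ x, ‖fderiv ℝ (onProd (phi r ρ φ 0)) (x, x)‖ ≤ (C₁ + 2 * n) * grad r x := by
    intro x
    have hev : onProd (phi r ρ φ 0) =ᶠ[𝓝 (x, x)]
        fun p => onProd (leviPoly r) p - ((r p.1 : ℝ) : ℂ) := by
      filter_upwards [hφ.eventually_eq_one hρ hκ x] with p hp
      have hp' : φ p.1 p.2 = 1 := hp
      simp [phi, hp']
    have hd1 : HasFDerivAt (onProd (leviPoly r)) _ (x, x) :=
      ((contDiff_leviPoly hr).differentiable (by simp)).differentiableAt.hasFDerivAt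
    have hd2 : HasFDerivAt (fun p : Cn n × Cn n => r p.1) ((fderiv ℝ r x).comp
        (ContinuousLinearMap.fst ℝ (Cn n) (Cn n))) (x, x) :=
      HasFDerivAt.comp (g := r) (f := Prod.fst) (x, x)
        (hr.differentiable (by simp)).differentiableAt.hasFDerivAt hasFDerivAt_fst
    have hd3 : HasFDerivAt (fun p : Cn n × Cn n => ((r p.1 : ℝ) : ℂ)) _ (x, x) :=
      Complex.ofRealCLM.hasFDerivAt.comp (x, x) hd2
    rw [hev.fderiv_eq, (hd1.fun_sub hd3).fderiv]
    refine (norm_sub_le _ _).trans ?_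
    rw [add_mul]
    refine add_le_add (h1 x) ?_
    refine (ContinuousLinearMap.opNorm_comp_le _ _).trans ?_
    rw [Complex.ofRealCLM_norm, one_mul]
    refine (ContinuousLinearMap.opNorm_comp_le _ _).trans ?_
    refine (mul_le_of_le_one_right (norm_nonneg _) (ContinuousLinearMap.norm_fst_le ℝ _ _)).trans ?_
    exact norm_fderiv_le_grad hr x
  obtain ⟨C₂, hC₂, h2⟩ := exists_near_diagonal_bound (hc0.fderiv_right (m := ∞) (by simp)) R
    (a := grad r) (fun x _ => hdiag x)
  obtain ⟨C₃, hC₃, h3⟩ := exists_vanishing_bound (hcφ.fderiv_right (m := ∞) (by simp)) R fun x => by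
    have hev : (fun p : Cn n × Cn n => (φ p.1 p.2 : ℂ)) =ᶠ[𝓝 (x, x)] fun _ => 1 := by
      filter_upwards [hφ.eventually_eq_one hρ hκ x] with p hp
      have hp' : φ p.1 p.2 = 1 := hp
      simp [hp']
    rw [hev.fderiv_eq]
    simp
  refine ⟨C₁ + 2 * n + C₂ + C₃, by positivity, fun ε hε ζ hζ z hz => ?_⟩
  have hga := grad_nonneg (r := r) ζ
  -- The parameter enters only through ε times the patching function, whose derivative vanishes on
  -- the diagonal. This gives uniformity in ε.
  have e : onProd (phi r ρ φ ε) = fun p => onProd (phi r ρ φ 0) p - (ε : ℂ) * (φ p.1 p.2 : ℂ) := by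
    funext p
    simp only [phi]
    push_cast
    ring
  have hd1 : HasFDerivAt (onProd (phi r ρ φ 0)) _ (ζ, z) :=
    (hc0.differentiable (by simp)).differentiableAt.hasFDerivAt
  have hd2 : HasFDerivAt (fun p : Cn n × Cn n => (φ p.1 p.2 : ℂ)) _ (ζ, z) :=
    (hcφ.differentiable (by simp)).differentiableAt.hasFDerivAt
  rw [e, (hd1.fun_sub (hd2.const_mul (ε : ℂ))).fderiv]
  refine (norm_sub_le _ _).trans ?_
  rw [norm_smul]
  have h4 : ‖(ε : ℂ)‖ ≤ 1 := by
    rw [Complex.norm_real, Real.norm_of_nonneg hε.1.le]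
    exact hε.2.le
  have h5 := h2 ζ hζ z hz
  have h6 := h3 ζ hζ z hz
  have h7 : ‖(ε : ℂ)‖ * ‖fderiv ℝ (fun p : Cn n × Cn n => (φ p.1 p.2 : ℂ)) (ζ, z)‖ ≤
      C₃ * ‖ζ - z‖ := (mul_le_of_le_one_left (norm_nonneg _) h4).trans h6
  have h8 : 0 ≤ (C₁ + 2 * n) * ‖ζ - z‖ + (C₂ + C₃) * grad r ζ := by positivity
  linarith

/-! ### Estimates for `P_ε` -/

/-- `r_ε / γ`. -/
def sEps (r γ : Cn n → ℝ) (ε : ℝ) (x : Cn n) : ℝ := (r x + ε) / γ x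

lemma PP_eq (ε : ℝ) (ζ z : Cn n) :
    PP r γ ρ ε ζ z = ρ ζ z ^ 2 + 2 * sEps r γ ε ζ * sEps r γ ε z := rfl

lemma contDiffAt_sEps (hr : ContDiff ℝ ∞ r) (hγ : IsGamma r U g γ) (ε : ℝ) {x : Cn n}
    (hx : x ∈ dom r) : ContDiffAt ℝ ∞ (sEps r γ ε) x :=
  (hr.contDiffAt.add contDiffAt_const).div (hγ.contDiffAt hr.continuous hx) (hγ.pos x hx).ne'

lemma contDiffAt_PP (hr : ContDiff ℝ ∞ r) (hγ : IsGamma r U g γ) (hρ : IsDistance g ρ) (ε : ℝ)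
    {p : Cn n × Cn n} (h1 : p.1 ∈ dom r) (h2 : p.2 ∈ dom r) :
    ContDiffAt ℝ ∞ (onProd (PP r γ ρ ε)) p :=
  hρ.contDiff_rhoSq.contDiffAt.add ((contDiffAt_const.mul
    ((contDiffAt_sEps hr hγ ε h1).comp p contDiffAt_fst)).mul
    ((contDiffAt_sEps hr hγ ε h2).comp p contDiffAt_snd))

/-- The bounds for `r_ε / γ` and its derivative. -/
lemma exists_sEps_bound (hr : IsHenkinLeiterer r U) (hg : IsLeviMetric r U g)
    (hγ : IsGamma r U g γ) : ∃ C : ℝ, 0 ≤ C ∧ ∀ ε > 0, ∀ x ∈ closure (domEps r ε),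
      sEps r γ ε x ^ 2 ≤ C * -(r x + ε) ∧ ‖fderiv ℝ (sEps r γ ε) x‖ ≤ C := by
  obtain ⟨A, hA0, hA⟩ := hγ.exists_grad_le hr hg
  obtain ⟨B, hB0, hB⟩ := hγ.exists_abs_le hr hg
  obtain ⟨C, hC0, hC⟩ := hγ.exists_fderiv_le hr hg
  refine ⟨2 * n * A + B * C + B, by positivity, fun ε hε x hx => ?_⟩
  have hxd := closure_domEps_subset_dom hr.smooth.continuous hε hx
  have hre : r x + ε ≤ 0 := closure_domEps_subset hr.smooth.continuous ε hx
  have hpos := hγ.pos x hxd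
  -- Passing from r to r_ε only decreases the absolute value on D̄_ε, so the bound by γ² is uniform
  -- in ε.
  have habs : -(r x + ε) ≤ B * γ x ^ 2 := by
    have h1 := hB x hxd
    have h2 := neg_abs_le (r x)
    linarith
  constructor
  · rw [sEps, div_pow, div_le_iff₀ (by positivity)]
    have h1 : (r x + ε) ^ 2 = -(r x + ε) * -(r x + ε) := by ring
    rw [h1]
    have h2 : -(r x + ε) * -(r x + ε) ≤ -(r x + ε) * (B * γ x ^ 2) := by
      gcongr
      linarith
    have h3 : 0 ≤ (2 * n * A + B * C) * (-(r x + ε)) * γ x ^ 2 := by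
      have : 0 ≤ -(r x + ε) := by linarith
      positivity
    linarith
  · have hd1 : HasFDerivAt (fun x => r x + ε) (fderiv ℝ r x) x :=
      ((hr.smooth.differentiable (by simp)).differentiableAt.hasFDerivAt).add_const ε
    have hd2 : HasFDerivAt γ (fderiv ℝ γ x) x :=
      ((hγ.contDiffAt hr.smooth.continuous hxd).differentiableAt (by simp)).hasFDerivAt
    have hd : HasFDerivAt (sEps r γ ε) ((r x + ε) • (-(γ x ^ 2)⁻¹ • fderiv ℝ γ x) +
        (γ x)⁻¹ • fderiv ℝ r x) x := by
      have h := hd1.mul ((hasDerivAt_inv hpos.ne').comp_hasFDerivAt x hd2)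
      refine h.congr_of_eventuallyEq (Filter.Eventually.of_forall fun y => ?_)
      simp [sEps, div_eq_mul_inv]
    rw [hd.fderiv]
    refine (norm_add_le _ _).trans ?_
    rw [norm_smul, norm_smul, norm_smul, norm_neg, norm_inv, norm_inv, Real.norm_of_nonneg hpos.le,
      Real.norm_of_nonneg (by positivity : 0 ≤ γ x ^ 2), Real.norm_of_nonpos hre]
    have h1 : -(r x + ε) * ((γ x ^ 2)⁻¹ * ‖fderiv ℝ γ x‖) ≤ B * C := by
      have h2 : -(r x + ε) * (γ x ^ 2)⁻¹ ≤ B := by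
        rw [← div_eq_mul_inv, div_le_iff₀ (by positivity)]
        exact habs
      rw [← mul_assoc]
      exact mul_le_mul h2 (hC x hxd) (norm_nonneg _) hB0
    have h3 : (γ x)⁻¹ * ‖fderiv ℝ r x‖ ≤ 2 * n * A := by
      rw [inv_mul_le_iff₀ hpos]
      calc _ ≤ 2 * n * grad r x := norm_fderiv_le_grad hr.smooth x
        _ ≤ 2 * n * (A * γ x) := by gcongr; exact hA x hxd
        _ = _ := by ring
    linarith

/-- The bound for the derivative of `P_ε`. -/
lemma exists_fderiv_PP_le (hr : IsHenkinLeiterer r U) (hg : IsLeviMetric r U g)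
    (hγ : IsGamma r U g γ) (hρ : IsDistance g ρ) : ∃ C : ℝ, 0 ≤ C ∧ ∀ ε > 0,
      ∀ ζ ∈ closure (domEps r ε), ∀ z ∈ closure (domEps r ε),
        ‖fderiv ℝ (onProd (PP r γ ρ ε)) (ζ, z)‖ ≤
          C * (‖ζ - z‖ + |sEps r γ ε ζ| + |sEps r γ ε z|) := by
  obtain ⟨R, hR⟩ := hr.exists_ball
  -- The derivative of ρ² vanishes on the diagonal; in the derivative of 2 s(ζ) s(z) one factor s
  -- survives and the other has bounded derivative.
  obtain ⟨A, hA0, hA⟩ := exists_vanishing_bound (hρ.contDiff_rhoSq.fderiv_right (m := ∞) (by simp)) R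
    hρ.fderiv_rhoSq_self
  obtain ⟨C, hC0, hC⟩ := exists_sEps_bound hr hg hγ
  refine ⟨A + 2 * C, by positivity, fun ε hε ζ hζ z hz => ?_⟩
  have hsub := closure_domEps_subset_dom hr.smooth.continuous hε
  have hd0 : HasFDerivAt (rhoSq ρ) _ (ζ, z) :=
    (hρ.contDiff_rhoSq.differentiable (by simp)).differentiableAt.hasFDerivAt
  have hd1 : HasFDerivAt (fun p : Cn n × Cn n => sEps r γ ε p.1) ((fderiv ℝ (sEps r γ ε) ζ).comp
      (ContinuousLinearMap.fst ℝ (Cn n) (Cn n))) (ζ, z) :=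
    HasFDerivAt.comp (g := sEps r γ ε) (f := Prod.fst) (ζ, z)
      ((contDiffAt_sEps hr.smooth hγ ε (hsub hζ)).differentiableAt (by simp)).hasFDerivAt
      hasFDerivAt_fst
  have hd2 : HasFDerivAt (fun p : Cn n × Cn n => sEps r γ ε p.2) ((fderiv ℝ (sEps r γ ε) z).comp
      (ContinuousLinearMap.snd ℝ (Cn n) (Cn n))) (ζ, z) :=
    HasFDerivAt.comp (g := sEps r γ ε) (f := Prod.snd) (ζ, z)
      ((contDiffAt_sEps hr.smooth hγ ε (hsub hz)).differentiableAt (by simp)).hasFDerivAt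
      hasFDerivAt_snd
  have hd : HasFDerivAt (onProd (PP r γ ρ ε)) _ (ζ, z) := hd0.add ((hd1.const_mul 2).mul hd2)
  rw [hd.fderiv]
  refine (norm_add_le _ _).trans ?_
  have h1 : ‖(fderiv ℝ (sEps r γ ε) ζ).comp (ContinuousLinearMap.fst ℝ (Cn n) (Cn n))‖ ≤ C :=
    (ContinuousLinearMap.opNorm_comp_le _ _).trans ((mul_le_of_le_one_right (norm_nonneg _)
      (ContinuousLinearMap.norm_fst_le ℝ _ _)).trans (hC ε hε ζ hζ).2)
  have h2 : ‖(fderiv ℝ (sEps r γ ε) z).comp (ContinuousLinearMap.snd ℝ (Cn n) (Cn n))‖ ≤ C :=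
    (ContinuousLinearMap.opNorm_comp_le _ _).trans ((mul_le_of_le_one_right (norm_nonneg _)
      (ContinuousLinearMap.norm_snd_le ℝ _ _)).trans (hC ε hε z hz).2)
  have h3 := hA ζ (hR (subset_closure (hsub hζ))) z (hR (subset_closure (hsub hz)))
  have h4 : ‖(2 * sEps r γ ε ζ) • (fderiv ℝ (sEps r γ ε) z).comp
      (ContinuousLinearMap.snd ℝ (Cn n) (Cn n)) + sEps r γ ε z • (2 : ℝ) •
      (fderiv ℝ (sEps r γ ε) ζ).comp (ContinuousLinearMap.fst ℝ (Cn n) (Cn n))‖ ≤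
      2 * C * (|sEps r γ ε ζ| + |sEps r γ ε z|) := by
    refine (norm_add_le _ _).trans ?_
    rw [norm_smul, norm_smul, norm_smul, norm_mul, Real.norm_ofNat, Real.norm_eq_abs,
      Real.norm_eq_abs]
    have e1 := mul_le_mul_of_nonneg_left h2 (abs_nonneg (sEps r γ ε ζ))
    have e2 := mul_le_mul_of_nonneg_left h1 (abs_nonneg (sEps r γ ε z))
    linarith
  have h5 : 0 ≤ 2 * C * ‖ζ - z‖ + A * (|sEps r γ ε ζ| + |sEps r γ ε z|) := by positivity
  refine (add_le_add h3 h4).trans ?_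
  linarith

/-- Upper bound for `P_ε`. -/
lemma exists_PP_le (hr : IsHenkinLeiterer r U) (hg : IsLeviMetric r U g)
    (hγ : IsGamma r U g γ) (hρ : IsDistance g ρ) : ∃ C : ℝ, 0 ≤ C ∧ ∀ ε > 0,
      ∀ ζ ∈ closure (domEps r ε), ∀ z ∈ closure (domEps r ε),
        PP r γ ρ ε ζ z ≤ C * (-(r ζ + ε) + -(r z + ε) + ‖ζ - z‖ ^ 2) := by
  obtain ⟨R, hR⟩ := hr.exists_ball
  obtain ⟨A, hA0, hA⟩ := exists_second_order_bound hρ.contDiff_rhoSq R hρ.rhoSq_self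
    hρ.fderiv_rhoSq_self
  obtain ⟨C, hC0, hC⟩ := exists_sEps_bound hr hg hγ
  refine ⟨A + C, by positivity, fun ε hε ζ hζ z hz => ?_⟩
  have hsub := closure_domEps_subset_dom hr.smooth.continuous hε
  have h3 := (le_abs_self _).trans
    (hA ζ (hR (subset_closure (hsub hζ))) z (hR (subset_closure (hsub hz))))
  have h1 : r ζ + ε ≤ 0 := closure_domEps_subset hr.smooth.continuous ε hζ
  have h2 : r z + ε ≤ 0 := closure_domEps_subset hr.smooth.continuous ε hz
  have h4 := (hC ε hε ζ hζ).1
  have h5 := (hC ε hε z hz).1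
  have h6 := two_mul_le_add_sq (sEps r γ ε ζ) (sEps r γ ε z)
  have h7 : 0 ≤ A * (-(r ζ + ε) + -(r z + ε)) + C * ‖ζ - z‖ ^ 2 :=
    add_nonneg (mul_nonneg hA0 (by linarith)) (by positivity)
  rw [PP_eq]
  change ρ ζ z ^ 2 ≤ _ at h3
  linarith

lemma sEps_nonpos (hr : Continuous r) (hγ : IsGamma r U g γ) {ε : ℝ} (hε : 0 < ε) {x : Cn n}
    (hx : x ∈ closure (domEps r ε)) : sEps r γ ε x ≤ 0 :=
  div_nonpos_of_nonpos_of_nonneg (closure_domEps_subset hr ε hx)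
    (hγ.pos x (closure_domEps_subset_dom hr hε hx)).le

/-- Lower bound for `P_ε`. -/
lemma rhoSq_le_PP (hr : Continuous r) (hγ : IsGamma r U g γ) {ε : ℝ} (hε : 0 < ε) {ζ z : Cn n}
    (hζ : ζ ∈ closure (domEps r ε)) (hz : z ∈ closure (domEps r ε)) :
    ρ ζ z ^ 2 ≤ PP r γ ρ ε ζ z := by
  have := mul_nonneg_of_nonpos_of_nonpos (sEps_nonpos hr hγ hε hζ) (sEps_nonpos hr hγ hε hz)
  rw [PP_eq]
  linarith

end Phi

/-! ### The size of the kernel `ϑ_ζ L_q - ∂_z L_{q-1}` -/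

/-- The elementary inequality behind the estimate of the kernels: `F` and `Q` stand for `1/|φ_ε|`
and `1/P_ε`, `a` for the length of `∂r`, `d` for the distance. -/
lemma term_bound {n μ : ℕ} (hμ : μ + 2 ≤ n) {K a d F Q s s' U U₁ W W₁ N N₁ : ℝ} (hK : 1 ≤ K)
    (ha : 0 ≤ a) (hd : 0 < d) (hF : 0 ≤ F) (hQ : 0 ≤ Q) (hs : 0 ≤ s) (hs' : 0 ≤ s')
    (hdF : d ^ 2 * F ≤ K) (hdQ : d ^ 2 * Q ≤ K) (hFQ : F ≤ K * Q) (hdK : d ≤ K)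
    (has : a * s * F ≤ K) (has' : a * s' * F ≤ K * (1 + d * s' * F)) (hs'F : s' ^ 2 * F ≤ K)
    (hU0 : 0 ≤ U) (hW0 : 0 ≤ W) (hU₁0 : 0 ≤ U₁) (hW₁0 : 0 ≤ W₁) (hN0 : 0 ≤ N) (hN₁0 : 0 ≤ N₁)
    (hU : U ≤ F) (hU₁ : U₁ ≤ K * (F + (a + d) * F ^ 2)) (hW : W ≤ Q)
    (hW₁ : W₁ ≤ K * (d + s + s') * Q ^ 2) (hN : N ≤ K * (a * d)) (hN₁ : N₁ ≤ K * (a + d)) :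
    U ^ (μ + 1) * W ^ (n - 1 - μ) * (N + N₁) +
      (U ^ μ * U₁ * W ^ (n - 1 - μ) + U ^ (μ + 1) * W ^ (n - 2 - μ) * W₁) * N ≤
      12 * K ^ (n + 5) * ((d⁻¹ + a ^ 2 * d * F ^ 2) * Q ^ (n - 1)) := by
  have hK0 : 0 ≤ K := by linarith
  -- With t = adF this is X = (1 + t²)/d. Every product that arises will be dominated by a power of
  -- K times X, times powers of Q.
  set X := d⁻¹ + a ^ 2 * d * F ^ 2 with hX
  have hi : 0 < d⁻¹ := inv_pos.2 hd
  have hdd : d * d⁻¹ = 1 := mul_inv_cancel₀ hd.ne'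
  have hXi : d⁻¹ ≤ X := by have : 0 ≤ a ^ 2 * d * F ^ 2 := by positivity
                           linarith
  have hX0 : 0 ≤ X := hi.le.trans hXi
  -- In terms of t = adF this is t ≤ 1 + t², by completing the square.
  have f1 : a * F ≤ X := by
    have e : X - a * F = d⁻¹ * ((a * F * d - 1 / 2) ^ 2 + 3 / 4) := by
      rw [hX]; field_simp; ring
    have : 0 ≤ d⁻¹ * ((a * F * d - 1 / 2) ^ 2 + 3 / 4) := by positivity
    linarith
  have f2 : d * F ≤ K * X := by
    have e : d * F = (d ^ 2 * F) * d⁻¹ := by field_simp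
    rw [e]; gcongr
  have f3 : a ^ 2 * d * F ^ 2 ≤ X := by rw [hX]; linarith
  have f4 : s' * F ≤ K * X := by
    have h1 : (s' * d * F) ^ 2 ≤ K ^ 2 := by
      calc (s' * d * F) ^ 2 = (s' ^ 2 * F) * (d ^ 2 * F) := by ring
        _ ≤ K * K := by gcongr
        _ = K ^ 2 := by ring
    have h2 : s' * d * F ≤ K := (sq_le_sq₀ (by positivity) hK0).1 h1
    have e : s' * F = (s' * d * F) * d⁻¹ := by field_simp
    rw [e]; gcongr
  have f5 : d * Q ≤ K * X := by
    have e : d * Q = (d ^ 2 * Q) * d⁻¹ := by field_simp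
    rw [e]; gcongr
  have f6 : a * d * F ≤ K * X := by
    calc a * d * F = d * (a * F) := by ring
      _ ≤ K * X := by gcongr
  have hKX : X ≤ K * X := le_mul_of_one_le_left hX0 hK
  have hKKX : K * X ≤ K ^ 2 * X := by
    have := mul_le_mul_of_nonneg_left hKX hK0
    linarith
  have hK3X : K ^ 2 * X ≤ K ^ 3 * X := by
    have := mul_le_mul_of_nonneg_left hKKX hK0
    linarith
  have g1 : F * (N + N₁) ≤ 3 * K ^ 2 * X := by
    calc F * (N + N₁) ≤ F * (K * (a * d) + K * (a + d)) := by gcongr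
      _ = K * (a * d * F + a * F + d * F) := by ring
      _ ≤ K * (K * X + K * X + K * X) := mul_le_mul_of_nonneg_left (by linarith) hK0
      _ = _ := by ring
  have f7 : (d ^ 2 * F) * (a * F) ≤ K * X := by gcongr
  have g2 : U₁ * N ≤ 3 * K ^ 3 * X := by
    calc U₁ * N ≤ (K * (F + (a + d) * F ^ 2)) * (K * (a * d)) := by gcongr
      _ = K ^ 2 * (a * d * F + a ^ 2 * d * F ^ 2 + (d ^ 2 * F) * (a * F)) := by ring
      _ ≤ K ^ 2 * (K * X + K * X + K * X) :=
        mul_le_mul_of_nonneg_left (by linarith) (by positivity)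
      _ = _ := by ring
  -- This is the term in which P_ε is differentiated. The part with s' pairs ∂r at ζ with r_ε/γ at
  -- z, and the extra d s' F allowed in `has'` is absorbed by f4 together with d²Q ≤ K.
  have g3 : F * W₁ * N ≤ 4 * K ^ 5 * X * Q := by
    have e1 : (d ^ 2 * Q) * (a * F) ≤ K ^ 3 * X := by
      calc (d ^ 2 * Q) * (a * F) ≤ K * X := by gcongr
        _ ≤ _ := by linarith
    have e2 : (a * s * F) * (d * Q) ≤ K ^ 3 * X := by
      calc (a * s * F) * (d * Q) ≤ K * (K * X) := by gcongr
        _ = K ^ 2 * X := by ring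
        _ ≤ _ := hK3X
    have e3 : (a * s' * F) * (d * Q) ≤ 2 * (K ^ 3 * X) := by
      calc (a * s' * F) * (d * Q) ≤ (K * (1 + d * s' * F)) * (d * Q) := by gcongr
        _ = K * (d * Q) + K * ((s' * F) * (d ^ 2 * Q)) := by ring
        _ ≤ K * (K * X) + K * ((K * X) * K) := by gcongr
        _ = K ^ 2 * X + K ^ 3 * X := by ring
        _ ≤ _ := by linarith
    calc F * W₁ * N ≤ F * (K * (d + s + s') * Q ^ 2) * (K * (a * d)) := by gcongr
      _ = K ^ 2 * Q * ((d ^ 2 * Q) * (a * F) + (a * s * F) * (d * Q) + (a * s' * F) * (d * Q)) := by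
          ring
      _ ≤ K ^ 2 * Q * (K ^ 3 * X + K ^ 3 * X + 2 * (K ^ 3 * X)) := by gcongr
      _ = _ := by ring
  -- Since P_ε = O(|φ_ε|), each of the μ surplus factors 1/|φ_ε| may be traded for a factor 1/P_ε.
  have hpow : F ^ μ * Q ^ (n - 1 - μ) ≤ K ^ μ * Q ^ (n - 1) := by
    calc F ^ μ * Q ^ (n - 1 - μ) ≤ (K * Q) ^ μ * Q ^ (n - 1 - μ) := by gcongr
      _ = K ^ μ * Q ^ (μ + (n - 1 - μ)) := by rw [mul_pow, mul_assoc, ← pow_add]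
      _ = _ := by rw [show μ + (n - 1 - μ) = n - 1 by omega]
  have hpow' : F ^ μ * Q ^ (n - 2 - μ) * Q ≤ K ^ μ * Q ^ (n - 1) := by
    rw [mul_assoc, ← pow_succ, show n - 2 - μ + 1 = n - 1 - μ by omega]
    exact hpow
  have hKn : ∀ m : ℕ, m ≤ 5 → K ^ μ * K ^ m ≤ K ^ (n + 5) := fun m hm => by
    rw [← pow_add]
    exact pow_le_pow_right₀ hK (by omega)
  set Z := K ^ (n + 5) * (X * Q ^ (n - 1)) with hZ
  have hXQ : 0 ≤ X * Q ^ (n - 1) := by positivity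
  have t1 : U ^ (μ + 1) * W ^ (n - 1 - μ) * (N + N₁) ≤ 3 * Z := by
    calc U ^ (μ + 1) * W ^ (n - 1 - μ) * (N + N₁)
        ≤ F ^ (μ + 1) * Q ^ (n - 1 - μ) * (N + N₁) := by gcongr
      _ = (F ^ μ * Q ^ (n - 1 - μ)) * (F * (N + N₁)) := by ring
      _ ≤ (K ^ μ * Q ^ (n - 1)) * (3 * K ^ 2 * X) := by gcongr
      _ = 3 * ((K ^ μ * K ^ 2) * (X * Q ^ (n - 1))) := by ring
      _ ≤ 3 * Z := by rw [hZ]; gcongr; exact hKn 2 (by norm_num)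
  have t2 : U ^ μ * U₁ * W ^ (n - 1 - μ) * N ≤ 3 * Z := by
    calc U ^ μ * U₁ * W ^ (n - 1 - μ) * N ≤ F ^ μ * U₁ * Q ^ (n - 1 - μ) * N := by gcongr
      _ = (F ^ μ * Q ^ (n - 1 - μ)) * (U₁ * N) := by ring
      _ ≤ (K ^ μ * Q ^ (n - 1)) * (3 * K ^ 3 * X) := by gcongr
      _ = 3 * ((K ^ μ * K ^ 3) * (X * Q ^ (n - 1))) := by ring
      _ ≤ 3 * Z := by rw [hZ]; gcongr; exact hKn 3 (by norm_num)
  have t3 : U ^ (μ + 1) * W ^ (n - 2 - μ) * W₁ * N ≤ 4 * Z := by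
    calc U ^ (μ + 1) * W ^ (n - 2 - μ) * W₁ * N ≤ F ^ (μ + 1) * Q ^ (n - 2 - μ) * W₁ * N := by gcongr
      _ = (F ^ μ * Q ^ (n - 2 - μ)) * (F * W₁ * N) := by ring
      _ ≤ (F ^ μ * Q ^ (n - 2 - μ)) * (4 * K ^ 5 * X * Q) := by gcongr
      _ = (F ^ μ * Q ^ (n - 2 - μ) * Q) * (4 * K ^ 5 * X) := by ring
      _ ≤ (K ^ μ * Q ^ (n - 1)) * (4 * K ^ 5 * X) := by gcongr
      _ = 4 * ((K ^ μ * K ^ 5) * (X * Q ^ (n - 1))) := by ring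
      _ ≤ 4 * Z := by rw [hZ]; gcongr; exact hKn 5 le_rfl
  have hZ0 : 0 ≤ Z := by positivity
  have : 12 * K ^ (n + 5) * (X * Q ^ (n - 1)) = 12 * Z := by rw [hZ]; ring
  rw [this]
  linarith

/-! ### The forms ∂r and ∂_ζρ² and the numerators built from them -/

section KernelBound

variable {n : ℕ} {r : Cn n → ℝ} {U : Set (Cn n)} {g : Cn n → Matrix (Fin n) (Fin n) ℂ}
  {ρ φ : Cn n → Cn n → ℝ} {γ χ : Cn n → ℝ} {κ δ : ℝ}

/-- `∂r` as a double form. -/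
def drKernel (r : Cn n → ℝ) : Kernel n := fun ζ _ => ∑ j, dr r j ζ • genZeta (gen j false)

lemma isZetaDegree_drKernel (ζ z : Cn n) : IsZetaDegree 1 (drKernel r ζ z) :=
  IsZetaDegree.sum _ _ fun j => isZetaDegree_genZeta (gen j false)

lemma contDiff_drKernel (hr : ContDiff ℝ ∞ r) : ContDiff ℝ ∞ (onProd (drKernel r)) :=
  ContDiff.sum fun j _ => ((contDiff_dr hr j).comp contDiff_fst).smul contDiff_const

lemma delbarZ_drKernel (ζ z : Cn n) : delbarZ (drKernel r) ζ z = 0 :=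
  Finset.sum_eq_zero fun j _ => by
    rw [show (fun w => drKernel r ζ w) = fun _ => drKernel r ζ z from rfl, ddbar_const, wedge_zero]

lemma exists_drKernel_le : ∃ C : ℝ, 0 ≤ C ∧ ∀ ζ z : Cn n, ‖drKernel r ζ z‖ ≤ C * grad r ζ := by
  refine ⟨∑ j : Fin n, ‖(genZeta (gen j false) : DForm n)‖, by positivity, fun ζ z => ?_⟩
  rw [Finset.sum_mul]
  refine (norm_sum_le _ _).trans (Finset.sum_le_sum fun j _ => ?_)
  rw [norm_smul, mul_comm]
  gcongr
  exact norm_dr_le_grad j ζ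

/-- `ρ²` as a complex valued function. -/
def rhoSqC (ρ : Cn n → Cn n → ℝ) (ζ z : Cn n) : ℂ := ((ρ ζ z ^ 2 : ℝ) : ℂ)

lemma IsDistance.contDiff_rhoSqC (hρ : IsDistance g ρ) : ContDiff ℝ ∞ (onProd (rhoSqC ρ)) :=
  Complex.ofRealCLM.contDiff.comp hρ.contDiff_rhoSq

lemma IsDistance.fderiv_rhoSqC_self (hρ : IsDistance g ρ) (x : Cn n) :
    fderiv ℝ (onProd (rhoSqC ρ)) (x, x) = 0 := by
  have hd : HasFDerivAt (onProd (rhoSqC ρ)) _ (x, x) := Complex.ofRealCLM.hasFDerivAt.comp (x, x)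
    (hρ.contDiff_rhoSq.differentiable (by simp)).differentiableAt.hasFDerivAt
  rw [hd.fderiv, hρ.fderiv_rhoSq_self, ContinuousLinearMap.comp_zero]

lemma contDiff_scalarKernel {f : Cn n → Cn n → ℂ} (hf : ContDiff ℝ ∞ (onProd f)) :
    ContDiff ℝ ∞ (onProd (scalarKernel f)) := hf.smul contDiff_const

lemma contDiff_delRhoSq (hρ : IsDistance g ρ) : ContDiff ℝ ∞ (onProd (delRhoSq ρ)) :=
  contDiff_iff_contDiffAt.2 fun _ =>
    contDiffAt_delZeta (contDiff_scalarKernel hρ.contDiff_rhoSqC).contDiffAt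

lemma delRhoSq_eq (hρ : IsDistance g ρ) (ζ z : Cn n) : delRhoSq ρ ζ z =
    ∑ j, dd j (fun w => rhoSqC ρ w z) ζ • genZeta (gen j false) := by
  unfold delRhoSq delZeta
  refine Finset.sum_congr rfl fun j _ => ?_
  have hd : DifferentiableAt ℝ (fun w => rhoSqC ρ w z) ζ :=
    (hasFDerivAt_onProd_left (p := (ζ, z))
      (hρ.contDiff_rhoSqC.differentiable (by simp)).differentiableAt).differentiableAt
  have h := dd_smul j hd (differentiableAt_const (oneForm : DForm n))
  rw [dd_const, smul_zero, zero_add] at h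
  change wedge _ (dd j (fun w => rhoSqC ρ w z • oneForm) ζ) = _
  rw [h, wedge_smul, wedge_oneForm]

lemma isZetaDegree_delRhoSq (hρ : IsDistance g ρ) (ζ z : Cn n) :
    IsZetaDegree 1 (delRhoSq ρ ζ z) := by
  rw [delRhoSq_eq hρ]
  exact IsZetaDegree.sum _ _ fun j => isZetaDegree_genZeta (gen j false)

lemma delRhoSq_self (hρ : IsDistance g ρ) (x : Cn n) : delRhoSq ρ x x = 0 := by
  rw [delRhoSq_eq hρ]
  refine Finset.sum_eq_zero fun j _ => ?_
  have h : HasFDerivAt (fun w => rhoSqC ρ w x) _ x := hasFDerivAt_onProd_left (p := (x, x))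
    (hρ.contDiff_rhoSqC.differentiable (by simp)).differentiableAt
  rw [dd, h.fderiv, hρ.fderiv_rhoSqC_self]
  simp

/-- The wedge product and its derivative in norm. -/
lemma exists_wedge_bound (n : ℕ) : ∃ w : ℝ, 0 ≤ w ∧
    (∀ F G : DForm n, ‖wedge F G‖ ≤ w * ‖F‖ * ‖G‖) ∧
    ∀ (F G : Cn n × Cn n → DForm n) (p : Cn n × Cn n), DifferentiableAt ℝ F p →
      DifferentiableAt ℝ G p → ‖fderiv ℝ (fun p => wedge (F p) (G p)) p‖ ≤
        w * (‖F p‖ * ‖fderiv ℝ G p‖ + ‖fderiv ℝ F p‖ * ‖G p‖) :=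
  ⟨‖(wedgeCLM : DForm n →L[ℝ] DForm n →L[ℝ] DForm n)‖, ContinuousLinearMap.opNorm_nonneg _, fun F G => wedge_norm_le F G,
    fun _ _ _ hF hG => norm_fderiv_bilinear_le wedgeCLM hF hG⟩

lemma exists_norm_fderiv_bound {V : Type*} [NormedAddCommGroup V] [NormedSpace ℝ V]
    {f : Cn n × Cn n → V} (hf : ContDiff ℝ ∞ f) (R : ℝ) : ∃ M : ℝ, 0 ≤ M ∧
      ∀ ζ ∈ Metric.closedBall (0 : Cn n) R, ∀ z ∈ Metric.closedBall (0 : Cn n) R,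
        ‖f (ζ, z)‖ ≤ M ∧ ‖fderiv ℝ f (ζ, z)‖ ≤ M := by
  have hcpt := (isCompact_closedBall (0 : Cn n) R).prod (isCompact_closedBall (0 : Cn n) R)
  obtain ⟨M, hM⟩ := hcpt.exists_bound_of_continuousOn hf.continuous.continuousOn
  obtain ⟨M', hM'⟩ := hcpt.exists_bound_of_continuousOn
    (hf.continuous_fderiv (by simp)).continuousOn
  exact ⟨max 0 (max M M'), le_max_left _ _, fun ζ hζ z hz =>
    ⟨(hM (ζ, z) ⟨hζ, hz⟩).trans ((le_max_left _ _).trans (le_max_right _ _)),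
      (hM' (ζ, z) ⟨hζ, hz⟩).trans ((le_max_right _ _).trans (le_max_right _ _))⟩⟩

/-- The size of the numerators and of their derivatives. -/
lemma exists_numer_bound (hr : IsHenkinLeiterer r U) (hρ : IsDistance g ρ) (R : ℝ) (q μ : ℕ) :
    ∃ C : ℝ, 0 ≤ C ∧ ∀ ζ ∈ Metric.closedBall (0 : Cn n) R, ∀ z ∈ Metric.closedBall (0 : Cn n) R,
      ‖numer q μ (drKernel r) (delRhoSq ρ) ζ z‖ ≤ C * (grad r ζ * ‖ζ - z‖) ∧
      ‖fderiv ℝ (onProd (numer q μ (drKernel r) (delRhoSq ρ))) (ζ, z)‖ ≤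
        C * (grad r ζ + ‖ζ - z‖) := by
  have ha := contDiff_drKernel hr.smooth
  have hb := contDiff_delRhoSq hρ
  obtain ⟨A, hA0, hA⟩ := exists_drKernel_le (r := r) (n := n)
  obtain ⟨B, hB0, hB⟩ := exists_vanishing_bound hb R (fun x => delRhoSq_self hρ x)
  obtain ⟨w, hw, hw1, hw2⟩ := exists_wedge_bound n
  -- The smallness comes from the two leading factors alone: ∂r is O(|∂r|) and ∂_ζρ² vanishes on the
  -- diagonal. The product S of the remaining factors only has to be bounded with its first
  -- derivatives.
  obtain ⟨S, hS, hSdef⟩ : ∃ S : Cn n × Cn n → DForm n, ContDiff ℝ ∞ S ∧ ∀ p, S p =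
    wedge (wedgePow (delbarZeta (drKernel r) p.1 p.2) μ)
      (wedge (wedgePow (delbarZeta (delRhoSq ρ) p.1 p.2) (n - q - μ - 2))
        (wedgePow (delbarZ (delRhoSq ρ) p.1 p.2) q)) :=
    ⟨_, contDiff_iff_contDiffAt.2 fun p =>
      contDiffAt_wedge (contDiffAt_wedgePow (contDiffAt_delbarZeta ha.contDiffAt) _) <|
      contDiffAt_wedge (contDiffAt_wedgePow (contDiffAt_delbarZeta hb.contDiffAt) _)
        (contDiffAt_wedgePow (contDiffAt_delbarZ hb.contDiffAt) _), fun _ => rfl⟩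
  have hbS : ContDiff ℝ ∞ fun p : Cn n × Cn n => wedge (onProd (delRhoSq ρ) p) (S p) :=
    contDiff_iff_contDiffAt.2 fun p => contDiffAt_wedge hb.contDiffAt hS.contDiffAt
  have hN : onProd (numer q μ (drKernel r) (delRhoSq ρ)) = fun p : Cn n × Cn n =>
      wedge (onProd (drKernel r) p) (wedge (onProd (delRhoSq ρ) p) (S p)) := by
    funext p
    rw [hSdef]
    rfl
  obtain ⟨M, hM0, hM⟩ := exists_norm_fderiv_bound hS R
  obtain ⟨M₁, hM₁0, hM₁⟩ := exists_norm_fderiv_bound ha R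
  obtain ⟨M₂, hM₂0, hM₂⟩ := exists_norm_fderiv_bound hb R
  refine ⟨w * A * (w * B * M) + w * A * w * ((2 * |R|) * B * M + M₂ * M) + w * M₁ * (w * B * M),
    by positivity, fun ζ hζ z hz => ?_⟩
  have hga := grad_nonneg (r := r) ζ
  have b1 : ‖onProd (drKernel r) (ζ, z)‖ ≤ A * grad r ζ := hA ζ z
  have b2 : ‖onProd (delRhoSq ρ) (ζ, z)‖ ≤ B * ‖ζ - z‖ := hB ζ hζ z hz
  obtain ⟨b3, b4⟩ := hM ζ hζ z hz
  have b5 := (hM₁ ζ hζ z hz).2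
  have b6 := (hM₂ ζ hζ z hz).2
  have hd2 : ‖ζ - z‖ ≤ 2 * |R| := by
    have hx' : ‖ζ‖ ≤ R := by simpa using hζ
    have hy' : ‖z‖ ≤ R := by simpa using hz
    have := norm_sub_le ζ z
    have := le_abs_self R
    linarith
  have c1 : ‖wedge (onProd (delRhoSq ρ) (ζ, z)) (S (ζ, z))‖ ≤ w * (B * ‖ζ - z‖) * M :=
    (hw1 _ _).trans (by gcongr)
  have c2 : ‖fderiv ℝ (fun p : Cn n × Cn n => wedge (onProd (delRhoSq ρ) p) (S p)) (ζ, z)‖ ≤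
      w * ((B * (2 * |R|)) * M + M₂ * M) :=
    (hw2 _ _ _ (hb.differentiable (by simp)).differentiableAt
      (hS.differentiable (by simp)).differentiableAt).trans (by gcongr; exact b2.trans (by gcongr))
  have c3 := hw2 _ _ (ζ, z) (ha.differentiable (by simp)).differentiableAt
    (hbS.differentiable (by simp)).differentiableAt
  have c4 := hw1 (onProd (drKernel r) (ζ, z)) (wedge (onProd (delRhoSq ρ) (ζ, z)) (S (ζ, z)))
  have hD : 0 ≤ ‖ζ - z‖ := norm_nonneg _
  refine ⟨?_, ?_⟩
  · rw [show numer q μ (drKernel r) (delRhoSq ρ) ζ z = wedge (onProd (drKernel r) (ζ, z))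
      (wedge (onProd (delRhoSq ρ) (ζ, z)) (S (ζ, z))) from congrFun hN (ζ, z)]
    calc _ ≤ w * (A * grad r ζ) * (w * (B * ‖ζ - z‖) * M) := c4.trans (by gcongr)
      _ = w * A * (w * B * M) * (grad r ζ * ‖ζ - z‖) := by ring
      _ ≤ _ := by
        rw [add_assoc]
        exact mul_le_mul_of_nonneg_right (le_add_of_nonneg_right (by positivity)) (by positivity)
  · rw [hN]
    calc _ ≤ w * (A * grad r ζ * (w * ((B * (2 * |R|)) * M + M₂ * M)) +
          M₁ * (w * (B * ‖ζ - z‖) * M)) := c3.trans (by gcongr)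
      _ = w * A * w * ((2 * |R|) * B * M + M₂ * M) * grad r ζ +
          w * M₁ * (w * B * M) * ‖ζ - z‖ := by ring
      _ ≤ (w * A * (w * B * M) + w * A * w * ((2 * |R|) * B * M + M₂ * M) +
          w * M₁ * (w * B * M)) * grad r ζ + (w * A * (w * B * M) +
          w * A * w * ((2 * |R|) * B * M + M₂ * M) + w * M₁ * (w * B * M)) * ‖ζ - z‖ := by
        refine add_le_add (mul_le_mul_of_nonneg_right ?_ hga) (mul_le_mul_of_nonneg_right ?_ hD)
        · have h1 : 0 ≤ w * A * (w * B * M) := by positivity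
          have h2 : 0 ≤ w * M₁ * (w * B * M) := by positivity
          linarith
        · exact le_add_of_nonneg_left (by positivity)
      _ = _ := by ring

end KernelBound

lemma norm_fderiv_inv_le {E : Type*} [NormedAddCommGroup E] [NormedSpace ℝ E] {f : E → ℂ} {x : E}
    (hf : DifferentiableAt ℝ f x) (h0 : f x ≠ 0) :
    ‖fderiv ℝ (fun y => (f y)⁻¹) x‖ ≤ ‖fderiv ℝ f x‖ * ‖f x‖⁻¹ ^ 2 := by
  have h1 : HasFDerivAt (fun w : ℂ => w⁻¹) _ (f x) :=
    ((hasDerivAt_inv h0).hasFDerivAt).restrictScalars ℝ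
  have h2 : HasFDerivAt (fun y => (f y)⁻¹) _ x := h1.comp x hf.hasFDerivAt
  rw [h2.fderiv]
  refine (ContinuousLinearMap.opNorm_comp_le _ _).trans ?_
  rw [mul_comm]
  refine mul_le_mul_of_nonneg_left ?_ (norm_nonneg _)
  refine ContinuousLinearMap.opNorm_le_bound _ (by positivity) fun w => ?_
  simp [mul_comm]

/-! ### The coefficients χ/φ_ε and 1/P_ε and the pointwise bound for the kernel -/

section KernelBound

variable {n : ℕ} {r : Cn n → ℝ} {U : Set (Cn n)} {g : Cn n → Matrix (Fin n) (Fin n) ℂ}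
  {ρ φ : Cn n → Cn n → ℝ} {γ χ : Cn n → ℝ} {κ δ : ℝ}

/-- The factor of `∂r` in `α_ε`. -/
def alphaCoeff (r χ : Cn n → ℝ) (ρ φ : Cn n → Cn n → ℝ) (ε : ℝ) (ζ z : Cn n) : ℂ :=
  (χ ζ : ℂ) / phi r ρ φ ε ζ z

/-- The factor of `∂_ζ ρ²` in `β_ε`. -/
def betaCoeff (r γ : Cn n → ℝ) (ρ : Cn n → Cn n → ℝ) (ε : ℝ) (ζ z : Cn n) : ℂ :=
  ((PP r γ ρ ε ζ z : ℝ) : ℂ)⁻¹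

/-- The kernel `ϑ_ζ L_q - ∂_z L_{q-1}`. -/
def homotopyKer (r γ χ : Cn n → ℝ) (g : Cn n → Matrix (Fin n) (Fin n) ℂ)
    (ρ φ : Cn n → Cn n → ℝ) (q : ℕ) (ε : ℝ) : Kernel n := fun ζ z =>
  thetaZeta g (LKer r γ χ g ρ φ q ε) ζ z - delZ (LKer r γ χ g ρ φ (q - 1) ε) ζ z

lemma contDiffAt_alphaCoeff (hr : ContDiff ℝ ∞ r) (hρ : IsDistance g ρ) (hφ : IsPatching ρ κ φ)
    (hχ : ContDiff ℝ ∞ χ) (ε : ℝ) {p : Cn n × Cn n} (h0 : phi r ρ φ ε p.1 p.2 ≠ 0) :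
    ContDiffAt ℝ ∞ (onProd (alphaCoeff r χ ρ φ ε)) p :=
  ((Complex.ofRealCLM.contDiff.comp (hχ.comp contDiff_fst)).contDiffAt).mul
    ((contDiff_phi hr hρ hφ ε).contDiffAt.inv h0)

lemma contDiffAt_betaCoeff (hr : ContDiff ℝ ∞ r) (hγ : IsGamma r U g γ) (hρ : IsDistance g ρ)
    (ε : ℝ) {p : Cn n × Cn n} (h1 : p.1 ∈ dom r) (h2 : p.2 ∈ dom r)
    (h0 : PP r γ ρ ε p.1 p.2 ≠ 0) : ContDiffAt ℝ ∞ (onProd (betaCoeff r γ ρ ε)) p :=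
  (Complex.ofRealCLM.contDiff.contDiffAt.comp p (contDiffAt_PP hr hγ hρ ε h1 h2)).inv
    (Complex.ofReal_ne_zero.2 h0)

lemma contDiffAt_LKer (hr : ContDiff ℝ ∞ r) (hg : IsLeviMetric r U g) (hγ : IsGamma r U g γ)
    (hρ : IsDistance g ρ) (q : ℕ)
    (ε : ℝ) {p : Cn n × Cn n} (h1 : p.1 ∈ dom r) (h2 : p.2 ∈ dom r)
    (h0 : PP r γ ρ ε p.1 p.2 ≠ 0) (hα : ContDiffAt ℝ ∞ (onProd (alphaCoeff r χ ρ φ ε)) p) :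
    ContDiffAt ℝ ∞ (onProd (LKer r γ χ g ρ φ q ε)) p :=
  contDiffAt_starConj (contDiff_starCoeff hg.smooth hg.posDef) _ <|
    contDiffAt_Cq (hα.smul (contDiff_drKernel hr).contDiffAt)
      ((contDiffAt_betaCoeff hr hγ hρ ε h1 h2 h0).smul (contDiff_delRhoSq hρ).contDiffAt) q

lemma contDiffAt_homotopyKer (hr : ContDiff ℝ ∞ r) (hg : IsLeviMetric r U g)
    (hγ : IsGamma r U g γ) (hρ : IsDistance g ρ) (q : ℕ)
    (ε : ℝ) {p : Cn n × Cn n} (h1 : p.1 ∈ dom r) (h2 : p.2 ∈ dom r)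
    (h0 : PP r γ ρ ε p.1 p.2 ≠ 0) (hα : ContDiffAt ℝ ∞ (onProd (alphaCoeff r χ ρ φ ε)) p) :
    ContDiffAt ℝ ∞ (onProd (homotopyKer r γ χ g ρ φ q ε)) p :=
  (contDiffAt_thetaZeta (contDiff_starCoeff hg.smooth hg.posDef)
    (contDiffAt_LKer hr hg hγ hρ q ε h1 h2 h0 hα)).sub
    (contDiffAt_delZ (contDiffAt_LKer hr hg hγ hρ (q - 1) ε h1 h2 h0 hα))

/-- Used to move ∂r from ζ to z, where it can be paired with r_ε(z)/γ(z), at the cost of a multiple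
of |ζ - z|. -/
lemma exists_grad_lipschitz (hr : ContDiff ℝ ∞ r) (R : ℝ) : ∃ L : ℝ, 0 ≤ L ∧
    ∀ ζ ∈ Metric.closedBall (0 : Cn n) R, ∀ z ∈ Metric.closedBall (0 : Cn n) R,
      grad r ζ ≤ grad r z + L * ‖ζ - z‖ := by
  have hv : ContDiff ℝ ∞ (gradVec r) := (contDiff_piLp 2).2 fun j => contDiff_dr hr j
  obtain ⟨L, hL0, hL⟩ := exists_lipschitz_bound hv (isCompact_closedBall (0 : Cn n) R)
    (convex_closedBall _ _)
  refine ⟨L, hL0, fun ζ hζ z hz => ?_⟩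
  have h1 := hL ζ hζ z hz
  have h2 := norm_le_norm_add_norm_sub' (gradVec r ζ) (gradVec r z)
  rw [norm_gradVec, norm_gradVec] at h2
  linarith

/-- Differentiating χ leaves 1/|φ_ε|; differentiating 1/φ_ε gives |Dφ_ε|/|φ_ε|². -/
lemma exists_alphaCoeff_bound (hr : IsHenkinLeiterer r U) (hρ : IsDistance g ρ)
    (hφ : IsPatching ρ κ φ) (hκ : 0 < κ) (hχ : IsCutoff r δ χ) (R : ℝ) :
    ∃ C : ℝ, 0 ≤ C ∧ ∀ ε ∈ Set.Ioo (0 : ℝ) 1,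
      ∀ ζ ∈ Metric.closedBall (0 : Cn n) R, ∀ z ∈ Metric.closedBall (0 : Cn n) R,
        phi r ρ φ ε ζ z ≠ 0 → ‖alphaCoeff r χ ρ φ ε ζ z‖ ≤ ‖phi r ρ φ ε ζ z‖⁻¹ ∧
        ‖fderiv ℝ (onProd (alphaCoeff r χ ρ φ ε)) (ζ, z)‖ ≤
          C * (‖phi r ρ φ ε ζ z‖⁻¹ + (grad r ζ + ‖ζ - z‖) * ‖phi r ρ φ ε ζ z‖⁻¹ ^ 2) := by
  obtain ⟨A, hA0, hA⟩ := exists_fderiv_phi_le hr.smooth hρ hφ hκ R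
  have hχc : ContDiff ℝ ∞ fun p : Cn n × Cn n => (χ p.1 : ℂ) :=
    Complex.ofRealCLM.contDiff.comp (hχ.smooth.comp contDiff_fst)
  obtain ⟨B, hB0, hB⟩ := exists_norm_fderiv_bound hχc R
  refine ⟨A + B, by positivity, fun ε hε ζ hζ z hz h0 => ?_⟩
  have hχ1 : ‖(χ ζ : ℂ)‖ ≤ 1 := by
    rw [Complex.norm_real, Real.norm_of_nonneg (hχ.range ζ).1]
    exact (hχ.range ζ).2
  have hd : DifferentiableAt ℝ (onProd (phi r ρ φ ε)) (ζ, z) :=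
    ((contDiff_phi hr.smooth hρ hφ ε).differentiable (by simp)).differentiableAt
  have h1 := norm_fderiv_inv_le hd h0
  have h2 := hA ε hε ζ hζ z hz
  have h3 := (hB ζ hζ z hz).2
  have hga := grad_nonneg (r := r) ζ
  constructor
  · rw [alphaCoeff, norm_div, div_eq_mul_inv]
    exact mul_le_of_le_one_left (by positivity) hχ1
  · have h4 := norm_fderiv_mul_le (x := (ζ, z)) (hχc.differentiable (by simp)).differentiableAt
      (hd.inv h0)
    change ‖fderiv ℝ (fun p : Cn n × Cn n => (χ p.1 : ℂ) * (onProd (phi r ρ φ ε) p)⁻¹) (ζ, z)‖ ≤ _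
    set f := ‖phi r ρ φ ε ζ z‖⁻¹
    have hf : 0 ≤ f := by positivity
    have h5 : ‖(onProd (phi r ρ φ ε) (ζ, z))⁻¹‖ = f := norm_inv _
    have hD : 0 ≤ ‖ζ - z‖ := norm_nonneg _
    calc _ ≤ 1 * (A * (grad r ζ + ‖ζ - z‖) * f ^ 2) + B * f := by
          refine h4.trans (add_le_add (mul_le_mul hχ1 (h1.trans ?_) (norm_nonneg _) zero_le_one) ?_)
          · exact mul_le_mul_of_nonneg_right h2 (by positivity)
          · rw [Pi.inv_apply, h5]; exact mul_le_mul_of_nonneg_right h3 hf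
      _ = A * ((grad r ζ + ‖ζ - z‖) * f ^ 2) + B * f := by ring
      _ ≤ (A + B) * ((grad r ζ + ‖ζ - z‖) * f ^ 2) + (A + B) * f := by gcongr <;> linarith
      _ = _ := by ring

lemma exists_betaCoeff_bound (hr : IsHenkinLeiterer r U) (hg : IsLeviMetric r U g)
    (hγ : IsGamma r U g γ) (hρ : IsDistance g ρ) : ∃ C : ℝ, 0 ≤ C ∧ ∀ ε > 0,
      ∀ ζ ∈ closure (domEps r ε), ∀ z ∈ closure (domEps r ε), PP r γ ρ ε ζ z ≠ 0 →
        ‖fderiv ℝ (onProd (betaCoeff r γ ρ ε)) (ζ, z)‖ ≤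
          C * (‖ζ - z‖ + |sEps r γ ε ζ| + |sEps r γ ε z|) * |PP r γ ρ ε ζ z|⁻¹ ^ 2 := by
  obtain ⟨C, hC0, hC⟩ := exists_fderiv_PP_le hr hg hγ hρ
  refine ⟨C, hC0, fun ε hε ζ hζ z hz h0 => ?_⟩
  have hsub := closure_domEps_subset_dom hr.smooth.continuous hε
  have hd := (contDiffAt_PP hr.smooth hγ hρ ε (p := (ζ, z)) (hsub hζ) (hsub hz)).differentiableAt
    (by simp)
  have hd' : HasFDerivAt (fun p : Cn n × Cn n => ((onProd (PP r γ ρ ε) p : ℝ) : ℂ)) _ (ζ, z) :=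
    Complex.ofRealCLM.hasFDerivAt.comp (ζ, z) hd.hasFDerivAt
  have h1 := norm_fderiv_inv_le hd'.differentiableAt (Complex.ofReal_ne_zero.2 h0)
  rw [hd'.fderiv, Complex.norm_real] at h1
  refine h1.trans (mul_le_mul_of_nonneg_right ?_ (by positivity))
  refine (ContinuousLinearMap.opNorm_comp_le _ _).trans ?_
  rw [Complex.ofRealCLM_norm, one_mul]
  exact hC ε hε ζ hζ z hz

/-- The bound for one term of `C_q` and its first derivatives. -/
lemma exists_term_bound (hr : IsHenkinLeiterer r U) (hg : IsLeviMetric r U g)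
    (hγ : IsGamma r U g γ) (hρ : IsDistance g ρ) (hφ : IsPatching ρ κ φ) (hκ : 0 < κ)
    (hχ : IsCutoff r δ χ) {c m : ℝ} (hc : 0 < c)
    (hlow : ∀ ε ∈ Set.Ioo (0 : ℝ) 1, ∀ ζ ∈ closure (domEps r ε),
        ∀ z ∈ closure (domEps r ε), -m ≤ r ζ →
          c * (-(r ζ + ε) + -(r z + ε) + ‖ζ - z‖ ^ 2) ≤ (phi r ρ φ ε ζ z).re)
    {q μ : ℕ} (hμ : μ + 2 ≤ n) : ∃ C : ℝ, 0 ≤ C ∧ ∀ ε ∈ Set.Ioo (0 : ℝ) 1,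
      ∀ ζ ∈ closure (domEps r ε), ∀ z ∈ closure (domEps r ε), -m ≤ r ζ → ζ ≠ z →
      ‖alphaCoeff r χ ρ φ ε ζ z‖ ^ (μ + 1) * ‖betaCoeff r γ ρ ε ζ z‖ ^ (n - 1 - μ) *
          (‖numer q μ (drKernel r) (delRhoSq ρ) ζ z‖ +
            ‖fderiv ℝ (onProd (numer q μ (drKernel r) (delRhoSq ρ))) (ζ, z)‖) +
        (‖alphaCoeff r χ ρ φ ε ζ z‖ ^ μ * ‖fderiv ℝ (onProd (alphaCoeff r χ ρ φ ε)) (ζ, z)‖ *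
            ‖betaCoeff r γ ρ ε ζ z‖ ^ (n - 1 - μ) +
          ‖alphaCoeff r χ ρ φ ε ζ z‖ ^ (μ + 1) * ‖betaCoeff r γ ρ ε ζ z‖ ^ (n - 2 - μ) *
            ‖fderiv ℝ (onProd (betaCoeff r γ ρ ε)) (ζ, z)‖) *
            ‖numer q μ (drKernel r) (delRhoSq ρ) ζ z‖ ≤
      C * ((‖ζ - z‖⁻¹ + gradSq r ζ * ‖ζ - z‖ * ‖phi r ρ φ ε ζ z‖⁻¹ ^ 2) *
        (PP r γ ρ ε ζ z)⁻¹ ^ (n - 1)) := by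
  obtain ⟨R, hR⟩ := hr.exists_ball
  obtain ⟨c', hc', hlow'⟩ := hρ.exists_lower hg.smooth hg.posDef R
  obtain ⟨A, hA0, hA⟩ := hγ.exists_grad_le hr hg
  obtain ⟨S, hS0, hS⟩ := exists_sEps_bound hr hg hγ
  obtain ⟨B, hB0, hB⟩ := exists_PP_le hr hg hγ hρ
  obtain ⟨L, hL0, hL⟩ := exists_grad_lipschitz hr.smooth R
  obtain ⟨C₁, hC₁0, hC₁⟩ := exists_alphaCoeff_bound hr hρ hφ hκ hχ R
  obtain ⟨C₂, hC₂0, hC₂⟩ := exists_betaCoeff_bound hr hg hγ hρ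
  obtain ⟨C₃, hC₃0, hC₃⟩ := exists_numer_bound hr hρ R q μ
  obtain ⟨K, hK1, k1, k2, k3, k4, k5, k6, k7, k8, k9, k10, k11⟩ : ∃ K : ℝ, 1 ≤ K ∧ c⁻¹ ≤ K ∧ c'⁻¹ ≤ K ∧ B * c⁻¹ ≤ K ∧
      2 * |R| ≤ K ∧ A * c⁻¹ ≤ K ∧ L ≤ K ∧ S * c⁻¹ ≤ K ∧ C₁ ≤ K ∧ C₂ ≤ K ∧ C₃ ≤ K ∧ A ≤ K := by
    have : 0 ≤ c⁻¹ := by positivity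
    have : 0 ≤ c'⁻¹ := by positivity
    have : 0 ≤ B * c⁻¹ := by positivity
    have : 0 ≤ A * c⁻¹ := by positivity
    have : 0 ≤ S * c⁻¹ := by positivity
    have : 0 ≤ 2 * |R| := by positivity
    refine ⟨1 + c⁻¹ + c'⁻¹ + B * c⁻¹ + 2 * |R| + A * c⁻¹ + L + S * c⁻¹ + C₁ + C₂ + C₃ + A,
      ?_, ?_, ?_, ?_, ?_, ?_, ?_, ?_, ?_, ?_, ?_, ?_⟩ <;> linarith
  refine ⟨12 * K ^ (n + 5), by positivity, fun ε hε ζ hζ z hz hm hne => ?_⟩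
  have hsub := closure_domEps_subset_dom hr.smooth.continuous hε.1
  have hζd := hsub hζ
  have hzd := hsub hz
  have hζR := hR (subset_closure hζd)
  have hzR := hR (subset_closure hzd)
  have hd : 0 < ‖ζ - z‖ := norm_pos_iff.2 (sub_ne_zero.2 hne)
  have hrζ : r ζ + ε ≤ 0 := closure_domEps_subset hr.smooth.continuous ε hζ
  have hrz : r z + ε ≤ 0 := closure_domEps_subset hr.smooth.continuous ε hz
  have hφle := (hlow ε hε ζ hζ z hz hm).trans ((Complex.re_le_norm _))
  have hP1 := hlow' ζ hζR z hzR
  have hP2 := rhoSq_le_PP (ρ := ρ) hr.smooth.continuous hγ hε.1 hζ hz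
  have hP3 := hB ε hε.1 ζ hζ z hz
  have hgζ := grad_nonneg (r := r) ζ
  set d := ‖ζ - z‖ with hddef
  set Φ := ‖phi r ρ φ ε ζ z‖ with hΦdef
  set P := PP r γ ρ ε ζ z with hPdef
  have hd2 : 0 < d ^ 2 := by positivity
  have hX : 0 < -(r ζ + ε) + -(r z + ε) + d ^ 2 := by linarith
  have hΦ : 0 < Φ := lt_of_lt_of_le (by positivity) hφle
  have hP : 0 < P := lt_of_lt_of_le (by positivity) (hP1.trans hP2)
  have hφ0 : phi r ρ φ ε ζ z ≠ 0 := norm_pos_iff.1 hΦ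
  have hF : 0 ≤ Φ⁻¹ := by positivity
  -- The lower bound for Re φ_ε, divided by |φ_ε|. It controls |r_ε(ζ)|, |r_ε(z)| and d² by |φ_ε| at
  -- once.
  have hXF : (-(r ζ + ε) + -(r z + ε) + d ^ 2) * Φ⁻¹ ≤ c⁻¹ := by
    rw [mul_inv_le_iff₀ hΦ, ← div_eq_inv_mul, le_div_iff₀ hc]
    linarith
  have hζF : |r ζ + ε| * Φ⁻¹ ≤ c⁻¹ := by
    refine le_trans ?_ hXF
    rw [abs_of_nonpos hrζ]
    gcongr
    linarith
  have hzF : |r z + ε| * Φ⁻¹ ≤ c⁻¹ := by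
    refine le_trans ?_ hXF
    rw [abs_of_nonpos hrz]
    gcongr
    linarith
  -- Since |∂r| = O(γ), a factor |∂r| times |r_ε/γ| at the same point is O(|r_ε|), hence O(|φ_ε|).
  have hγs : ∀ x ∈ dom r, γ x * |sEps r γ ε x| = |r x + ε| := fun x hx => by
    have hp := hγ.pos x hx
    rw [sEps, abs_div, abs_of_pos hp]
    field_simp
  have has' : grad r z * |sEps r γ ε z| * Φ⁻¹ ≤ A * c⁻¹ := by
    calc _ ≤ A * γ z * |sEps r γ ε z| * Φ⁻¹ := by
          gcongr
          exact hA z hzd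
      _ = A * (|r z + ε| * Φ⁻¹) := by rw [← hγs z hzd]; ring
      _ ≤ _ := by gcongr
  rw [← grad_sq]
  have hα := hC₁ ε hε ζ hζR z hzR hφ0
  have hβ := hC₂ ε hε.1 ζ hζ z hz hP.ne'
  rw [abs_of_pos hP] at hβ
  have hN := hC₃ ζ hζR z hzR
  have hβn : ‖betaCoeff r γ ρ ε ζ z‖ = P⁻¹ := by
    rw [betaCoeff, norm_inv, Complex.norm_real, Real.norm_of_nonneg hP.le]
  refine term_bound hμ (F := Φ⁻¹) (Q := P⁻¹) (s := |sEps r γ ε ζ|) (s' := |sEps r γ ε z|) hK1 hgζ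
    hd hF (by positivity) (abs_nonneg _) (abs_nonneg _) ?_ ?_ ?_ ?_ ?_ ?_ ?_ (norm_nonneg _)
    (norm_nonneg _) (norm_nonneg _) (norm_nonneg _) (norm_nonneg _) (norm_nonneg _) hα.1
    (hα.2.trans (by gcongr)) hβn.le (hβ.trans (by gcongr)) (hN.1.trans (by gcongr))
    (hN.2.trans (by gcongr))
  · refine le_trans ?_ (hXF.trans k1)
    gcongr
    linarith
  · refine le_trans ?_ k2
    rw [mul_inv_le_iff₀ hP, ← div_eq_inv_mul, le_div_iff₀ hc']
    linarith
  · refine le_trans ?_ (mul_le_mul_of_nonneg_right k3 (by positivity))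
    rw [← div_eq_mul_inv _ P, le_div_iff₀ hP, inv_mul_le_iff₀ hΦ]
    calc P ≤ B * (-(r ζ + ε) + -(r z + ε) + d ^ 2) := hP3
      _ = B * ((-(r ζ + ε) + -(r z + ε) + d ^ 2) * Φ⁻¹) * Φ := by field_simp
      _ ≤ B * c⁻¹ * Φ := by gcongr
      _ = _ := by ring
  · refine le_trans ?_ k4
    have hx' : ‖ζ‖ ≤ R := by simpa using hζR
    have hy' : ‖z‖ ≤ R := by simpa using hzR
    have := norm_sub_le ζ z
    have := le_abs_self R
    linarith
  · calc _ ≤ A * γ ζ * |sEps r γ ε ζ| * Φ⁻¹ := by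
          gcongr
          exact hA ζ hζd
      _ = A * (|r ζ + ε| * Φ⁻¹) := by rw [← hγs ζ hζd]; ring
      _ ≤ A * c⁻¹ := by gcongr
      _ ≤ K := k5
  · calc _ ≤ (grad r z + L * d) * |sEps r γ ε z| * Φ⁻¹ := by
          gcongr
          exact hL ζ hζR z hzR
      _ = grad r z * |sEps r γ ε z| * Φ⁻¹ + L * (d * |sEps r γ ε z| * Φ⁻¹) := by ring
      _ ≤ K + K * (d * |sEps r γ ε z| * Φ⁻¹) := by
          gcongr
          exact has'.trans k5
      _ = _ := by ring
  · calc _ ≤ S * |r z + ε| * Φ⁻¹ := by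
          gcongr
          rw [sq_abs, abs_of_nonpos hrz]
          exact (hS ε hε.1 z hz).1
      _ = S * (|r z + ε| * Φ⁻¹) := by ring
      _ ≤ S * c⁻¹ := by gcongr
      _ ≤ K := k7

/-- The bound for the kernel `ϑ_ζ L_q - ∂_z L_{q-1}`. -/
lemma exists_homotopyKer_bound (hr : IsHenkinLeiterer r U) (hg : IsLeviMetric r U g)
    (hγ : IsGamma r U g γ) (hρ : IsDistance g ρ) (hφ : IsPatching ρ κ φ) (hκ : 0 < κ)
    (hχ : IsCutoff r δ χ) {c m : ℝ} (hc : 0 < c)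
    (hlow : ∀ ε ∈ Set.Ioo (0 : ℝ) 1, ∀ ζ ∈ closure (domEps r ε),
        ∀ z ∈ closure (domEps r ε), -m ≤ r ζ →
          c * (-(r ζ + ε) + -(r z + ε) + ‖ζ - z‖ ^ 2) ≤ (phi r ρ φ ε ζ z).re)
    (q : ℕ) : ∃ C : ℝ, 0 ≤ C ∧ ∀ ε ∈ Set.Ioo (0 : ℝ) 1,
      ∀ ζ ∈ closure (domEps r ε), ∀ z ∈ closure (domEps r ε), -m ≤ r ζ → ζ ≠ z →
      ‖homotopyKer r γ χ g ρ φ q ε ζ z‖ ≤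
      C * ((‖ζ - z‖⁻¹ + gradSq r ζ * ‖ζ - z‖ * ‖phi r ρ φ ε ζ z‖⁻¹ ^ 2) *
        (PP r γ ρ ε ζ z)⁻¹ ^ (n - 1)) := by
  obtain ⟨R, hR⟩ := hr.exists_ball
  obtain ⟨c', hc', hlow'⟩ := hρ.exists_lower hg.smooth hg.posDef R
  obtain ⟨A, hA0, hA⟩ := exists_first_order_bound (contDiff_starCoeff hg.smooth hg.posDef)
    hr.isCompact_closure ((-1) ^ (q + 1)) ((-1) ^ (q - 1 + 1))
  -- The constants are chosen for all indices at once, with the default 0 outside the range of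
  -- summation. For q' = n - 1 the range is empty.
  have key : ∀ q' μ : ℕ, ∃ C : ℝ, 0 ≤ C ∧ (μ ∈ Finset.range (n - q' - 1) → _) := fun q' μ => by
    by_cases h : μ ∈ Finset.range (n - q' - 1)
    · have h' : μ + 2 ≤ n := by have := Finset.mem_range.1 h; omega
      obtain ⟨C, hC0, hC⟩ := exists_term_bound hr hg hγ hρ hφ hκ hχ hc hlow (q := q') h'
      exact ⟨C, hC0, fun _ => hC⟩
    · exact ⟨0, le_rfl, fun h' => absurd h' h⟩
  choose T hT0 hT using key
  set M : ℕ → ℝ := fun q' => ∑ μ ∈ Finset.range (n - q' - 1), ‖coeffCq n q' μ‖ * n * T q' μ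
  have hM0 : ∀ q', 0 ≤ M q' := fun q' => Finset.sum_nonneg fun μ _ =>
    mul_nonneg (by positivity) (hT0 q' μ)
  refine ⟨A * (M q + M (q - 1)), mul_nonneg hA0 (add_nonneg (hM0 _) (hM0 _)),
    fun ε hε ζ hζ z hz hm hne => ?_⟩
  have hsub := closure_domEps_subset_dom hr.smooth.continuous hε.1
  have hζd := hsub hζ
  have hzd := hsub hz
  have hζR := hR (subset_closure hζd)
  have hzR := hR (subset_closure hzd)
  have hd : 0 < ‖ζ - z‖ := norm_pos_iff.2 (sub_ne_zero.2 hne)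
  have hrζ : r ζ + ε ≤ 0 := closure_domEps_subset hr.smooth.continuous ε hζ
  have hrz : r z + ε ≤ 0 := closure_domEps_subset hr.smooth.continuous ε hz
  have hd2 : 0 < ‖ζ - z‖ ^ 2 := by positivity
  have hX : 0 < -(r ζ + ε) + -(r z + ε) + ‖ζ - z‖ ^ 2 := by linarith
  have hΦ : 0 < ‖phi r ρ φ ε ζ z‖ := lt_of_lt_of_le (by positivity)
    ((hlow ε hε ζ hζ z hz hm).trans (Complex.re_le_norm _))
  have hP : 0 < PP r γ ρ ε ζ z := lt_of_lt_of_le (by positivity)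
    ((hlow' ζ hζR z hzR).trans (rhoSq_le_PP hr.smooth.continuous hγ hε.1 hζ hz))
  have hu := contDiffAt_alphaCoeff (p := (ζ, z)) hr.smooth hρ hφ hχ.smooth ε (norm_pos_iff.1 hΦ)
  have hv := contDiffAt_betaCoeff (p := (ζ, z)) hr.smooth hγ hρ ε hζd hzd hP.ne'
  have hQ : ∀ q', ContDiffAt ℝ ∞ (onProd (Cq q' (alphaForm r χ ρ φ ε) (betaForm r γ ρ ε))) (ζ, z) :=
    fun q' => contDiffAt_Cq (hu.smul (contDiff_drKernel hr.smooth).contDiffAt)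
      (hv.smul (contDiff_delRhoSq hρ).contDiffAt) q'
  have hb : ∀ q', ‖Cq q' (alphaForm r χ ρ φ ε) (betaForm r γ ρ ε) ζ z‖ +
      ‖fderiv ℝ (onProd (Cq q' (alphaForm r χ ρ φ ε) (betaForm r γ ρ ε))) (ζ, z)‖ ≤
        M q' * ((‖ζ - z‖⁻¹ + gradSq r ζ * ‖ζ - z‖ * ‖phi r ρ φ ε ζ z‖⁻¹ ^ 2) *
        (PP r γ ρ ε ζ z)⁻¹ ^ (n - 1)) := fun q' => by
    refine (Cq_first_order_bound (p := (ζ, z)) isZetaDegree_drKernel (isZetaDegree_delRhoSq hρ)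
      (contDiff_drKernel hr.smooth) (contDiff_delRhoSq hρ) delbarZ_drKernel hu hv q').trans ?_
    rw [Finset.sum_mul]
    refine Finset.sum_le_sum fun μ hμ => ?_
    rw [mul_assoc (‖coeffCq n q' μ‖ * n)]
    exact mul_le_mul_of_nonneg_left (hT q' μ hμ ε hε ζ hζ z hz hm hne) (by positivity)
  refine (hA (ζ, z) (subset_closure hζd) _ _ (hQ q) (hQ (q - 1))).trans ?_
  rw [mul_assoc, add_mul]
  exact mul_le_mul_of_nonneg_left (add_le_add (hb q) (hb (q - 1))) hA0

end KernelBound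

section Families

variable {n : ℕ} {r : Cn n → ℝ} {U : Set (Cn n)} {g : Cn n → Matrix (Fin n) (Fin n) ℂ}
  {ρ φ : Cn n → Cn n → ℝ} {γ χ : Cn n → ℝ} {κ δ : ℝ}

/-! ### Geometry of the domain of the kernels -/

lemma lt_zero_of_mem_kerDom (hr : Continuous r) {ε : ℝ} {p : Cn n × Cn n} (hp : p ∈ kerDom r ε)
    (h : p.1 = p.2) : r p.1 + ε < 0 := by
  by_contra hn
  refine hp.2 ⟨h, hp.1.1, fun hi => hn ?_⟩
  rw [(isOpen_domEps hr ε).interior_eq] at hi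
  exact hi

/-- Off the diagonal the distance is positive; a diagonal point of this set lies in the open domain
D_ε, where r_ε < 0. So φ_ε does not vanish on the part of the set where its lower bound is
available. -/
lemma defect_pos (hr : Continuous r) {ε : ℝ} {p : Cn n × Cn n} (hp : p ∈ kerDom r ε) :
    0 < -(r p.1 + ε) + -(r p.2 + ε) + ‖p.1 - p.2‖ ^ 2 := by
  have h1 : r p.1 + ε ≤ 0 := closure_domEps_subset hr ε hp.1.1
  have h2 : r p.2 + ε ≤ 0 := closure_domEps_subset hr ε hp.1.2
  by_cases h : p.1 = p.2
  · have := lt_zero_of_mem_kerDom hr hp h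
    have := sq_nonneg ‖p.1 - p.2‖
    linarith
  · have : 0 < ‖p.1 - p.2‖ ^ 2 := by
      have := norm_pos_iff.2 (sub_ne_zero.2 h)
      positivity
    linarith

lemma PP_pos (hr : Continuous r) (hγ : IsGamma r U g γ) (hρ : IsDistance g ρ) {ε : ℝ}
    (hε : 0 < ε) {p : Cn n × Cn n} (hp : p ∈ kerDom r ε) : 0 < PP r γ ρ ε p.1 p.2 := by
  by_cases h : p.1 = p.2
  · have h1 := lt_zero_of_mem_kerDom hr hp h
    have h2 := hγ.pos _ (closure_domEps_subset_dom hr hε hp.1.1)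
    have h3 : sEps r γ ε p.1 < 0 := div_neg_of_neg_of_pos h1 h2
    rw [PP_eq, ← h, hρ.rho_self]
    have := mul_pos_of_neg_of_neg h3 h3
    linarith
  · have := pow_pos (hρ.pos _ _ h) 2
    exact this.trans_le (rhoSq_le_PP hr hγ hε hp.1.1 hp.1.2)

/-! ### The region where `χ` vanishes -/

/-- Every term of C_q has the factor α_ε, which is 0 where χ = 0. This includes zeros of φ_ε,
because 0 divided by 0 is 0. -/
lemma LKer_eq_zero (hχ : IsCutoff r δ χ) (q : ℕ) (ε : ℝ) {ζ : Cn n} (h : 3 / 2 * δ < |r ζ|)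
    (z : Cn n) : LKer r γ χ g ρ φ q ε ζ z = 0 := by
  have hα : alphaForm r χ ρ φ ε ζ z = 0 := by
    rw [alphaForm, hχ.eq_zero ζ h]
    simp
  have hC : Cq q (alphaForm r χ ρ φ ε) (betaForm r γ ρ ε) ζ z = 0 := by
    refine Finset.sum_eq_zero fun μ _ => Finset.sum_eq_zero fun ν _ => ?_
    rw [Cqmn, hα, zero_wedge, smul_zero]
  have hc : conjForm (0 : DForm n) = 0 := map_zero (conjCLM (n := n))
  rw [LKer, hC, hc, starZeta_eq, map_zero, smul_zero]

/-- The condition on ζ is open, so both kernels L vanish in a neighbourhood and their derivatives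
vanish too. -/
lemma homotopyKer_eventuallyEq_zero (hr : Continuous r) (hχ : IsCutoff r δ χ) (q : ℕ) (ε : ℝ)
    {p : Cn n × Cn n} (h : 3 / 2 * δ < |r p.1|) :
    onProd (homotopyKer r γ χ g ρ φ q ε) =ᶠ[𝓝 p] fun _ => 0 := by
  have hO : IsOpen {x : Cn n | 3 / 2 * δ < |r x|} := isOpen_lt continuous_const hr.abs
  have hev : ∀ᶠ p' : Cn n × Cn n in 𝓝 p, 3 / 2 * δ < |r p'.1| :=
    continuous_fst.continuousAt.eventually (hO.mem_nhds h)
  filter_upwards [hev] with p' hp'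
  have h1 : delZ (LKer r γ χ g ρ φ (q - 1) ε) p'.1 p'.2 = 0 :=
    Finset.sum_eq_zero fun j _ => by
      rw [show (fun w => LKer r γ χ g ρ φ (q - 1) ε p'.1 w) = fun _ => 0 from
        funext fun w => LKer_eq_zero hχ _ ε hp' w, dd_const, wedge_zero]
  have h2 : delZeta (fun ζ z => starZeta (g ζ) (LKer r γ χ g ρ φ q ε ζ z)) p'.1 p'.2 = 0 :=
    Finset.sum_eq_zero fun j _ => by
      have he : (fun w => starZeta (g w) (LKer r γ χ g ρ φ q ε w p'.2)) =ᶠ[𝓝 p'.1] fun _ => 0 := by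
        filter_upwards [hO.mem_nhds hp'] with w hw
        rw [LKer_eq_zero hχ _ ε hw, starZeta_eq, map_zero]
      have hd : dd j (fun w => starZeta (g w) (LKer r γ χ g ρ φ q ε w p'.2)) p'.1 = 0 := by
        rw [dd, he.fderiv_eq (𝕜 := ℝ)]
        simp
      rw [hd, wedge_zero]
  change thetaZeta g _ p'.1 p'.2 - delZ _ p'.1 p'.2 = 0
  rw [thetaZeta, h1, h2, starZeta_eq, map_zero, neg_zero, sub_zero]

/-! ### Splitting the kernel -/

/-- The weight that separates the admissible from the isotropic part. -/
def splitWeight (r : Cn n → ℝ) (ρ φ : Cn n → Cn n → ℝ) (ε : ℝ) (ζ z : Cn n) : ℝ :=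
  gradSq r ζ ^ 2 * (‖ζ - z‖ ^ 2) ^ 2 /
    ((‖phi r ρ φ ε ζ z‖ ^ 2) ^ 2 + gradSq r ζ ^ 2 * (‖ζ - z‖ ^ 2) ^ 2)

lemma splitWeight_mem (ε : ℝ) (ζ z : Cn n) :
    0 ≤ splitWeight r ρ φ ε ζ z ∧ splitWeight r ρ φ ε ζ z ≤ 1 :=
  ⟨by rw [splitWeight]; positivity,
    div_le_one_of_le₀ (le_add_of_nonneg_left (by positivity)) (by positivity)⟩

lemma contDiffAt_splitWeight (hr : ContDiff ℝ ∞ r) (hρ : IsDistance g ρ) (hφ : IsPatching ρ κ φ)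
    (ε : ℝ) {p : Cn n × Cn n} (h0 : phi r ρ φ ε p.1 p.2 ≠ 0) :
    ContDiffAt ℝ ∞ (onProd (splitWeight r ρ φ ε)) p := by
  have h1 : ContDiff ℝ ∞ fun p : Cn n × Cn n => gradSq r p.1 ^ 2 * (‖p.1 - p.2‖ ^ 2) ^ 2 :=
    (((contDiff_gradSq hr).comp contDiff_fst).pow 2).mul
      (((contDiff_fst.sub contDiff_snd).norm_sq ℝ).pow 2)
  have h2 : ContDiff ℝ ∞ fun p : Cn n × Cn n => (‖phi r ρ φ ε p.1 p.2‖ ^ 2) ^ 2 :=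
    ((contDiff_phi hr hρ hφ ε).norm_sq ℝ).pow 2
  refine h1.contDiffAt.div (h2.add h1).contDiffAt (ne_of_gt ?_)
  have := norm_pos_iff.2 h0
  positivity

/-- The elementary inequalities for the weight. -/
lemma weight_ineq {h d Φ : ℝ} (hh : 0 ≤ h) (hd : 0 < d) (hΦ : 0 < Φ) :
    h ^ 2 * (d ^ 2) ^ 2 / ((Φ ^ 2) ^ 2 + h ^ 2 * (d ^ 2) ^ 2) * (d⁻¹ + h * d * Φ⁻¹ ^ 2) ≤
      2 * (h * d * Φ⁻¹ ^ 2) ∧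
    (1 - h ^ 2 * (d ^ 2) ^ 2 / ((Φ ^ 2) ^ 2 + h ^ 2 * (d ^ 2) ^ 2)) * (d⁻¹ + h * d * Φ⁻¹ ^ 2) ≤
      2 * d⁻¹ := by
  -- Here x = h d²/Φ² is the quotient of the two terms of the bracket. The claims become x²(1+x) ≤
  -- 2x(1+x²) and 1+x ≤ 2(1+x²).
  obtain ⟨x, hx0, rfl⟩ : ∃ x, 0 ≤ x ∧ h = x * Φ ^ 2 / d ^ 2 :=
    ⟨h * d ^ 2 / Φ ^ 2, by positivity, by field_simp⟩
  have e1 : (x * Φ ^ 2 / d ^ 2) ^ 2 * (d ^ 2) ^ 2 /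
      ((Φ ^ 2) ^ 2 + (x * Φ ^ 2 / d ^ 2) ^ 2 * (d ^ 2) ^ 2) = x ^ 2 / (1 + x ^ 2) := by
    field_simp
  have e2 : x * Φ ^ 2 / d ^ 2 * d * Φ⁻¹ ^ 2 = x * d⁻¹ := by field_simp
  rw [e1, e2]
  have hi : 0 < d⁻¹ := inv_pos.2 hd
  have hx : 0 < 1 + x ^ 2 := by positivity
  have e3 : 1 - x ^ 2 / (1 + x ^ 2) = 1 / (1 + x ^ 2) := by field_simp; ring
  have f1 : x ^ 2 / (1 + x ^ 2) * (1 + x) ≤ 2 * x := by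
    rw [div_mul_eq_mul_div, div_le_iff₀ hx]
    nlinarith [sq_nonneg (x - 1), mul_nonneg hx0 (sq_nonneg (x - 1)), mul_nonneg hx0 (sq_nonneg x)]
  have f2 : 1 / (1 + x ^ 2) * (1 + x) ≤ 2 := by
    rw [div_mul_eq_mul_div, div_le_iff₀ hx]
    nlinarith [sq_nonneg (x - 1)]
  rw [e3]
  constructor
  · calc _ = (x ^ 2 / (1 + x ^ 2) * (1 + x)) * d⁻¹ := by ring
      _ ≤ 2 * x * d⁻¹ := by gcongr
      _ = _ := by ring
  · calc _ = (1 / (1 + x ^ 2) * (1 + x)) * d⁻¹ := by ring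
      _ ≤ 2 * d⁻¹ := by gcongr

/-- The admissible part of the kernel. -/
def admissiblePart (r γ χ : Cn n → ℝ) (g : Cn n → Matrix (Fin n) (Fin n) ℂ)
    (ρ φ : Cn n → Cn n → ℝ) (q : ℕ) (ε : ℝ) : Kernel n := fun ζ z =>
  (splitWeight r ρ φ ε ζ z : ℂ) • homotopyKer r γ χ g ρ φ q ε ζ z

/-- The isotropic part of the kernel. -/
def isotropicPart (r γ χ : Cn n → ℝ) (g : Cn n → Matrix (Fin n) (Fin n) ℂ)
    (ρ φ : Cn n → Cn n → ℝ) (q : ℕ) (ε : ℝ) : Kernel n := fun ζ z =>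
  ((1 - splitWeight r ρ φ ε ζ z : ℝ) : ℂ) • homotopyKer r γ χ g ρ φ q ε ζ z +
    delbarZeta (GammaKer ρ q) ζ z

lemma TKer_eq (q : ℕ) (ε : ℝ) (ζ z : Cn n) : TKer r γ χ g ρ φ q ε ζ z =
    isotropicPart r γ χ g ρ φ q ε ζ z + admissiblePart r γ χ g ρ φ q ε ζ z := by
  change homotopyKer r γ χ g ρ φ q ε ζ z + _ = _
  rw [isotropicPart, admissiblePart]
  push_cast
  module

/-- Where φ_ε ≠ 0 all ingredients are smooth, diagonal points of D_ε included, since P_ε > 0 there.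
Otherwise the kernel vanishes in a neighbourhood and the factor u, which may be singular, is
irrelevant. -/
lemma contDiffAt_smul_homotopyKer (hr : IsHenkinLeiterer r U) (hg : IsLeviMetric r U g)
    (hγ : IsGamma r U g γ) (hρ : IsDistance g ρ) (hφ : IsPatching ρ κ φ) (hχ : IsCutoff r δ χ)
    (q : ℕ) {ε : ℝ} (hε : 0 < ε) {p : Cn n × Cn n} (hp : p ∈ kerDom r ε)
    (hcase : phi r ρ φ ε p.1 p.2 ≠ 0 ∨ 3 / 2 * δ < |r p.1|) {u : Cn n → Cn n → ℂ}
    (hu : phi r ρ φ ε p.1 p.2 ≠ 0 → ContDiffAt ℝ ∞ (onProd u) p) :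
    ContDiffAt ℝ ∞ (fun p : Cn n × Cn n => u p.1 p.2 • homotopyKer r γ χ g ρ φ q ε p.1 p.2) p := by
  have hsub := closure_domEps_subset_dom hr.smooth.continuous hε
  rcases hcase with h | h
  · exact (hu h).smul (contDiffAt_homotopyKer hr.smooth hg hγ hρ q ε (hsub hp.1.1) (hsub hp.1.2)
      (PP_pos hr.smooth.continuous hγ hρ hε hp).ne'
      (contDiffAt_alphaCoeff hr.smooth hρ hφ hχ.smooth ε h))
  · refine (contDiffAt_const (c := (0 : DForm n))).congr_of_eventuallyEq ?_
    filter_upwards [homotopyKer_eventuallyEq_zero (γ := γ) (g := g) (ρ := ρ) (φ := φ)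
      hr.smooth.continuous hχ q ε h] with p' hp'
    have hp'' : homotopyKer r γ χ g ρ φ q ε p'.1 p'.2 = 0 := hp'
    rw [hp'', smul_zero]

/-- On the domain of the kernels, either `φ_ε` does not vanish or `χ` vanishes. -/
lemma phi_ne_zero_or (hr : Continuous r) {c m : ℝ} (hc : 0 < c)
    (hlow : ∀ ε ∈ Set.Ioo (0 : ℝ) 1, ∀ ζ ∈ closure (domEps r ε),
        ∀ z ∈ closure (domEps r ε), -m ≤ r ζ →
          c * (-(r ζ + ε) + -(r z + ε) + ‖ζ - z‖ ^ 2) ≤ (phi r ρ φ ε ζ z).re)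
    (hδ : 3 / 2 * δ < m) {ε : ℝ} (hε : ε ∈ Set.Ioo (0 : ℝ) 1) {p : Cn n × Cn n}
    (hp : p ∈ kerDom r ε) :
    (-m ≤ r p.1 ∧ phi r ρ φ ε p.1 p.2 ≠ 0) ∨ 3 / 2 * δ < |r p.1| := by
  by_cases h : -m ≤ r p.1
  · refine Or.inl ⟨h, fun h0 => ?_⟩
    have h1 := hlow ε hε p.1 hp.1.1 p.2 hp.1.2 h
    rw [h0, Complex.zero_re] at h1
    have := mul_pos hc (defect_pos hr hp)
    linarith
  · refine Or.inr (hδ.trans ?_)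
    have := neg_abs_le (r p.1)
    linarith

/-- The bounds for the two parts of `ϑ_ζ L_q - ∂_z L_{q-1}`. -/
lemma exists_split_bound (hr : IsHenkinLeiterer r U) (hg : IsLeviMetric r U g)
    (hγ : IsGamma r U g γ) (hρ : IsDistance g ρ) (hφ : IsPatching ρ κ φ) (hκ : 0 < κ)
    (hχ : IsCutoff r δ χ) {c m : ℝ} (hc : 0 < c)
    (hlow : ∀ ε ∈ Set.Ioo (0 : ℝ) 1, ∀ ζ ∈ closure (domEps r ε),
        ∀ z ∈ closure (domEps r ε), -m ≤ r ζ →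
          c * (-(r ζ + ε) + -(r z + ε) + ‖ζ - z‖ ^ 2) ≤ (phi r ρ φ ε ζ z).re)
    (hδ : 3 / 2 * δ < m) (q : ℕ) :
    ∃ C : ℝ, 0 ≤ C ∧ ∀ ε ∈ Set.Ioo (0 : ℝ) 1, ∀ p ∈ kerDom r ε,
      ‖admissiblePart r γ χ g ρ φ q ε p.1 p.2‖ * (‖phi r ρ φ ε p.1 p.2‖ ^ 2 *
        PP r γ ρ ε p.1 p.2 ^ (n - 1)) ≤ C * (gradSq r p.1 * ‖p.1 - p.2‖) ∧
      (p.1 ≠ p.2 → ‖((1 - splitWeight r ρ φ ε p.1 p.2 : ℝ) : ℂ) •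
        homotopyKer r γ χ g ρ φ q ε p.1 p.2‖ * PP r γ ρ ε p.1 p.2 ^ (n - 1) ≤
          C * ‖p.1 - p.2‖⁻¹) := by
  obtain ⟨C, hC0, hC⟩ := exists_homotopyKer_bound hr hg hγ hρ hφ hκ hχ hc hlow q
  refine ⟨2 * C, by positivity, fun ε hε p hp => ?_⟩
  have hP := PP_pos hr.smooth.continuous hγ hρ hε.1 hp
  have hh := gradSq_nonneg (r := r) p.1
  have hw := splitWeight_mem (r := r) (ρ := ρ) (φ := φ) ε p.1 p.2
  by_cases hne : p.1 = p.2
  · refine ⟨?_, fun h => absurd hne h⟩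
    -- The estimate of the full kernel is restricted to ζ ≠ z; on the diagonal the weight itself is
    -- 0.
    have : splitWeight r ρ φ ε p.1 p.2 = 0 := by simp [splitWeight, hne]
    rw [admissiblePart, this]
    simp only [Complex.ofReal_zero, zero_smul, norm_zero, zero_mul]
    positivity
  rcases phi_ne_zero_or hr.smooth.continuous hc hlow hδ hε hp with ⟨hm, h0⟩ | h
  · have hb := hC ε hε p.1 hp.1.1 p.2 hp.1.2 hm hne
    have hd : 0 < ‖p.1 - p.2‖ := norm_pos_iff.2 (sub_ne_zero.2 hne)
    have hΦ : 0 < ‖phi r ρ φ ε p.1 p.2‖ := norm_pos_iff.2 h0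
    obtain ⟨w1, w2⟩ := weight_ineq hh hd hΦ
    rw [show gradSq r p.1 ^ 2 * (‖p.1 - p.2‖ ^ 2) ^ 2 / ((‖phi r ρ φ ε p.1 p.2‖ ^ 2) ^ 2 +
      gradSq r p.1 ^ 2 * (‖p.1 - p.2‖ ^ 2) ^ 2) = splitWeight r ρ φ ε p.1 p.2 from rfl] at w1 w2
    rw [admissiblePart, norm_smul, norm_smul, Complex.norm_real, Complex.norm_real,
      Real.norm_of_nonneg hw.1, Real.norm_of_nonneg (sub_nonneg.2 hw.2)]
    set w := splitWeight r ρ φ ε p.1 p.2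
    set d := ‖p.1 - p.2‖
    set Φ := ‖phi r ρ φ ε p.1 p.2‖
    set P := PP r γ ρ ε p.1 p.2
    set h := gradSq r p.1
    constructor
    · calc _ ≤ w * (C * ((d⁻¹ + h * d * Φ⁻¹ ^ 2) * P⁻¹ ^ (n - 1))) * (Φ ^ 2 * P ^ (n - 1)) := by
            gcongr
            exact hw.1
        _ = C * (w * (d⁻¹ + h * d * Φ⁻¹ ^ 2)) * (Φ ^ 2 * (P⁻¹ ^ (n - 1) * P ^ (n - 1))) := by ring
        _ ≤ C * (2 * (h * d * Φ⁻¹ ^ 2)) * (Φ ^ 2 * (P⁻¹ ^ (n - 1) * P ^ (n - 1))) := by gcongr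
        _ = _ := by rw [inv_pow P, inv_mul_cancel₀ (by positivity)]; field_simp
    · intro _
      calc _ ≤ (1 - w) * (C * ((d⁻¹ + h * d * Φ⁻¹ ^ 2) * P⁻¹ ^ (n - 1))) * P ^ (n - 1) := by
            gcongr
            exact sub_nonneg.2 hw.2
        _ = C * ((1 - w) * (d⁻¹ + h * d * Φ⁻¹ ^ 2)) * (P⁻¹ ^ (n - 1) * P ^ (n - 1)) := by ring
        _ ≤ C * (2 * d⁻¹) * (P⁻¹ ^ (n - 1) * P ^ (n - 1)) := by gcongr
        _ = _ := by rw [inv_pow P, inv_mul_cancel₀ (by positivity)]; ring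
  · have h0 : homotopyKer r γ χ g ρ φ q ε p.1 p.2 = 0 :=
      (homotopyKer_eventuallyEq_zero hr.smooth.continuous hχ q ε h).eq_of_nhds
    rw [admissiblePart, h0]
    simp only [smul_zero, norm_zero, zero_mul]
    exact ⟨by positivity, fun _ => by positivity⟩

end Families

section Families

variable {n : ℕ} {r : Cn n → ℝ} {U : Set (Cn n)} {g : Cn n → Matrix (Fin n) (Fin n) ℂ}
  {ρ φ : Cn n → Cn n → ℝ} {γ χ : Cn n → ℝ} {κ δ : ℝ}

/-! ### The admissible part -/

lemma diff_diagonal_subset_kerDom (ε : ℝ) :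
    (closure (domEps r ε) ×ˢ closure (domEps r ε)) \ {p : Cn n × Cn n | p.1 = p.2} ⊆ kerDom r ε :=
  fun _ hp => ⟨hp.1, fun h => hp.2 h.1⟩

/-- The exponents of the admissible part. -/
def splitExponents (n : ℕ) : Exponents where
  N := 0
  M := 0
  j := 1
  k := 0
  α := 2
  β := 0
  t₀ := n - 1
  t₁ := -2
  t₂ := 0
  t₃ := 0
  t₄ := 0
  l := 0
  m := 0
  sum_nonpos := by norm_num
  N_add_nonneg := by norm_num
  M_add_nonneg := by norm_num

/-- With t = 2 the smooth type is 2n + 1 + 2 - 2(n+1) = 1, and α = 2 reduces the correction max{0, 2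
- α} to 0. The hypothesis on n makes n - 1 exact. -/
lemma one_le_type_splitExponents (hn : 1 ≤ n) : 1 ≤ (splitExponents n).type n := by
  simp only [Exponents.type, Exponents.smoothType, Exponents.t, splitExponents]
  push_cast [hn]
  norm_num
  omega

/-- The form in the numerator of the admissible part. -/
def admissibleNumer (r γ χ : Cn n → ℝ) (g : Cn n → Matrix (Fin n) (Fin n) ℂ)
    (ρ φ : Cn n → Cn n → ℝ) (q : ℕ) (ε : ℝ) : Kernel n := fun ζ z =>
  (phi r ρ φ ε ζ z ^ 2 * (PP r γ ρ ε ζ z : ℂ) ^ (n - 1)) • admissiblePart r γ χ g ρ φ q ε ζ z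

lemma contDiffAt_splitWeightC (hr : ContDiff ℝ ∞ r) (hρ : IsDistance g ρ) (hφ : IsPatching ρ κ φ)
    (ε : ℝ) {p : Cn n × Cn n} (h0 : phi r ρ φ ε p.1 p.2 ≠ 0) :
    ContDiffAt ℝ ∞ (onProd fun ζ z => (splitWeight r ρ φ ε ζ z : ℂ)) p :=
  Complex.ofRealCLM.contDiff.contDiffAt.comp p (contDiffAt_splitWeight hr hρ hφ ε h0)

variable {c m : ℝ}

lemma contDiffAt_admissiblePart (hr : IsHenkinLeiterer r U) (hg : IsLeviMetric r U g)
    (hγ : IsGamma r U g γ) (hρ : IsDistance g ρ) (hφ : IsPatching ρ κ φ)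
    (hχ : IsCutoff r δ χ) (hc : 0 < c)
    (hlow : ∀ ε ∈ Set.Ioo (0 : ℝ) 1, ∀ ζ ∈ closure (domEps r ε),
        ∀ z ∈ closure (domEps r ε), -m ≤ r ζ →
          c * (-(r ζ + ε) + -(r z + ε) + ‖ζ - z‖ ^ 2) ≤ (phi r ρ φ ε ζ z).re)
    (hδ : 3 / 2 * δ < m) (q : ℕ) {ε : ℝ} (hε : ε ∈ Set.Ioo (0 : ℝ) 1) {p : Cn n × Cn n}
    (hp : p ∈ kerDom r ε) :
    ContDiffAt ℝ ∞ (onProd (admissiblePart r γ χ g ρ φ q ε)) p :=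
  contDiffAt_smul_homotopyKer hr hg hγ hρ hφ hχ q hε.1 hp
    ((phi_ne_zero_or hr.smooth.continuous hc hlow hδ hε hp).imp_left And.right)
    (contDiffAt_splitWeightC hr.smooth hρ hφ ε)

/-- A single representation serves near all points: multiplying by φ_ε² P_ε^{n-1} gives a smooth
numerator of size |∂r|² |ζ - z|, with 𝓔* = 1 and without factors R. The phase of φ_ε is harmless
since only the size of the numerator is prescribed. -/
lemma isAdmissible_admissiblePart (hr : IsHenkinLeiterer r U) (hg : IsLeviMetric r U g)
    (hγ : IsGamma r U g γ) (hρ : IsDistance g ρ) (hφ : IsPatching ρ κ φ) (hκ : 0 < κ)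
    (hχ : IsCutoff r δ χ) (hc : 0 < c)
    (hlow : ∀ ε ∈ Set.Ioo (0 : ℝ) 1, ∀ ζ ∈ closure (domEps r ε),
        ∀ z ∈ closure (domEps r ε), -m ≤ r ζ →
          c * (-(r ζ + ε) + -(r z + ε) + ‖ζ - z‖ ^ 2) ≤ (phi r ρ φ ε ζ z).re)
    (hδ : 3 / 2 * δ < m) (hn : 1 ≤ n) (q : ℕ) :
    IsAdmissible r γ ρ φ 1 1 (admissiblePart r γ χ g ρ φ q) := by
  have hsm : ∀ ε ∈ Set.Ioo (0 : ℝ) 1, ∀ p ∈ kerDom r ε,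
      ContDiffAt ℝ ∞ (onProd (admissiblePart r γ χ g ρ φ q ε)) p := fun ε hε p hp =>
    contDiffAt_admissiblePart hr hg hγ hρ hφ hχ hc hlow hδ q hε hp
  obtain ⟨C, hC0, hC⟩ := exists_split_bound hr hg hγ hρ hφ hκ hχ hc hlow hδ q
  refine ⟨fun ε hε p hp => (hsm ε hε p (diff_diagonal_subset_kerDom ε hp)).contDiffWithinAt,
    fun x _ => ⟨Set.univ, Filter.univ_mem, splitExponents n, one_le_type_splitExponents hn,
      fun _ => 1, fun _ => 1, admissibleNumer r γ χ g ρ φ q, fun _ _ _ => oneForm, by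
        simp [IsR, splitExponents], by simp [IsR, splitExponents], ?_, ?_, Or.inl ?_⟩⟩
  · refine ⟨gradSq r, isWeight_gradSq hγ hr hg, C, fun ε hε => ⟨fun p hp => ?_, fun p hp => ?_⟩⟩
    · have hsub := closure_domEps_subset_dom hr.smooth.continuous hε.1
      exact (((contDiff_phi hr.smooth hρ hφ ε).contDiffAt.pow 2).mul
        ((Complex.ofRealCLM.contDiff.contDiffAt.comp p (contDiffAt_PP hr.smooth hγ hρ ε
          (hsub hp.2.1.1) (hsub hp.2.1.2))).pow (n - 1))).smul (hsm ε hε p hp.2)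
        |>.contDiffWithinAt
    · have h1 := (hC ε hε p hp.2).1
      have hP := PP_pos hr.smooth.continuous hγ hρ hε.1 hp.2
      rw [admissibleNumer, norm_smul, norm_mul, norm_pow, norm_pow, Complex.norm_real,
        Real.norm_of_nonneg hP.le, abs_of_nonneg (gradSq_nonneg p.1)]
      simp only [splitExponents, pow_one]
      linarith
  · exact ⟨fun _ => 1, isWeight_one, ‖(oneForm : DForm n)‖, fun ε hε =>
      ⟨contDiffOn_const, fun p _ => by
        have : swapKernel (fun _ _ => (oneForm : DForm n)) p.1 p.2 = oneForm := by
          funext S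
          simp only [swapKernel, oneForm, Pi.single_apply]
          congr 1
          refine propext ⟨fun h => ?_, fun h => by rw [h]; rfl⟩
          rw [← Prod.swap_swap S, h]
          rfl
        change ‖swapKernel (fun _ _ => (oneForm : DForm n)) p.1 p.2‖ ≤ _
        rw [this]
        simp [splitExponents]⟩⟩
  · intro ε hε p hp
    have hP := PP_pos hr.smooth.continuous hγ hρ hε.1 hp.2
    have hPc : (PP r γ ρ ε p.1 p.2 : ℂ) ≠ 0 := Complex.ofReal_ne_zero.2 hP.ne'
    simp only [admissibleForm, splitExponents, admissibleNumer, zpow_zero, pow_zero, mul_one, one_mul,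
      wedge_oneForm, smul_smul]
    rcases phi_ne_zero_or hr.smooth.continuous hc hlow hδ hε hp.2 with ⟨-, h0⟩ | h
    · have : ((PP r γ ρ ε p.1 p.2 : ℂ) ^ (n - 1))⁻¹ * phi r ρ φ ε p.1 p.2 ^ (-2 : ℤ) *
          (phi r ρ φ ε p.1 p.2 ^ 2 * (PP r γ ρ ε p.1 p.2 : ℂ) ^ (n - 1)) = 1 := by
        rw [zpow_neg, show (phi r ρ φ ε p.1 p.2 ^ (2 : ℤ)) = phi r ρ φ ε p.1 p.2 ^ 2 from
          zpow_natCast _ 2]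
        field_simp
      rw [this, one_smul]
    -- Here φ_ε may be 0, so its negative power cannot be cancelled; both sides vanish together with
    -- the kernel.
    · have h0 : homotopyKer r γ χ g ρ φ q ε p.1 p.2 = 0 :=
        (homotopyKer_eventuallyEq_zero hr.smooth.continuous hχ q ε h).eq_of_nhds
      rw [admissiblePart, h0, smul_zero, smul_zero]

/-! ### The isotropic part -/

/-- `∂̄_ζ ∂_z ρ²` to the power `q`. -/
def mixedPow (ρ : Cn n → Cn n → ℝ) (q : ℕ) : Kernel n := fun ζ z =>
  wedgePow (delbarZeta (delZ (scalarKernel (rhoSqC ρ))) ζ z) q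

/-- The numerator of `∂̄_ζ Γ_{0,q}` over `ρ^{2n}`. -/
def gammaNumer (ρ : Cn n → Cn n → ℝ) (q : ℕ) : Kernel n := fun ζ z =>
  ∑ j, wedge (genZeta (gen j true))
    ((((n - 2).factorial : ℂ) / (2 * (Real.pi : ℂ) ^ n)) •
      (rhoSqC ρ ζ z • ddbar j (fun w => mixedPow ρ q w z) ζ +
        (-((n - 1 : ℕ) : ℂ) * ddbar j (fun w => rhoSqC ρ w z) ζ) • mixedPow ρ q ζ z))

lemma contDiff_mixedPow (hρ : IsDistance g ρ) (q : ℕ) : ContDiff ℝ ∞ (onProd (mixedPow ρ q)) :=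
  contDiff_iff_contDiffAt.2 fun _ => contDiffAt_wedgePow (contDiffAt_delbarZeta (contDiffAt_delZ
    (contDiff_scalarKernel hρ.contDiff_rhoSqC).contDiffAt)) q

lemma contDiff_gammaNumer (hρ : IsDistance g ρ) (q : ℕ) : ContDiff ℝ ∞ (onProd (gammaNumer ρ q)) :=
  contDiff_iff_contDiffAt.2 fun _ => ContDiffAt.sum fun j _ => contDiffAt_wedge contDiffAt_const <|
    ((hρ.contDiff_rhoSqC.contDiffAt.smul (contDiffAt_ddbar_of_fderiv j
      (contDiffAt_fderiv_left (contDiff_mixedPow hρ q).contDiffAt))).add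
      ((contDiffAt_const.mul (contDiffAt_ddbar_of_fderiv j
        (contDiffAt_fderiv_left hρ.contDiff_rhoSqC.contDiffAt))).smul
        (contDiff_mixedPow hρ q).contDiffAt)).const_smul _

/-- Both terms contain ρ² or its first derivative, which are zero on the diagonal. Hence ρ^{2n} ∂̄_ζ
Γ_{0,q} is O(|ζ - z|), the size needed for an isotropic kernel. -/
lemma gammaNumer_self (hρ : IsDistance g ρ) (q : ℕ) (x : Cn n) : gammaNumer ρ q x x = 0 := by
  refine Finset.sum_eq_zero fun j _ => ?_
  have h : HasFDerivAt (fun w => rhoSqC ρ w x) _ x := hasFDerivAt_onProd_left (p := (x, x))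
    (hρ.contDiff_rhoSqC.differentiable (by simp)).differentiableAt
  have h1 : ddbar j (fun w => rhoSqC ρ w x) x = 0 := by
    rw [ddbar, h.fderiv, hρ.fderiv_rhoSqC_self]
    simp
  have h2 : rhoSqC ρ x x = 0 := by simp [rhoSqC, hρ.rho_self]
  rw [h1, h2, mul_zero, zero_smul, zero_smul, add_zero, smul_zero, wedge_zero]

/-- For n = 1 the truncated exponent is harmless: the factor n - 1 makes both sides 0. -/
lemma inv_pow_deriv_aux (hn : 1 ≤ n) {s : ℂ} (hs : s ≠ 0) :
    -(((n - 1 : ℕ) : ℂ) * s ^ (n - 1 - 1)) / (s ^ (n - 1)) ^ 2 =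
      -((n - 1 : ℕ) : ℂ) * (s ^ n)⁻¹ := by
  rcases Nat.lt_or_ge 1 n with h1 | h1
  · obtain ⟨k, rfl⟩ : ∃ k, n = k + 2 := ⟨n - 2, by omega⟩
    rw [show k + 2 - 1 = k + 1 by omega, Nat.add_sub_cancel, div_eq_iff (by positivity),
      show (s ^ (k + 1)) ^ 2 = s ^ (k + 2) * s ^ k by ring]
    field_simp
  · obtain rfl : n = 1 := by omega
    simp

/-- Γ_{0,q} is a constant times (ρ²)^{1-n} times a smooth form; the product rule produces the common
denominator (ρ²)^n. -/
lemma delbarZeta_GammaKer (hρ : IsDistance g ρ) (hn : 1 ≤ n) (q : ℕ) {ζ z : Cn n} (hne : ζ ≠ z) :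
    delbarZeta (GammaKer ρ q) ζ z = ((ρ ζ z ^ (2 * n) : ℝ) : ℂ)⁻¹ • gammaNumer ρ q ζ z := by
  set c : ℂ := ((n - 2).factorial : ℂ) / (2 * (Real.pi : ℂ) ^ n) with hc
  have hS : rhoSqC ρ ζ z ≠ 0 := Complex.ofReal_ne_zero.2 (pow_pos (hρ.pos _ _ hne) 2).ne'
  have hG : ∀ w, GammaKer ρ q w z = (c * (rhoSqC ρ w z ^ (n - 1))⁻¹) • mixedPow ρ q w z := by
    intro w
    have : ((ρ w z ^ (2 * n - 2) : ℝ) : ℂ) = rhoSqC ρ w z ^ (n - 1) := by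
      rw [rhoSqC, ← Complex.ofReal_pow, ← pow_mul, show 2 * (n - 1) = 2 * n - 2 by omega]
    rw [GammaKer, this]
    rfl
  have hX : DifferentiableAt ℝ (fun w => mixedPow ρ q w z) ζ :=
    (hasFDerivAt_onProd_left (p := (ζ, z))
      ((contDiff_mixedPow hρ q).differentiable (by simp)).differentiableAt).differentiableAt
  have hs : DifferentiableAt ℝ (fun w => rhoSqC ρ w z) ζ :=
    (hasFDerivAt_onProd_left (p := (ζ, z))
      (hρ.contDiff_rhoSqC.differentiable (by simp)).differentiableAt).differentiableAt
  have hinv : HasDerivAt (fun s : ℂ => c * (s ^ (n - 1))⁻¹)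
      (c * (-((n - 1 : ℕ) : ℂ) * (rhoSqC ρ ζ z ^ n)⁻¹)) (rhoSqC ρ ζ z) := by
    have h := ((hasDerivAt_pow (n - 1) (rhoSqC ρ ζ z)).fun_inv (pow_ne_zero _ hS)).const_mul c
    rwa [inv_pow_deriv_aux hn hS] at h
  have hu : HasFDerivAt (fun w => c * (rhoSqC ρ w z ^ (n - 1))⁻¹) _ ζ :=
    HasFDerivAt.comp (g := fun s : ℂ => c * (s ^ (n - 1))⁻¹) (f := fun w => rhoSqC ρ w z) ζ
      (hinv.hasFDerivAt.restrictScalars ℝ) hs.hasFDerivAt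
  have hdu : ∀ j, ddbar j (fun w => c * (rhoSqC ρ w z ^ (n - 1))⁻¹) ζ =
      c * (-((n - 1 : ℕ) : ℂ) * (rhoSqC ρ ζ z ^ n)⁻¹) * ddbar j (fun w => rhoSqC ρ w z) ζ := by
    intro j
    rw [ddbar, hu.fderiv, ddbar]
    simp
    ring
  have hpow : ((ρ ζ z ^ (2 * n) : ℝ) : ℂ) = rhoSqC ρ ζ z ^ n := by
    rw [rhoSqC, ← Complex.ofReal_pow, ← pow_mul]
  have hpow2 : (rhoSqC ρ ζ z ^ (n - 1))⁻¹ = (rhoSqC ρ ζ z ^ n)⁻¹ * rhoSqC ρ ζ z := by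
    obtain ⟨k, rfl⟩ : ∃ k, n = k + 1 := ⟨n - 1, by omega⟩
    rw [Nat.add_sub_cancel, pow_succ]
    field_simp
  rw [hpow, gammaNumer, Finset.smul_sum]
  unfold delbarZeta
  refine Finset.sum_congr rfl fun j _ => ?_
  rw [show (fun w => GammaKer ρ q w z) =
      fun w => (c * (rhoSqC ρ w z ^ (n - 1))⁻¹) • mixedPow ρ q w z from funext hG,
    ddbar_smul j hu.differentiableAt hX, hdu, hpow2, ← wedge_smul]
  congr 1
  module

/-- The numerator of the isotropic part over `ρ^{2n}`. -/
def isotropicNumer (r γ χ : Cn n → ℝ) (g : Cn n → Matrix (Fin n) (Fin n) ℂ)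
    (ρ φ : Cn n → Cn n → ℝ) (q : ℕ) (ε : ℝ) : Kernel n := fun ζ z =>
  (((ρ ζ z ^ 2) ^ n * (1 - splitWeight r ρ φ ε ζ z) : ℝ) : ℂ) • homotopyKer r γ χ g ρ φ q ε ζ z +
    gammaNumer ρ q ζ z

lemma isotropicPart_eq (hρ : IsDistance g ρ) (hn : 1 ≤ n) (q : ℕ) (ε : ℝ) {ζ z : Cn n}
    (hne : ζ ≠ z) : isotropicPart r γ χ g ρ φ q ε ζ z =
      ((ρ ζ z ^ (2 * n) : ℝ) : ℂ)⁻¹ • isotropicNumer r γ χ g ρ φ q ε ζ z := by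
  have h0 : ((ρ ζ z ^ (2 * n) : ℝ) : ℂ) ≠ 0 := Complex.ofReal_ne_zero.2 (pow_pos (hρ.pos _ _ hne) _).ne'
  rw [isotropicPart, isotropicNumer, delbarZeta_GammaKer hρ hn q hne, ← pow_mul, smul_add, smul_smul,
    Complex.ofReal_mul, inv_mul_cancel_left₀ h0]

/-- Of the n factors ρ², n - 1 are dominated by P_ε and cancel P_ε^{-(n-1)}. The last one is O(|ζ -
z|²), which turns the remaining 1/|ζ - z| into |ζ - z|. -/
lemma exists_isotropicNumer_bound (hr : IsHenkinLeiterer r U) (hg : IsLeviMetric r U g)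
    (hγ : IsGamma r U g γ) (hρ : IsDistance g ρ) (hφ : IsPatching ρ κ φ) (hκ : 0 < κ)
    (hχ : IsCutoff r δ χ) (hc : 0 < c)
    (hlow : ∀ ε ∈ Set.Ioo (0 : ℝ) 1, ∀ ζ ∈ closure (domEps r ε),
        ∀ z ∈ closure (domEps r ε), -m ≤ r ζ →
          c * (-(r ζ + ε) + -(r z + ε) + ‖ζ - z‖ ^ 2) ≤ (phi r ρ φ ε ζ z).re)
    (hδ : 3 / 2 * δ < m) (hn : 1 ≤ n) (q : ℕ) : ∃ C : ℝ, 0 ≤ C ∧ ∀ ε ∈ Set.Ioo (0 : ℝ) 1,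
      ∀ p ∈ kerDom r ε, ‖isotropicNumer r γ χ g ρ φ q ε p.1 p.2‖ ≤ C * ‖p.1 - p.2‖ := by
  obtain ⟨R, hR⟩ := hr.exists_ball
  obtain ⟨A, hA0, hA⟩ := exists_second_order_bound hρ.contDiff_rhoSq R hρ.rhoSq_self
    hρ.fderiv_rhoSq_self
  obtain ⟨B, hB0, hB⟩ := exists_vanishing_bound (contDiff_gammaNumer hρ q) R
    (fun x => gammaNumer_self hρ q x)
  obtain ⟨C, hC0, hC⟩ := exists_split_bound hr hg hγ hρ hφ hκ hχ hc hlow hδ q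
  refine ⟨A * C + B, by positivity, fun ε hε p hp => ?_⟩
  have hsub := closure_domEps_subset_dom hr.smooth.continuous hε.1
  have h1R := hR (subset_closure (hsub hp.1.1))
  have h2R := hR (subset_closure (hsub hp.1.2))
  rw [isotropicNumer, add_mul]
  refine (norm_add_le _ _).trans (add_le_add ?_ (hB p.1 h1R p.2 h2R))
  by_cases hne : p.1 = p.2
  · rw [hne, hρ.rho_self, zero_pow two_ne_zero, zero_pow (by omega), zero_mul, Complex.ofReal_zero,
      zero_smul, norm_zero]
    positivity
  · have h1 := (hC ε hε p hp).2 hne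
    have h2 : ρ p.1 p.2 ^ 2 ≤ A * ‖p.1 - p.2‖ ^ 2 := (le_abs_self _).trans (hA p.1 h1R p.2 h2R)
    have h3 := rhoSq_le_PP (ρ := ρ) hr.smooth.continuous hγ hε.1 hp.1.1 hp.1.2
    have hP := PP_pos hr.smooth.continuous hγ hρ hε.1 hp
    have hd : 0 < ‖p.1 - p.2‖ := norm_pos_iff.2 (sub_ne_zero.2 hne)
    rw [Complex.ofReal_mul, mul_smul, norm_smul, Complex.norm_real, Real.norm_of_nonneg (by positivity)]
    set N := ‖((1 - splitWeight r ρ φ ε p.1 p.2 : ℝ) : ℂ) • homotopyKer r γ χ g ρ φ q ε p.1 p.2‖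
    have hN : 0 ≤ N := norm_nonneg _
    set d := ‖p.1 - p.2‖
    calc (ρ p.1 p.2 ^ 2) ^ n * N = ρ p.1 p.2 ^ 2 * (N * (ρ p.1 p.2 ^ 2) ^ (n - 1)) := by
          rw [← mul_pow_sub_one (by omega : n ≠ 0) (ρ p.1 p.2 ^ 2)]
          ring
      _ ≤ A * d ^ 2 * (N * PP r γ ρ ε p.1 p.2 ^ (n - 1)) := by gcongr
      _ ≤ A * d ^ 2 * (C * d⁻¹) := by gcongr
      _ = A * C * d := by field_simp

lemma contDiffAt_isotropicNumer (hr : IsHenkinLeiterer r U) (hg : IsLeviMetric r U g)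
    (hγ : IsGamma r U g γ) (hρ : IsDistance g ρ) (hφ : IsPatching ρ κ φ)
    (hχ : IsCutoff r δ χ) (hc : 0 < c)
    (hlow : ∀ ε ∈ Set.Ioo (0 : ℝ) 1, ∀ ζ ∈ closure (domEps r ε),
        ∀ z ∈ closure (domEps r ε), -m ≤ r ζ →
          c * (-(r ζ + ε) + -(r z + ε) + ‖ζ - z‖ ^ 2) ≤ (phi r ρ φ ε ζ z).re)
    (hδ : 3 / 2 * δ < m) (q : ℕ) {ε : ℝ} (hε : ε ∈ Set.Ioo (0 : ℝ) 1) {p : Cn n × Cn n}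
    (hp : p ∈ kerDom r ε) :
    ContDiffAt ℝ ∞ (onProd (isotropicNumer r γ χ g ρ φ q ε)) p :=
  (contDiffAt_smul_homotopyKer hr hg hγ hρ hφ hχ q hε.1 hp
    (u := fun ζ z => (((ρ ζ z ^ 2) ^ n * (1 - splitWeight r ρ φ ε ζ z) : ℝ) : ℂ))
    ((phi_ne_zero_or hr.smooth.continuous hc hlow hδ hε hp).imp_left And.right) fun h0 =>
    Complex.ofRealCLM.contDiff.contDiffAt.comp p ((hρ.contDiff_rhoSq.contDiffAt.pow n).mul
      (contDiffAt_const.sub (contDiffAt_splitWeight hr.smooth hρ hφ ε h0)))).add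
    (contDiff_gammaNumer hρ q).contDiffAt

lemma isIsotropic_isotropicPart (hr : IsHenkinLeiterer r U) (hg : IsLeviMetric r U g)
    (hγ : IsGamma r U g γ) (hρ : IsDistance g ρ) (hφ : IsPatching ρ κ φ) (hκ : 0 < κ)
    (hχ : IsCutoff r δ χ) (hc : 0 < c)
    (hlow : ∀ ε ∈ Set.Ioo (0 : ℝ) 1, ∀ ζ ∈ closure (domEps r ε),
        ∀ z ∈ closure (domEps r ε), -m ≤ r ζ →
          c * (-(r ζ + ε) + -(r z + ε) + ‖ζ - z‖ ^ 2) ≤ (phi r ρ φ ε ζ z).re)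
    (hδ : 3 / 2 * δ < m) (hn : 1 ≤ n) (q : ℕ) :
    IsIsotropic r γ ρ 1 (1 - 2 * n) (isotropicPart r γ χ g ρ φ q) := by
  obtain ⟨C, hC0, hC⟩ := exists_isotropicNumer_bound hr hg hγ hρ hφ hκ hχ hc hlow hδ hn q
  -- A numerator of first order over ρ^{2n} gives exactly 1 - 2n.
  refine ⟨1, n, isotropicNumer r γ χ g ρ φ q, by norm_num, ⟨fun _ => 1, isWeight_one, C,
    fun ε hε => ⟨fun p hp => ?_, fun p hp => ?_⟩⟩, fun ε hε ζ hζ z hz hne => ?_⟩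
  · exact (contDiffAt_isotropicNumer hr hg hγ hρ hφ hχ hc hlow hδ q hε hp).contDiffWithinAt
  · simpa using hC ε hε p hp
  · exact isotropicPart_eq hρ hn q ε hne

/-- The isotropic part is bounded by a multiple of `|ζ - z|^{1-2n}`. -/
lemma exists_isotropicPart_bound (hr : IsHenkinLeiterer r U) (hg : IsLeviMetric r U g)
    (hγ : IsGamma r U g γ) (hρ : IsDistance g ρ) (hφ : IsPatching ρ κ φ) (hκ : 0 < κ)
    (hχ : IsCutoff r δ χ) (hc : 0 < c)
    (hlow : ∀ ε ∈ Set.Ioo (0 : ℝ) 1, ∀ ζ ∈ closure (domEps r ε),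
        ∀ z ∈ closure (domEps r ε), -m ≤ r ζ →
          c * (-(r ζ + ε) + -(r z + ε) + ‖ζ - z‖ ^ 2) ≤ (phi r ρ φ ε ζ z).re)
    (hδ : 3 / 2 * δ < m) (hn : 1 ≤ n) (q : ℕ) : ∃ C : ℝ, 0 ≤ C ∧ ∀ ε ∈ Set.Ioo (0 : ℝ) 1,
      ∀ ζ ∈ closure (domEps r ε), ∀ z ∈ closure (domEps r ε), ζ ≠ z →
        ‖isotropicPart r γ χ g ρ φ q ε ζ z‖ ≤ C * (‖ζ - z‖ ^ (2 * n - 1))⁻¹ := by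
  obtain ⟨R, hR⟩ := hr.exists_ball
  obtain ⟨c', hc', hlow'⟩ := hρ.exists_lower hg.smooth hg.posDef R
  obtain ⟨C, hC0, hC⟩ := exists_isotropicNumer_bound hr hg hγ hρ hφ hκ hχ hc hlow hδ hn q
  refine ⟨(c' ^ n)⁻¹ * C, by positivity, fun ε hε ζ hζ z hz hne => ?_⟩
  have hsub := closure_domEps_subset_dom hr.smooth.continuous hε.1
  have hd : 0 < ‖ζ - z‖ := norm_pos_iff.2 (sub_ne_zero.2 hne)
  have h1 := hC ε hε (ζ, z) (diff_diagonal_subset_kerDom ε ⟨⟨hζ, hz⟩, hne⟩)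
  have h2 := hlow' ζ (hR (subset_closure (hsub hζ))) z (hR (subset_closure (hsub hz)))
  rw [isotropicPart_eq hρ hn q ε hne, norm_smul, norm_inv, Complex.norm_real, pow_mul,
    Real.norm_of_nonneg (by positivity)]
  calc _ ≤ ((c' * ‖ζ - z‖ ^ 2) ^ n)⁻¹ * (C * ‖ζ - z‖) := by
        gcongr
    _ = _ := by
      have : ‖ζ - z‖ ^ (2 * n) = ‖ζ - z‖ ^ (2 * n - 1) * ‖ζ - z‖ := by
        rw [← pow_succ, Nat.sub_add_cancel (by omega)]
      rw [mul_pow, ← pow_mul, this]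
      field_simp

end Families

/-! ### The operators -/

section Operators

variable {n : ℕ} {r : Cn n → ℝ} {U : Set (Cn n)} {g : Cn n → Matrix (Fin n) (Fin n) ℂ}
  {ρ φ : Cn n → Cn n → ℝ} {γ χ : Cn n → ℝ} {κ δ : ℝ}

/-- The pairing of a form with a double form by the wedge product. -/
def topPairing : Form n →L[ℝ] DForm n →L[ℝ] Form n :=
  (LinearMap.mk₂ ℝ (fun (F : Form n) (Q : DForm n) => (fun B =>
      wedge (inclZeta F) Q (Finset.univ, B) * ((Complex.I / 2) ^ n)⁻¹ : Form n))
    (fun F F' Q => by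
      have : inclZeta (F + F') = inclZeta F + inclZeta F' := by
        funext S
        simp only [inclZeta, Pi.add_apply]
        split_ifs <;> simp
      funext B
      rw [this, add_wedge, Pi.add_apply, Pi.add_apply, add_mul])
    (fun c F Q => by
      have : inclZeta (c • F) = (c : ℂ) • inclZeta F := by
        funext S
        simp only [inclZeta, Pi.smul_apply, smul_eq_mul, Complex.real_smul]
        split_ifs <;> simp
      funext B
      rw [this, smul_wedge, Pi.smul_apply, Pi.smul_apply, smul_eq_mul, Complex.real_smul, mul_assoc])
    (fun F Q Q' => by
      funext B
      rw [wedge_add, Pi.add_apply, Pi.add_apply, add_mul])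
    (fun c F Q => by
      funext B
      rw [show c • Q = (c : ℂ) • Q from rfl, wedge_smul, Pi.smul_apply, Pi.smul_apply, smul_eq_mul,
        Complex.real_smul, mul_assoc])).toContinuousBilinearMap

/-- Writing the integrand through continuous linear and bilinear maps makes its measurability and
its size immediate. -/
lemma integrand_eq (K : Kernel n) (f : Cn n → Form n) (z ζ : Cn n) :
    integrand g K f z ζ = topPairing (f ζ) (starCLM (starCoeff (g ζ)) (conjCLM (K ζ z))) := by
  rw [← starZeta_eq]
  rfl

lemma integrand_add (K K' : Kernel n) (f : Cn n → Form n) (z ζ : Cn n) :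
    integrand g (fun ζ z => K ζ z + K' ζ z) f z ζ = integrand g K f z ζ + integrand g K' f z ζ := by
  simp only [integrand_eq, map_add]

lemma exists_integrand_bound (hg : ContDiff ℝ ∞ (fun x => starCoeff (g x))) {S : Set (Cn n)}
    (hS : IsCompact S) : ∃ C : ℝ, 0 ≤ C ∧ ∀ (K : Kernel n) (f : Cn n → Form n), ∀ ζ ∈ S, ∀ z,
      ‖integrand g K f z ζ‖ ≤ C * (‖f ζ‖ * ‖K ζ z‖) := by
  obtain ⟨A, hA0, hA⟩ := exists_starZeta_bound hg hS
  have hN : 0 ≤ ‖(conjCLM : DForm n →L[ℝ] DForm n)‖ := ContinuousLinearMap.opNorm_nonneg _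
  have hT : 0 ≤ ‖(topPairing : Form n →L[ℝ] DForm n →L[ℝ] Form n)‖ :=
    ContinuousLinearMap.opNorm_nonneg _
  refine ⟨‖(topPairing : Form n →L[ℝ] DForm n →L[ℝ] Form n)‖ *
    (A * ‖(conjCLM : DForm n →L[ℝ] DForm n)‖), by positivity, fun K f ζ hζ z => ?_⟩
  have h1 : ‖conjCLM (K ζ z)‖ ≤ ‖(conjCLM : DForm n →L[ℝ] DForm n)‖ * ‖K ζ z‖ :=
    (conjCLM (n := n)).le_opNorm _
  have h2 := hA ζ hζ (conjCLM (K ζ z))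
  rw [starZeta_eq] at h2
  rw [integrand_eq]
  calc _ ≤ ‖(topPairing : Form n →L[ℝ] DForm n →L[ℝ] Form n)‖ * ‖f ζ‖ *
        (A * (‖(conjCLM : DForm n →L[ℝ] DForm n)‖ * ‖K ζ z‖)) :=
        (ContinuousLinearMap.le_opNorm₂ _ _ _).trans (by gcongr; exact h2.trans (by gcongr))
    _ = _ := by ring

/-- The point z is a null set, so continuity and a bound away from z suffice. The condition n ≥ 1 is
needed for points to be null. -/
lemma integrableOn_integrand (hn : 1 ≤ n) (hg : ContDiff ℝ ∞ (fun x => starCoeff (g x)))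
    {S T : Set (Cn n)} (hS : MeasurableSet S) (hT : IsCompact T) (hST : S ⊆ T) {K : Kernel n}
    {f : Cn n → Form n} {z : Cn n} {k : Cn n → ℝ}
    (hf : AEStronglyMeasurable f (volume.restrict S))
    (hK : ContinuousOn (fun ζ => K ζ z) (S \ {z}))
    (hk : ∀ ζ ∈ S \ {z}, ‖K ζ z‖ ≤ k ζ) (hint : IntegrableOn (fun ζ => ‖f ζ‖ * k ζ) S) :
    IntegrableOn (integrand g K f z) S := by
  have : Nonempty (Fin n) := ⟨⟨0, hn⟩⟩
  obtain ⟨C, hC0, hC⟩ := exists_integrand_bound hg hT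
  have hnull : (volume : Measure (Cn n)) {z} = 0 := measure_singleton z
  have hres : (volume : Measure (Cn n)).restrict (S \ {z}) = volume.restrict S :=
    Measure.restrict_congr_set (sdiff_null_ae_eq_self hnull)
  have hms : MeasurableSet (S \ {z}) := hS.diff (measurableSet_singleton z)
  have hKm : AEStronglyMeasurable (fun ζ => K ζ z) (volume.restrict S) := by
    rw [← hres]
    exact hK.aestronglyMeasurable hms
  have hm : AEStronglyMeasurable (integrand g K f z) (volume.restrict S) := by
    rw [show integrand g K f z = _ from funext fun ζ => integrand_eq K f z ζ]
    exact topPairing.aestronglyMeasurable_comp₂ hf (starCLM.aestronglyMeasurable_comp₂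
      hg.continuous.aestronglyMeasurable
      ((conjCLM (n := n)).continuous.comp_aestronglyMeasurable hKm))
  refine Integrable.mono' (hint.const_mul C) hm ?_
  rw [← hres]
  refine (ae_restrict_iff' hms).2 (Filter.Eventually.of_forall fun ζ hζ => ?_)
  refine (hC K f ζ (hST hζ.1) z).trans ?_
  exact mul_le_mul_of_nonneg_left
    (mul_le_mul_of_nonneg_left (hk ζ hζ) (norm_nonneg _)) hC0

/-- Almost everywhere absolute convergence of the weakly singular integrals. -/
lemma ae_integrableOn_rieszKernel (hn : 1 ≤ n) {S : Set (Cn n)} (hS : MeasurableSet S) {R : ℝ}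
    (hSR : S ⊆ Metric.closedBall 0 R) {f : Cn n → ℝ} (hf : IntegrableOn f S) :
    ∀ᵐ z ∂(volume : Measure (Cn n)).restrict S,
      IntegrableOn (fun ζ => f ζ * (‖ζ - z‖ ^ (2 * n - 1))⁻¹) S := by
  have : Nonempty (Fin n) := ⟨⟨0, hn⟩⟩
  -- The kernel is truncated at 2R + 1, beyond every distance occurring in the ball, so that it
  -- becomes integrable on the whole space.
  set k : ℝ → ℝ := fun y => if y < 2 * R + 1 then (y ^ (2 * n - 1))⁻¹ else 0 with hkdef
  -- In polar coordinates in real dimension 2n the Jacobian y^{2n-1} cancels the singularity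
  -- exactly, leaving the constant 1 on a bounded interval.
  have hk : Integrable (fun x : Cn n => k ‖x‖) := by
    rw [integrable_fun_norm_addHaar]
    have hfin : Module.finrank ℝ (Cn n) = 2 * n := by
      rw [finrank_real_of_complex, finrank_euclideanSpace_fin]
    rw [hfin]
    have h1 : IntegrableOn (fun _ : ℝ => (1 : ℝ)) (Set.Ioo 0 (2 * R + 1)) :=
      integrableOn_const (by simp)
    have h2 := (integrable_indicator_iff measurableSet_Ioo).2 h1
    refine (h2.integrableOn (s := Set.Ioi 0)).congr_fun (fun y hy => ?_) measurableSet_Ioi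
    have hy0 : 0 < y := hy
    simp only [hkdef, smul_eq_mul, Set.indicator_apply, Set.mem_Ioo, hy0, true_and]
    split_ifs
    · rw [mul_inv_cancel₀ (by positivity)]
    · rw [mul_zero]
  have hfS : Integrable (S.indicator f) := (integrable_indicator_iff hS).2 hf
  -- The convolution of two integrable functions converges absolutely almost everywhere.
  have hconv := Integrable.ae_convolution_exists (ContinuousLinearMap.mul ℝ ℝ) hfS hk
  refine (ae_restrict_iff' hS).2 (hconv.mono fun z hz hzS => ?_)
  refine (hz.integrableOn (s := S)).congr_fun (fun ζ hζ => ?_) hS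
  have h1 : ‖z‖ ≤ R := by simpa using hSR hzS
  have h2 : ‖ζ‖ ≤ R := by simpa using hSR hζ
  have h3 : ‖ζ - z‖ < 2 * R + 1 := by
    have := norm_sub_le ζ z
    linarith
  simp only [Set.indicator_of_mem hζ, ContinuousLinearMap.mul_apply', hkdef, norm_sub_rev z ζ,
    if_pos h3]

variable {c m : ℝ}

/-- As D_ε has finite measure, f is integrable, and the weakly singular bound |ζ - z|^{1-2n} handles
the isotropic part for almost every z. Additivity of the integral then gives the operator identity.
-/
lemma ae_operators (hr : IsHenkinLeiterer r U) (hg : IsLeviMetric r U g)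
    (hγ : IsGamma r U g γ) (hρ : IsDistance g ρ) (hφ : IsPatching ρ κ φ) (hκ : 0 < κ)
    (hχ : IsCutoff r δ χ) (hc : 0 < c)
    (hlow : ∀ ε ∈ Set.Ioo (0 : ℝ) 1, ∀ ζ ∈ closure (domEps r ε),
        ∀ z ∈ closure (domEps r ε), -m ≤ r ζ →
          c * (-(r ζ + ε) + -(r z + ε) + ‖ζ - z‖ ^ 2) ≤ (phi r ρ φ ε ζ z).re)
    (hδ : 3 / 2 * δ < m) (hn : 1 ≤ n) (q : ℕ) {ε : ℝ} (hε : ε ∈ Set.Ioo (0 : ℝ) 1)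
    {f : Cn n → Form n} (hf : MemLp f 2 (volume.restrict (domEps r ε))) :
    ∀ᵐ z ∂volume.restrict (domEps r ε),
      IntegrableOn (integrand g (isotropicPart r γ χ g ρ φ q ε) f z) (domEps r ε) ∧
      IntegrableOn (integrand g (admissiblePart r γ χ g ρ φ q ε) f z) (domEps r ε) ∧
      kernelOp r g ε (TKer r γ χ g ρ φ q ε) f z =
        kernelOp r g ε (isotropicPart r γ χ g ρ φ q ε) f z +
          kernelOp r g ε (admissiblePart r γ χ g ρ φ q ε) f z := by
  obtain ⟨R, hR⟩ := hr.exists_ball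
  have hrc := hr.smooth.continuous
  have hSo := isOpen_domEps hrc ε
  have hSm : MeasurableSet (domEps r ε) := hSo.measurableSet
  have hcd := closure_domEps_subset_dom hrc hε.1
  have hSd : domEps r ε ⊆ closure (dom r) := subset_closure.trans (hcd.trans subset_closure)
  have hcpt : IsCompact (closure (domEps r ε)) :=
    hr.isCompact_closure.of_isClosed_subset isClosed_closure (hcd.trans subset_closure)
  have hgs := contDiff_starCoeff hg.smooth hg.posDef
  have hfin : IsFiniteMeasure ((volume : Measure (Cn n)).restrict (domEps r ε)) :=
    ⟨by
      rw [Measure.restrict_apply_univ]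
      exact (measure_mono subset_closure).trans_lt hcpt.measure_lt_top⟩
  have hfi : IntegrableOn (fun ζ => ‖f ζ‖) (domEps r ε) := (hf.integrable (by norm_num)).norm
  obtain ⟨C, hC0, hC⟩ := exists_isotropicPart_bound hr hg hγ hρ hφ hκ hχ hc hlow hδ hn q
  filter_upwards [ae_integrableOn_rieszKernel hn hSm (hSd.trans hR) hfi,
    ae_restrict_mem hSm] with z hz hzS
  have hzc := subset_closure hzS
  have hmem : ∀ ζ ∈ closure (domEps r ε), (ζ, z) ∈ kerDom r ε := fun ζ hζ =>
    ⟨⟨hζ, hzc⟩, fun h => by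
      have h2 : ζ = z := h.1
      have h3 : z ∈ frontier (domEps r ε) := h2 ▸ h.2
      rw [hSo.frontier_eq] at h3
      exact h3.2 hzS⟩
  have hE : IntegrableOn (integrand g (isotropicPart r γ χ g ρ φ q ε) f z) (domEps r ε) := by
    refine integrableOn_integrand hn hgs hSm hr.isCompact_closure hSd hf.1
      (k := fun ζ => C * (‖ζ - z‖ ^ (2 * n - 1))⁻¹) ?_
      (fun ζ hζ => hC ε hε ζ (subset_closure hζ.1) z hzc hζ.2) ?_
    · have h1 : ContinuousOn (fun ζ => ((ρ ζ z ^ (2 * n) : ℝ) : ℂ)⁻¹ •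
          isotropicNumer r γ χ g ρ φ q ε ζ z) (domEps r ε \ {z}) := by
        intro ζ hζ
        have hd := (contDiffAt_isotropicNumer hr hg hγ hρ hφ hχ hc hlow hδ q hε
          (hmem ζ (subset_closure hζ.1))).continuousAt
        have hc1 : ContinuousAt (fun ζ' : Cn n => isotropicNumer r γ χ g ρ φ q ε ζ' z) ζ :=
          ContinuousAt.comp (f := fun ζ' : Cn n => (ζ', z)) hd (by fun_prop)
        have hc2 : ContinuousAt (fun ζ' : Cn n => ((ρ ζ' z ^ (2 * n) : ℝ) : ℂ)) ζ := by
          simp only [pow_mul]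
          exact Complex.continuous_ofReal.continuousAt.comp (((hρ.contDiff_rhoSq.continuous.comp
            (by fun_prop : Continuous fun ζ' : Cn n => (ζ', z))).pow n).continuousAt)
        exact ((hc2.inv₀ (Complex.ofReal_ne_zero.2 (pow_pos (hρ.pos _ _ hζ.2) _).ne')).smul
          hc1).continuousWithinAt
      exact h1.congr fun ζ hζ => isotropicPart_eq hρ hn q ε hζ.2
    · refine (hz.const_mul C).congr (Filter.Eventually.of_forall fun ζ => ?_)
      ring
  have hA : IntegrableOn (integrand g (admissiblePart r γ χ g ρ φ q ε) f z) (domEps r ε) := by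
    -- For z in the open set D_ε no pair (ζ, z) lies on the boundary diagonal. The admissible part
    -- is then continuous in ζ on the compact closure, and bounded; this bound may depend on z and
    -- ε.
    have hcont : ContinuousOn (fun ζ => admissiblePart r γ χ g ρ φ q ε ζ z)
        (closure (domEps r ε)) := fun ζ hζ =>
      (ContinuousAt.comp (f := fun ζ' : Cn n => (ζ', z))
        (contDiffAt_admissiblePart hr hg hγ hρ hφ hχ hc hlow hδ q hε (hmem ζ hζ)).continuousAt
        (by fun_prop)).continuousWithinAt
    obtain ⟨B, hB⟩ := hcpt.exists_bound_of_continuousOn hcont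
    exact integrableOn_integrand hn hgs hSm hr.isCompact_closure hSd hf.1 (k := fun _ => B)
      (hcont.mono (Set.sdiff_subset.trans subset_closure))
      (fun ζ hζ => hB ζ (subset_closure hζ.1)) (hfi.mul_const B)
  refine ⟨hE, hA, ?_⟩
  rw [kernelOp, kernelOp, kernelOp, ← integral_add hE hA]
  refine congrArg _ (funext fun ζ => ?_)
  rw [← integrand_add]
  congr 1
  funext ζ z
  exact TKer_eq q ε ζ z

end Operators

end

end HL

/-! ### Choice of κ₀, δ₀ and ε₀, and conclusion -/

theorem mainTheorem5 (n q : ℕ) (hq : 1 ≤ q) (hqn : q < n)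
    (r : HL.Cn n → ℝ) (U : Set (HL.Cn n)) (hr : HL.IsHenkinLeiterer r U)
    (g : HL.Cn n → Matrix (Fin n) (Fin n) ℂ) (hg : HL.IsLeviMetric r U g)
    (ρ : HL.Cn n → HL.Cn n → ℝ) (hρ : HL.IsDistance g ρ)
    (γ : HL.Cn n → ℝ) (hγ : HL.IsGamma r U g γ) :
    ∃ κ₀ > (0 : ℝ), ∀ κ ∈ Set.Ioo 0 κ₀, ∃ δ₀ > (0 : ℝ), ∀ δ ∈ Set.Ioo 0 δ₀,
      ∀ (φ : HL.Cn n → HL.Cn n → ℝ) (χ : HL.Cn n → ℝ),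
        HL.IsPatching ρ κ φ → HL.IsCutoff r δ χ →
        ∃ ε₀ > (0 : ℝ), ∃ E A : ℝ → HL.Kernel n,
          HL.IsIsotropic r γ ρ ε₀ (1 - 2 * n) E ∧
          HL.IsAdmissible r γ ρ φ ε₀ 1 A ∧
          ∀ ε ∈ Set.Ioo 0 ε₀,
            (∀ ζ ∈ closure (HL.domEps r ε), ∀ z ∈ closure (HL.domEps r ε), ζ ≠ z →
              HL.TKer r γ χ g ρ φ q ε ζ z = E ε ζ z + A ε ζ z) ∧
            ∀ f : HL.Cn n → HL.Form n, MemLp f 2 (volume.restrict (HL.domEps r ε)) →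
              ∀ᵐ z ∂volume.restrict (HL.domEps r ε),
                IntegrableOn (HL.integrand g (E ε) f z) (HL.domEps r ε) ∧
                IntegrableOn (HL.integrand g (A ε) f z) (HL.domEps r ε) ∧
                HL.kernelOp r g ε (HL.TKer r γ χ g ρ φ q ε) f z =
                  HL.kernelOp r g ε (E ε) f z + HL.kernelOp r g ε (A ε) f z := by
  have hn : 1 ≤ n := by omega
  obtain ⟨κ₀, hκ₀, m, hm, hφlow⟩ := HL.exists_phi_lower hr hg hρ
  -- With δ < m/2 the support of χ lies in |r| < m, the collar in which the lower bound for Re φ_ε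
  -- holds. All bounds are uniform for 0 < ε < 1, so ε₀ = 1 will do.
  refine ⟨κ₀, hκ₀, fun κ hκ => ⟨m / 2, by positivity, fun δ hδ φ χ hφ hχ => ?_⟩⟩
  obtain ⟨c, hc, hlow⟩ := hφlow κ hκ φ hφ
  have hδm : 3 / 2 * δ < m := by
    have := hδ.2
    linarith
  exact ⟨1, one_pos, HL.isotropicPart r γ χ g ρ φ q, HL.admissiblePart r γ χ g ρ φ q,
    HL.isIsotropic_isotropicPart hr hg hγ hρ hφ hκ.1 hχ hc hlow hδm hn q,
    HL.isAdmissible_admissiblePart hr hg hγ hρ hφ hκ.1 hχ hc hlow hδm hn q,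
    fun ε hε => ⟨fun ζ _ z _ _ => HL.TKer_eq q ε ζ z,
      fun f hf => HL.ae_operators hr hg hγ hρ hφ hκ.1 hχ hc hlow hδm hn q hε hf⟩⟩
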